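/- Conventions. A \emph{locally $C^*$-algebra} is a complete Hausdorff complex topological $*$-algebra $\mathcal A$ whose topology is given by an upward filtered family $\{p_\lambda\}_{\lambda\in\Lambda}$ of $C^*$-seminorms; $p_\lambda^n$ denotes the induced $C^*$-seminorm on $M_n(\mathcal A)$. For $a\in M_n(\mathcal A)$ write $a\ge_\lambda 0$ if $a=b^*b+c$ with $b,c\in M_n(\mathcal A)$ and $p_\lambda^n(c)=0$, and $a=_\lambda 0$ if $p_\lambda^n(a)=0$. A \emph{quantized domain} $\mathcal E=\{\mathcal H_\iota\}_{\iota\in\Upsilon}$ in a complex Hilbert space $\mathcal H$ is a nonempty upward filtered family of closed subspaces whose union $\mathcal D_{\mathcal E}$ is dense in $\mathcal H$. $C^*(\mathcal D_{\mathcal E})$ is the locally $C^*$-algebra of all linear operators $T$ on $\mathcal D_{\mathcal E}$ such that, for each $\iota$, $T\mathcal H_\iota\subseteq\mathcal H_\iota$, $T|_{\mathcal H_\iota}$ is bounded and $T(\mathcal H_\iota^\perp\cap\mathcal D_{\mathcal E})\subseteq\mathcal H_\iota^\perp\cap\mathcal D_{\mathcal E}$, with involution $T^*=T^{\bigstar}|_{\mathcal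 D_{\mathcal E}}$ (the restricted Hilbert space adjoint) and $C^*$-seminorms $\|T\|_\iota=\|T|_{\mathcal H_\iota}\|$. For a quantized domain $\mathcal F=\{\mathcal K_\gamma\}_{\gamma\in\Gamma}$ in $\mathcal K$, $\mathcal E\otimes\mathcal F=\{\mathcal H_\iota\otimes\mathcal K_\gamma\}$ is a quantized domain in the Hilbert space $\mathcal H\otimes\mathcal K$, and $T\otimes S\in C^*(\mathcal D_{\mathcal E\otimes\mathcal F})$, for $T\in C^*(\mathcal D_{\mathcal E})$ and $S\in C^*(\mathcal D_{\mathcal F})$, is given by $(T\otimes S)(\xi\otimes\eta)=T\xi\otimes S\eta$. Let $\mathcal{CPCC}_{\mathrm{loc}}(\mathcal A,C^*(\mathcal D_{\mathcal E}))$ be the set of all linear maps $\varphi:\mathcal A\to C^*(\mathcal D_{\mathcal E})$ that are \emph{local completely positive} (for each $\iota$ there is $\lambda$ such that for all $n\in\mathbb N$ and $a\in M_n(\mathcal A)$: $a\ge_\lambda0$ implies $\varphi^{(n)}(a)\ge_\iota0$, and $a=_\lambda0$ implies $\varphi^{(n)}(a)=_\iota0$) and \emph{local completely contractive} (for each $\iota$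 there is $\lambda$ such that $\|\varphi^{(n)}(a)\|_\iota^n\le p_\lambda^n(a)$ for all $n$ and all $a\in M_n(\mathcal A)$). For $\varphi,\psi$ in this set, $\psi$ is \emph{dominated} by $\varphi$ if $\varphi-\psi$ is in this set, and $\varphi$ is \emph{pure} if every $\psi$ in this set that is dominated by $\varphi$ has the form $\psi=\alpha\varphi$ with a real number $\alpha\ge0$. The minimal tensor product $\mathcal A\otimes\mathcal B$ of two locally $C^*$-algebras, with $C^*$-seminorms $\{p_\lambda\}_{\lambda\in\Lambda}$ and $\{q_\delta\}_{\delta\in\Delta}$, is the completion of the algebraic tensor product for the spatial $C^*$-seminorms given by $p_\lambda,q_\delta$, $(\lambda,\delta)\in\Lambda\times\Delta$. For $\varphi\in\mathcal{CPCC}_{\mathrm{loc}}(\mathcal A,C^*(\mathcal D_{\mathcal E}))$ and $\psi\in\mathcal{CPCC}_{\mathrm{loc}}(\mathcal B,C^*(\mathcal D_{\mathcal F}))$ with $\mathcal A,\mathcal B$ unital, $\varphi\otimes\psi$ is the unique map in $\mathcal{CPCC}_{\mathrm{loc}}(\mathcal A\otimes\mathcal B,C^*(\mathcal D_{\mathcal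 E\otimes\mathcal F}))$ with $(\varphi\otimes\psi)(a\otimes b)=\varphi(a)\otimes\psi(b)$ for all $a\in\mathcal A$, $b\in\mathcal B$. Theorem. Let $\mathcal A$ and $\mathcal B$ be unital locally $C^*$-algebras, $\mathcal E$ and $\mathcal F$ quantized domains in Hilbert spaces $\mathcal H$ and $\mathcal K$, and let $\varphi\in\mathcal{CPCC}_{\mathrm{loc}}(\mathcal A,C^*(\mathcal D_{\mathcal E}))$, $\psi\in\mathcal{CPCC}_{\mathrm{loc}}(\mathcal B,C^*(\mathcal D_{\mathcal F}))$ and $\phi\in\mathcal{CPCC}_{\mathrm{loc}}(\mathcal A\otimes\mathcal B,C^*(\mathcal D_{\mathcal E\otimes\mathcal F}))$. If $\phi$ is dominated by $\varphi\otimes\psi$ and $\varphi$ is pure, then there exists $\widetilde\psi\in\mathcal{CPCC}_{\mathrm{loc}}(\mathcal B,C^*(\mathcal D_{\mathcal F}))$ dominated by $\psi$ such that $\phi=\varphi\otimes\widetilde\psi$; in particular $\phi(a\otimes b)=\varphi(a)\otimes\widetilde\psi(b)$ for all $a\in\mathcal A$, $b\in\mathcal B$. -/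

import Mathlib

open scoped TensorProduct InnerProductSpace

noncomputable section

namespace LocCStar

universe u v

/-! ### Quantized domains and the algebra of noncommutative continuous functions -/

/-- A quantized domain in the Hilbert space `H`: an upward filtered family of closed subspaces of
`H` whose union is dense. -/
structure QuantizedDomain (ι : Type*) (H : Type*) [NormedAddCommGroup H]
    [InnerProductSpace ℂ H] where
  sub : ι → Submodule ℂ H
  isClosed_sub : ∀ i, IsClosed (sub i : Set H)
  directed_sub : Directed (· ≤ ·) sub
  dense_iUnion : Dense (⋃ i, (sub i : Set H))

section Ops

variable {ι H : Type*} [NormedAddCommGroup H] [InnerProductSpace ℂ H]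

/-- The union space of a quantized domain (the supremum of a directed family of subspaces is its
union, see `mem_dom`). -/
def QuantizedDomain.dom (E : QuantizedDomain ι H) : Submodule ℂ H := ⨆ i, E.sub i

theorem QuantizedDomain.mem_dom [Nonempty ι] (E : QuantizedDomain ι H) {x : H} :
    x ∈ E.dom ↔ ∃ i, x ∈ E.sub i :=
  Submodule.mem_iSup_of_directed _ E.directed_sub

theorem QuantizedDomain.sub_le_dom (E : QuantizedDomain ι H) (i : ι) : E.sub i ≤ E.dom :=
  le_iSup E.sub i

/-- `C*(D_E)`: the linear operators `T` on the union space `D_E` such that, for every `i`,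
`T` maps `H_i` to itself, the restriction of `T` to `H_i` is bounded, and
`T` maps `H_iᗮ ∩ D_E` to itself. -/
def cstarOps (E : QuantizedDomain ι H) : Subalgebra ℂ (Module.End ℂ E.dom) where
  carrier := {T | ∀ i,
    (∀ x : E.dom, (x : H) ∈ E.sub i → (T x : H) ∈ E.sub i) ∧
    (∃ C : ℝ, ∀ x : E.dom, (x : H) ∈ E.sub i → ‖T x‖ ≤ C * ‖x‖) ∧
    (∀ x : E.dom, (x : H) ∈ (E.sub i)ᗮ → (T x : H) ∈ (E.sub i)ᗮ)}
  mul_mem' := by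
    intro S T hS hT i
    obtain ⟨hS1, ⟨C, hC⟩, hS3⟩ := hS i
    obtain ⟨hT1, ⟨C', hC'⟩, hT3⟩ := hT i
    refine ⟨fun x hx => hS1 _ (hT1 x hx), ⟨|C| * C', fun x hx => ?_⟩, fun x hx => hS3 _ (hT3 x hx)⟩
    calc ‖S (T x)‖ ≤ C * ‖T x‖ := hC _ (hT1 x hx)
      _ ≤ |C| * ‖T x‖ := by gcongr; exact le_abs_self C
      _ ≤ |C| * (C' * ‖x‖) := by gcongr; exact hC' x hx
      _ = |C| * C' * ‖x‖ := by ring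
  add_mem' := by
    intro S T hS hT i
    obtain ⟨hS1, ⟨C, hC⟩, hS3⟩ := hS i
    obtain ⟨hT1, ⟨C', hC'⟩, hT3⟩ := hT i
    refine ⟨fun x hx => add_mem (hS1 x hx) (hT1 x hx), ⟨C + C', fun x hx => ?_⟩,
      fun x hx => add_mem (hS3 x hx) (hT3 x hx)⟩
    calc ‖S x + T x‖ ≤ ‖S x‖ + ‖T x‖ := norm_add_le _ _
      _ ≤ C * ‖x‖ + C' * ‖x‖ := add_le_add (hC x hx) (hC' x hx)
      _ = (C + C') * ‖x‖ := by ring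
  algebraMap_mem' := by
    intro r i
    refine ⟨fun x hx => ?_, ⟨‖r‖, fun x _ => ?_⟩, fun x hx => ?_⟩
    · simpa [Module.algebraMap_end_apply] using (E.sub i).smul_mem r hx
    · simp [Module.algebraMap_end_apply, norm_smul]
    · simpa [Module.algebraMap_end_apply] using (E.sub i)ᗮ.smul_mem r hx

/-- The unital `*`-algebra `C*(D_E)` as a type. -/
def CStarOps (E : QuantizedDomain ι H) : Type _ := cstarOps E

namespace CStarOps

instance (E : QuantizedDomain ι H) : Ring (CStarOps E) := inferInstanceAs (Ring (cstarOps E))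

instance (E : QuantizedDomain ι H) : Algebra ℂ (CStarOps E) :=
  inferInstanceAs (Algebra ℂ (cstarOps E))

variable {E : QuantizedDomain ι H}

theorem ext' {S T : CStarOps E} (h : ∀ x : E.dom, S.1 x = T.1 x) : S = T :=
  Subtype.ext (LinearMap.ext h)

/-- The restriction of `T ∈ C*(D_E)` to `H_i`, as a bounded operator on `H_i`. -/
def restr (i : ι) : CStarOps E →ₗ[ℂ] (E.sub i →L[ℂ] E.sub i) where
  toFun T := LinearMap.mkContinuousOfExistsBound
    { toFun := fun x => ⟨(T.1 ⟨x, E.sub_le_dom i x.2⟩ : H), (T.2 i).1 _ x.2⟩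
      map_add' := fun x y => Subtype.ext (congrArg (Subtype.val : E.dom → H)
        (T.1.map_add ⟨x, E.sub_le_dom i x.2⟩ ⟨y, E.sub_le_dom i y.2⟩))
      map_smul' := fun c x => Subtype.ext (congrArg (Subtype.val : E.dom → H)
        (T.1.map_smul c ⟨x, E.sub_le_dom i x.2⟩)) }
    (by
      obtain ⟨C, hC⟩ := (T.2 i).2.1
      exact ⟨C, fun x => hC ⟨x, E.sub_le_dom i x.2⟩ x.2⟩)
  map_add' _ _ := rfl
  map_smul' _ _ := rfl

@[simp]
theorem restr_apply (i : ι) (T : CStarOps E) (x : E.sub i) :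
    (restr i T x : H) = T.1 ⟨x, E.sub_le_dom i x.2⟩ := rfl

/-- The `C*`-seminorm `‖T‖_i = ‖T|_{H_i}‖`. -/
def seminorm (E : QuantizedDomain ι H) (i : ι) : Seminorm ℂ (CStarOps E) :=
  Seminorm.ofSMulLE (fun T : CStarOps E => ‖restr i T‖)
    ((congrArg norm (map_zero (restr i))).trans ContinuousLinearMap.opNorm_zero)
    (fun S T => (congrArg norm (map_add (restr i) S T)).trans_le
      (norm_add_le (restr i S) (restr i T)))
    (fun c T => (congrArg norm (map_smul (restr i) c T)).trans_le
      (ContinuousLinearMap.opNorm_smul_le c (restr i T)))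

theorem seminorm_apply (i : ι) (T : CStarOps E) : seminorm E i T = ‖restr i T‖ := rfl

/-- A linear operator on the union space is in `C*(D_E)` as soon as it is bounded on every `H_i`
and it and a formal adjoint of it leave every `H_i` invariant. -/
theorem mem_of_adjoint (T S : Module.End ℂ E.dom)
    (hT : ∀ i, ∀ x : E.dom, (x : H) ∈ E.sub i → (T x : H) ∈ E.sub i)
    (hS : ∀ i, ∀ x : E.dom, (x : H) ∈ E.sub i → (S x : H) ∈ E.sub i)
    (hb : ∀ i, ∃ C : ℝ, ∀ x : E.dom, (x : H) ∈ E.sub i → ‖T x‖ ≤ C * ‖x‖)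
    (hadj : ∀ x y : E.dom, ⟪(T x : H), (y : H)⟫_ℂ = ⟪(x : H), (S y : H)⟫_ℂ) :
    T ∈ cstarOps E := by
  refine fun i => ⟨hT i, hb i, fun x hx => ?_⟩
  rw [Submodule.mem_orthogonal'] at hx ⊢
  intro u hu
  exact (hadj x ⟨u, E.sub_le_dom i hu⟩).trans (hx _ (hS i ⟨u, E.sub_le_dom i hu⟩ hu))

theorem eq_of_inner {y z : E.dom} (h : ∀ x : E.dom, ⟪(x : H), (y : H)⟫_ℂ = ⟪(x : H), (z : H)⟫_ℂ) :
    y = z := ext_inner_left ℂ fun v => h v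

variable [CompleteSpace H] [Nonempty ι]

theorem exists_adjoint_apply (T : CStarOps E) (y : E.dom) :
    ∃ z : E.dom, (∀ i, (y : H) ∈ E.sub i → (z : H) ∈ E.sub i ∧ ‖z‖ ≤ ‖restr i T‖ * ‖y‖) ∧
      ∀ x : E.dom, ⟪(T.1 x : H), (y : H)⟫_ℂ = ⟪(x : H), (z : H)⟫_ℂ := by
  have key : ∀ i, (y : H) ∈ E.sub i → ∃ z : E.dom, ((z : H) ∈ E.sub i ∧
      ‖z‖ ≤ ‖restr i T‖ * ‖y‖) ∧ ∀ x : E.dom, ⟪(T.1 x : H), (y : H)⟫_ℂ = ⟪(x : H), (z : H)⟫_ℂ := by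
    intro i hi
    have : CompleteSpace (E.sub i) := (E.isClosed_sub i).completeSpace_coe
    let w : E.sub i := ContinuousLinearMap.adjoint (restr i T) ⟨y, hi⟩
    refine ⟨⟨w, E.sub_le_dom i w.2⟩, ⟨w.2, ?_⟩, fun x => ?_⟩
    · have h := (ContinuousLinearMap.adjoint (restr i T)).le_opNorm ⟨y, hi⟩
      rw [LinearIsometryEquiv.norm_map] at h
      exact h
    · let a : E.sub i := (E.sub i).orthogonalProjectionOnto (x : H)
      have ha : (x : H) - a ∈ (E.sub i)ᗮ := (E.sub i).sub_starProjection_mem_orthogonal _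
      let a' : E.dom := ⟨a, E.sub_le_dom i a.2⟩
      have h1 : (T.1 (x - a') : H) ∈ (E.sub i)ᗮ := (T.2 i).2.2 (x - a') ha
      have h2 : ⟪(T.1 x : H), (y : H)⟫_ℂ = ⟪(T.1 a' : H), (y : H)⟫_ℂ := by
        have := (Submodule.mem_orthogonal' _ _).1 h1 y hi
        rw [map_sub] at this
        push_cast at this
        rw [inner_sub_left, sub_eq_zero] at this
        exact this
      have h3 : ⟪(x : H), (w : H)⟫_ℂ = ⟪(a : H), (w : H)⟫_ℂ := by
        have := (Submodule.mem_orthogonal' _ _).1 ha w w.2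
        rwa [inner_sub_left, sub_eq_zero] at this
      rw [h2]
      refine Eq.trans ?_ h3.symm
      exact (ContinuousLinearMap.adjoint_inner_right (restr i T) a ⟨y, hi⟩).symm
  obtain ⟨i, hi⟩ := E.mem_dom.1 y.2
  obtain ⟨z, -, hz⟩ := key i hi
  refine ⟨z, fun j hj => ?_, hz⟩
  obtain ⟨z', h', hz'⟩ := key j hj
  have : z = z' := by
    refine ext_inner_left ℂ fun v => ?_
    exact (hz v).symm.trans (hz' v)
  rwa [this]

/-- The value at `y` of the adjoint of `T`. -/
def adjFun (T : CStarOps E) (y : E.dom) : E.dom := (exists_adjoint_apply T y).choose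

theorem inner_adjFun (T : CStarOps E) (x y : E.dom) :
    ⟪(T.1 x : H), (y : H)⟫_ℂ = ⟪(x : H), (adjFun T y : H)⟫_ℂ :=
  (exists_adjoint_apply T y).choose_spec.2 x

/-- The adjoint of `T ∈ C*(D_E)`, restricted to the union space. -/
def adj (T : CStarOps E) : CStarOps E :=
  ⟨{ toFun := adjFun T
     map_add' := fun y z => eq_of_inner fun x => by
      rw [← inner_adjFun]; push_cast
      rw [inner_add_right, inner_add_right, ← inner_adjFun, ← inner_adjFun]
     map_smul' := fun c y => eq_of_inner fun x => by
      rw [← inner_adjFun]; push_cast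
      rw [inner_smul_right, id_eq, inner_smul_right, ← inner_adjFun] },
    mem_of_adjoint _ T.1 (fun i x hx => ((exists_adjoint_apply T x).choose_spec.1 i hx).1)
      (fun i => (T.2 i).1)
      (fun i => ⟨_, fun x hx => ((exists_adjoint_apply T x).choose_spec.1 i hx).2⟩)
      (fun x y => by
        rw [← inner_conj_symm, ← inner_conj_symm (x : H)]
        exact congrArg _ (inner_adjFun T y x).symm)⟩

theorem inner_adj (T : CStarOps E) (x y : E.dom) :
    ⟪(T.1 x : H), (y : H)⟫_ℂ = ⟪(x : H), ((adj T).1 y : H)⟫_ℂ := inner_adjFun T x y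

theorem eq_adj {S T : CStarOps E}
    (h : ∀ x y : E.dom, ⟪(T.1 x : H), (y : H)⟫_ℂ = ⟪(x : H), (S.1 y : H)⟫_ℂ) : S = adj T :=
  ext' fun y => eq_of_inner fun x => (h x y).symm.trans (inner_adj T x y)

instance : StarRing (CStarOps E) where
  star := adj
  star_involutive T := (eq_adj fun x y => by
    rw [← inner_conj_symm, ← inner_conj_symm (x : H), inner_adj T y x]).symm
  star_mul S T := (eq_adj fun x y =>
    (inner_adj S (T.1 x) y).trans (inner_adj T x ((adj S).1 y))).symm
  star_add S T := (eq_adj fun x y => by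
    change ⟪(S.1 x : H) + T.1 x, (y : H)⟫_ℂ = ⟪(x : H), ((adj S).1 y : H) + (adj T).1 y⟫_ℂ
    rw [inner_add_left, inner_add_right, inner_adj, inner_adj]).symm

instance : StarModule ℂ (CStarOps E) where
  star_smul c T := (eq_adj fun x y => by
    change ⟪c • (T.1 x : H), (y : H)⟫_ℂ = ⟪(x : H), star c • ((adj T).1 y : H)⟫_ℂ
    rw [inner_smul_left, inner_smul_right, inner_adj]; rfl).symm

theorem inner_star (T : CStarOps E) (x y : E.dom) :
    ⟪(T.1 x : H), (y : H)⟫_ℂ = ⟪(x : H), ((star T).1 y : H)⟫_ℂ := inner_adj T x y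

end CStarOps

end Ops

/-! ### Tensor products of quantized domains and of operators -/

section TensorDomain

/-- The Hilbert space tensor product. -/
abbrev HTensor (H K : Type*) [NormedAddCommGroup H] [InnerProductSpace ℂ H]
    [NormedAddCommGroup K] [InnerProductSpace ℂ K] : Type _ :=
  UniformSpace.Completion (H ⊗[ℂ] K)

variable {ι κ H K : Type*} [NormedAddCommGroup H] [InnerProductSpace ℂ H]
  [NormedAddCommGroup K] [InnerProductSpace ℂ K]

/-- The elementary tensor `x ⊗ y` in the Hilbert space tensor product. -/
def htmul (x : H) (y : K) : HTensor H K := ((x ⊗ₜ[ℂ] y : H ⊗[ℂ] K) : HTensor H K)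

theorem continuous_htmul : Continuous fun x : H × K => htmul x.1 x.2 :=
  (UniformSpace.Completion.continuous_coe _).comp TensorProduct.continuous_tmul

theorem inner_htmul (x x' : H) (y y' : K) :
    ⟪htmul x y, htmul x' y'⟫_ℂ = ⟪x, x'⟫_ℂ * ⟪y, y'⟫_ℂ := by
  simp [htmul, UniformSpace.Completion.inner_coe]

/-- The closed subspace `H' ⊗ K'` of the Hilbert space tensor product `H ⊗ K`. -/
def subTensor (H' : Submodule ℂ H) (K' : Submodule ℂ K) : Submodule ℂ (HTensor H K) :=
  (Submodule.span ℂ (Set.image2 htmul (H' : Set H) (K' : Set K))).topologicalClosure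

theorem htmul_mem {H' : Submodule ℂ H} {K' : Submodule ℂ K} {x : H} {y : K} (hx : x ∈ H')
    (hy : y ∈ K') : htmul x y ∈ subTensor H' K' :=
  Submodule.le_topologicalClosure _ (Submodule.subset_span ⟨x, hx, y, hy, rfl⟩)

theorem subTensor_mono {H' H'' : Submodule ℂ H} {K' K'' : Submodule ℂ K} (h : H' ≤ H'')
    (k : K' ≤ K'') : subTensor H' K' ≤ subTensor H'' K'' :=
  Submodule.topologicalClosure_mono (Submodule.span_mono (Set.image2_subset h k))

theorem subTensor_induction {H' : Submodule ℂ H} {K' : Submodule ℂ K} {P : HTensor H K → Prop}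
    (hc : IsClosed {z | P z}) (h0 : P 0) (hadd : ∀ z w, P z → P w → P (z + w))
    (hsmul : ∀ (c : ℂ) z, P z → P (c • z)) (ht : ∀ x ∈ H', ∀ y ∈ K', P (htmul x y)) :
    ∀ z ∈ subTensor H' K', P z := by
  intro z hz
  refine closure_minimal (s := (Submodule.span ℂ (Set.image2 htmul (H' : Set H) (K' : Set K)) :
    Set (HTensor H K))) (fun w hw => ?_) hc hz
  induction hw using Submodule.span_induction with
  | mem w h => obtain ⟨x, hx, y, hy, rfl⟩ := h; exact ht x hx y hy
  | zero => exact h0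
  | add _ _ _ _ h h' => exact hadd _ _ h h'
  | smul c _ _ h => exact hsmul c _ h

/-- The quantized domain `E ⊗ F = {H_i ⊗ K_j}` in the Hilbert space `H ⊗ K`. -/
def QuantizedDomain.tensor [Nonempty ι] [Nonempty κ] (E : QuantizedDomain ι H)
    (F : QuantizedDomain κ K) : QuantizedDomain (ι × κ) (HTensor H K) where
  sub ij := subTensor (E.sub ij.1) (F.sub ij.2)
  isClosed_sub _ := Submodule.isClosed_topologicalClosure _
  directed_sub := by
    rintro ⟨i, j⟩ ⟨i', j'⟩
    obtain ⟨k, hk, hk'⟩ := E.directed_sub i i'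
    obtain ⟨l, hl, hl'⟩ := F.directed_sub j j'
    exact ⟨(k, l), subTensor_mono hk hl, subTensor_mono hk' hl'⟩
  dense_iUnion := by
    have hdir : Directed (· ≤ ·)
        fun ij : ι × κ => subTensor (E.sub ij.1) (F.sub ij.2) := by
      rintro ⟨i, j⟩ ⟨i', j'⟩
      obtain ⟨k, hk, hk'⟩ := E.directed_sub i i'
      obtain ⟨l, hl, hl'⟩ := F.directed_sub j j'
      exact ⟨(k, l), subTensor_mono hk hl, subTensor_mono hk' hl'⟩
    rw [← Submodule.coe_iSup_of_directed _ hdir]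
    set M : Submodule ℂ (HTensor H K) := ⨆ ij : ι × κ, subTensor (E.sub ij.1) (F.sub ij.2)
    have h1 : ∀ (x : H) (y : K), htmul x y ∈ M.topologicalClosure := by
      intro x y
      have hxy : (x, y) ∈ closure ((⋃ i, (E.sub i : Set H)) ×ˢ (⋃ j, (F.sub j : Set K))) :=
        (E.dense_iUnion.prod F.dense_iUnion) (x, y)
      refine map_mem_closure (f := fun x : H × K => htmul x.1 x.2) continuous_htmul hxy ?_
      rintro ⟨a, b⟩ ⟨ha, hb⟩
      obtain ⟨i, hi⟩ := Set.mem_iUnion.1 ha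
      obtain ⟨j, hj⟩ := Set.mem_iUnion.1 hb
      exact (le_iSup (fun ij : ι × κ => subTensor (E.sub ij.1) (F.sub ij.2)) (i, j))
        (htmul_mem hi hj)
    have h2 : ∀ t : H ⊗[ℂ] K, (t : HTensor H K) ∈ M.topologicalClosure := by
      intro t
      induction t using TensorProduct.induction_on with
      | zero => rw [UniformSpace.Completion.coe_zero]; exact zero_mem _
      | tmul x y => exact h1 x y
      | add a b ha hb => rw [UniformSpace.Completion.coe_add]; exact add_mem ha hb
    intro z
    change z ∈ (M.topologicalClosure : Set (HTensor H K))
    induction z using UniformSpace.Completion.induction_on with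
    | hp => exact M.isClosed_topologicalClosure
    | ih t => exact h2 t

theorem exists_common [Nonempty ι] [Nonempty κ] {E : QuantizedDomain ι H}
    {F : QuantizedDomain κ K} (z w : (E.tensor F).dom) : ∃ i j,
    (z : HTensor H K) ∈ subTensor (E.sub i) (F.sub j) ∧
    (w : HTensor H K) ∈ subTensor (E.sub i) (F.sub j) := by
  obtain ⟨k, hk⟩ := (E.tensor F).mem_dom.1 z.2
  obtain ⟨l, hl⟩ := (E.tensor F).mem_dom.1 w.2
  obtain ⟨m, hm, hm'⟩ := (E.tensor F).directed_sub k l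
  exact ⟨m.1, m.2, hm hk, hm' hl⟩

theorem htmul_mem_dom [Nonempty ι] [Nonempty κ] {E : QuantizedDomain ι H}
    {F : QuantizedDomain κ K} (x : E.dom) (y : F.dom) :
    htmul (x : H) (y : K) ∈ (E.tensor F).dom := by
  obtain ⟨i, hi⟩ := E.mem_dom.1 x.2
  obtain ⟨j, hj⟩ := F.mem_dom.1 y.2
  exact (E.tensor F).sub_le_dom (i, j) (htmul_mem hi hj)

variable [CompleteSpace H] [CompleteSpace K]

instance (E : QuantizedDomain ι H) (i : ι) : CompleteSpace (E.sub i) :=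
  (E.isClosed_sub i).completeSpace_coe

/-- `T P_i` as a bounded operator on `H`, where `P_i` is the projection onto `H_i`. -/
def CStarOps.compress {E : QuantizedDomain ι H} (T : CStarOps E) (i : ι) : H →L[ℂ] H :=
  (E.sub i).subtypeL ∘L CStarOps.restr i T ∘L (E.sub i).orthogonalProjectionOnto

theorem CStarOps.compress_apply {E : QuantizedDomain ι H} (T : CStarOps E) (i : ι) {x : H}
    (hx : x ∈ E.sub i) : CStarOps.compress T i x = T.1 ⟨x, E.sub_le_dom i hx⟩ := by
  have : (E.sub i).orthogonalProjectionOnto x = ⟨x, hx⟩ :=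
    Submodule.orthogonalProjectionOnto_mem_subspace_eq_self (⟨x, hx⟩ : E.sub i)
  simp [CStarOps.compress, this]

variable {E : QuantizedDomain ι H} {F : QuantizedDomain κ K}

/-- The bounded operator `T P_i ⊗ S Q_j` on `H ⊗ K`. -/
def boundedTensor (T : CStarOps E) (S : CStarOps F) (i : ι) (j : κ) :
    HTensor H K →L[ℂ] HTensor H K :=
  (TensorProduct.mapL (CStarOps.compress T i) (CStarOps.compress S j)).completion

theorem boundedTensor_htmul (T : CStarOps E) (S : CStarOps F) {i : ι} {j : κ} {x : H} {y : K}
    (hx : x ∈ E.sub i) (hy : y ∈ F.sub j) :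
    boundedTensor T S i j (htmul x y) =
      htmul (T.1 ⟨x, E.sub_le_dom i hx⟩ : H) (S.1 ⟨y, F.sub_le_dom j hy⟩ : K) := by
  rw [boundedTensor, htmul, ContinuousLinearMap.completion_apply_coe, TensorProduct.mapL_tmul,
    CStarOps.compress_apply T i hx, CStarOps.compress_apply S j hy]
  rfl

theorem boundedTensor_mem (T : CStarOps E) (S : CStarOps F) {i : ι} {j : κ} {z : HTensor H K}
    (hz : z ∈ subTensor (E.sub i) (F.sub j)) :
    boundedTensor T S i j z ∈ subTensor (E.sub i) (F.sub j) := by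
  refine subTensor_induction (P := fun z => boundedTensor T S i j z ∈ subTensor (E.sub i) (F.sub j))
    ?_ ?_ ?_ ?_ ?_ z hz
  · exact (Submodule.isClosed_topologicalClosure _).preimage (boundedTensor T S i j).continuous
  · rw [map_zero]; exact zero_mem _
  · intro z w h h'; rw [map_add]; exact add_mem h h'
  · intro c z h; rw [map_smul]; exact Submodule.smul_mem _ _ h
  · intro x hx y hy
    rw [boundedTensor_htmul T S hx hy]
    exact htmul_mem ((T.2 i).1 _ hx) ((S.2 j).1 _ hy)

theorem boundedTensor_congr (T : CStarOps E) (S : CStarOps F) {i i' : ι} {j j' : κ}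
    (hi : E.sub i ≤ E.sub i') (hj : F.sub j ≤ F.sub j') {z : HTensor H K}
    (hz : z ∈ subTensor (E.sub i) (F.sub j)) :
    boundedTensor T S i j z = boundedTensor T S i' j' z := by
  refine subTensor_induction (P := fun z => boundedTensor T S i j z = boundedTensor T S i' j' z)
    ?_ ?_ ?_ ?_ ?_ z hz
  · exact isClosed_eq (boundedTensor T S i j).continuous (boundedTensor T S i' j').continuous
  · rw [map_zero, map_zero]
  · intro z w h h'; rw [map_add, map_add, h, h']
  · intro c z h; rw [map_smul, map_smul, h]
  · intro x hx y hy
    rw [boundedTensor_htmul T S hx hy, boundedTensor_htmul T S (hi hx) (hj hy)]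

variable [Nonempty ι] [Nonempty κ]

theorem inner_boundedTensor (T : CStarOps E) (S : CStarOps F) {i : ι} {j : κ} {z w : HTensor H K}
    (hz : z ∈ subTensor (E.sub i) (F.sub j)) (hw : w ∈ subTensor (E.sub i) (F.sub j)) :
    ⟪boundedTensor T S i j z, w⟫_ℂ = ⟪z, boundedTensor (star T) (star S) i j w⟫_ℂ := by
  refine subTensor_induction
    (P := fun z => ⟪boundedTensor T S i j z, w⟫_ℂ = ⟪z, boundedTensor (star T) (star S) i j w⟫_ℂ)
    ?_ ?_ ?_ ?_ ?_ z hz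
  · exact isClosed_eq (by fun_prop) (by fun_prop)
  · simp
  · intro z w h h'; rw [map_add, inner_add_left, inner_add_left, h, h']
  · intro c z h; rw [map_smul, inner_smul_left, inner_smul_left, h]
  · intro x hx y hy
    refine subTensor_induction (P := fun w => ⟪boundedTensor T S i j (htmul x y), w⟫_ℂ =
      ⟪htmul x y, boundedTensor (star T) (star S) i j w⟫_ℂ) ?_ ?_ ?_ ?_ ?_ w hw
    · exact isClosed_eq (by fun_prop) (by fun_prop)
    · simp
    · intro z w h h'; rw [map_add, inner_add_right, inner_add_right, h, h']
    · intro c z h; rw [map_smul, inner_smul_right, inner_smul_right, h]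
    · intro x' hx' y' hy'
      rw [boundedTensor_htmul T S hx hy, boundedTensor_htmul _ _ hx' hy', inner_htmul,
        inner_htmul]
      exact congrArg₂ (· * ·) (CStarOps.inner_star T ⟨x, E.sub_le_dom i hx⟩ ⟨x', E.sub_le_dom i hx'⟩)
        (CStarOps.inner_star S ⟨y, F.sub_le_dom j hy⟩ ⟨y', F.sub_le_dom j hy'⟩)

/-- The value of `T ⊗ S` at a vector of the union space of `E ⊗ F`. -/
def tensorFun (T : CStarOps E) (S : CStarOps F) (z : (E.tensor F).dom) : (E.tensor F).dom :=
  ⟨boundedTensor T S ((E.tensor F).mem_dom.1 z.2).choose.1 ((E.tensor F).mem_dom.1 z.2).choose.2 z,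
    (E.tensor F).sub_le_dom _
      (boundedTensor_mem T S ((E.tensor F).mem_dom.1 z.2).choose_spec)⟩

theorem tensorFun_eq (T : CStarOps E) (S : CStarOps F) {i : ι} {j : κ} (z : (E.tensor F).dom)
    (hz : (z : HTensor H K) ∈ subTensor (E.sub i) (F.sub j)) :
    (tensorFun T S z : HTensor H K) = boundedTensor T S i j z := by
  obtain ⟨k, hk, hk'⟩ := E.directed_sub i ((E.tensor F).mem_dom.1 z.2).choose.1
  obtain ⟨l, hl, hl'⟩ := F.directed_sub j ((E.tensor F).mem_dom.1 z.2).choose.2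
  exact (boundedTensor_congr T S hk' hl' ((E.tensor F).mem_dom.1 z.2).choose_spec).trans
    (boundedTensor_congr T S hk hl hz).symm

/-- `tensorFun` as a linear operator on the union space. -/
def tensorLin (T : CStarOps E) (S : CStarOps F) : Module.End ℂ (E.tensor F).dom where
  toFun := tensorFun T S
  map_add' z w := by
    obtain ⟨i, j, hz, hw⟩ := exists_common z w
    refine Subtype.ext ?_
    rw [tensorFun_eq T S (z + w) (i := i) (j := j) (add_mem hz hw)]
    push_cast
    rw [map_add, tensorFun_eq T S z hz, tensorFun_eq T S w hw]
  map_smul' c z := by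
    obtain ⟨i, j, hz, -⟩ := exists_common z z
    refine Subtype.ext ?_
    rw [tensorFun_eq T S (c • z) (i := i) (j := j) (Submodule.smul_mem _ c hz)]
    push_cast
    rw [map_smul, tensorFun_eq T S z hz]
    rfl

/-- The operator `T ⊗ S ∈ C*(D_{E ⊗ F})` of `T ∈ C*(D_E)` and `S ∈ C*(D_F)`; it is determined by
`(T ⊗ S)(ξ ⊗ η) = T ξ ⊗ S η`, see `tensorOp_htmul`. -/
def tensorOp (T : CStarOps E) (S : CStarOps F) : CStarOps (E.tensor F) :=
  ⟨tensorLin T S, CStarOps.mem_of_adjoint _ (tensorLin (star T) (star S))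
    (fun i z hz => by
      rw [show (tensorLin T S z : HTensor H K) = _ from tensorFun_eq T S z hz]
      exact boundedTensor_mem T S hz)
    (fun i z hz => by
      rw [show (tensorLin (star T) (star S) z : HTensor H K) = _ from tensorFun_eq _ _ z hz]
      exact boundedTensor_mem _ _ hz)
    (fun i => ⟨‖boundedTensor T S i.1 i.2‖, fun z hz => by
      change ‖(tensorLin T S z : HTensor H K)‖ ≤ _
      rw [show (tensorLin T S z : HTensor H K) = _ from tensorFun_eq T S z hz]
      exact (boundedTensor T S i.1 i.2).le_opNorm _⟩)
    (fun z w => by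
      obtain ⟨i, j, hz, hw⟩ := exists_common z w
      rw [show (tensorLin T S z : HTensor H K) = _ from tensorFun_eq T S z hz,
        show (tensorLin (star T) (star S) w : HTensor H K) = _ from tensorFun_eq _ _ w hw]
      exact inner_boundedTensor T S hz hw)⟩

theorem tensorOp_htmul (T : CStarOps E) (S : CStarOps F) (x : E.dom) (y : F.dom) :
    ((tensorOp T S).1 ⟨htmul (x : H) (y : K), htmul_mem_dom x y⟩ : HTensor H K) =
      htmul (T.1 x : H) (S.1 y : K) := by
  obtain ⟨i, hi⟩ := E.mem_dom.1 x.2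
  obtain ⟨j, hj⟩ := F.mem_dom.1 y.2
  exact (tensorFun_eq T S _ (htmul_mem hi hj)).trans (boundedTensor_htmul T S hi hj)

end TensorDomain

/-! ### Locally `C*`-algebras and local completely positive maps -/

section LocalMaps

/-- `A` is a locally `C*`-algebra with respect to the family `p` of `C*`-seminorms: a complete
Hausdorff topological `*`-algebra whose topology is determined by the upward filtered family `p`. -/
structure IsLocallyCStarAlgebra {A Λ : Type*} [Nonempty Λ] [Ring A] [StarRing A] [Algebra ℂ A]
    [UniformSpace A] (p : Λ → Seminorm ℂ A) : Prop where
  isUniformAddGroup : IsUniformAddGroup A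
  completeSpace : CompleteSpace A
  t2Space : T2Space A
  withSeminorms : WithSeminorms p
  directed : Directed (· ≤ ·) p
  mul_le : ∀ (l : Λ) (a b : A), p l (a * b) ≤ p l a * p l b
  star_mul_self : ∀ (l : Λ) (a : A), p l (star a * a) = p l a ^ 2

variable {A : Type*} [Ring A] [StarRing A] [Algebra ℂ A]
variable {B : Type*} [Ring B] [StarRing B] [Algebra ℂ B]

open scoped Matrix in
/-- The `C*`-seminorm `p^n` on `M_n(A)` associated with a `C*`-seminorm `p` on `A`: with
`A_p = A / ker p`, it is the norm of the operator of multiplication by the matrix on the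
Hilbert `A_p`-module `A_p ^ n`, whose norm is `‖x‖² = ‖∑ x_j* x_j‖`. -/
def matSeminorm (p : Seminorm ℂ A) {n : ℕ} (a : Matrix (Fin n) (Fin n) A) : ℝ :=
  sSup {r : ℝ | ∃ x : Fin n → A, p (∑ j, star (x j) * x j) ≤ 1 ∧
    r = √(p (∑ i, star ((a *ᵥ x) i) * (a *ᵥ x) i))}

open scoped Matrix in
/-- `a ≥_p 0` in `M_n(A)`: `a = b* b + c` with `p^n(c) = 0`. -/
def MatLocPos (p : Seminorm ℂ A) {n : ℕ} (a : Matrix (Fin n) (Fin n) A) : Prop :=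
  ∃ b c : Matrix (Fin n) (Fin n) A, a = bᴴ * b + c ∧ matSeminorm p c = 0

/-- Local completely positive maps. -/
def IsLocalCP {Λ Δ : Type*} (p : Λ → Seminorm ℂ A) (q : Δ → Seminorm ℂ B) (φ : A →ₗ[ℂ] B) :
    Prop :=
  ∀ d : Δ, ∃ l : Λ, ∀ (n : ℕ) (a : Matrix (Fin n) (Fin n) A),
    (MatLocPos (p l) a → MatLocPos (q d) (a.map φ)) ∧
    (matSeminorm (p l) a = 0 → matSeminorm (q d) (a.map φ) = 0)

/-- Local completely contractive maps. -/
def IsLocalCC {Λ Δ : Type*} (p : Λ → Seminorm ℂ A) (q : Δ → Seminorm ℂ B) (φ : A →ₗ[ℂ] B) :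
    Prop :=
  ∀ d : Δ, ∃ l : Λ, ∀ (n : ℕ) (a : Matrix (Fin n) (Fin n) A),
    matSeminorm (q d) (a.map φ) ≤ matSeminorm (p l) a

variable {Λ ι H : Type*} [NormedAddCommGroup H] [InnerProductSpace ℂ H] [CompleteSpace H]
  [Nonempty ι] {E : QuantizedDomain ι H}

/-- `φ ∈ CPCC_loc(A, C*(D_E))`: unbounded local completely positive and local completely
contractive maps. -/
def IsLocalCPCC (p : Λ → Seminorm ℂ A) (φ : A →ₗ[ℂ] CStarOps E) : Prop :=
  IsLocalCP p (CStarOps.seminorm E) φ ∧ IsLocalCC p (CStarOps.seminorm E) φ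

/-- `ψ` is dominated by `φ`. -/
def IsDominated (p : Λ → Seminorm ℂ A) (ψ φ : A →ₗ[ℂ] CStarOps E) : Prop :=
  IsLocalCPCC p (φ - ψ)

/-- `φ` is pure: each map in `CPCC_loc(A, C*(D_E))` dominated by `φ` is a nonnegative multiple
of `φ`. -/
def IsPure (p : Λ → Seminorm ℂ A) (φ : A →ₗ[ℂ] CStarOps E) : Prop :=
  ∀ ψ : A →ₗ[ℂ] CStarOps E, IsLocalCPCC p ψ → IsDominated p ψ φ →
    ∃ α : ℝ, 0 ≤ α ∧ ψ = (α : ℂ) • φ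

end LocalMaps

/-! ### The minimal tensor product of locally `C*`-algebras -/

section MinTensor

variable {A : Type u} [Ring A] [StarRing A] [Algebra ℂ A]
variable {B : Type v} [Ring B] [StarRing B] [Algebra ℂ B]

/-- A `*`-representation of `A` on a Hilbert space that is contractive for the seminorm `p`, that
is, a representation of the `C*`-algebra `A / ker p`. -/
structure Rep (p : Seminorm ℂ A) : Type (u + 1) where
  space : Type u
  [normed : NormedAddCommGroup space]
  [inner : InnerProductSpace ℂ space]
  [complete : CompleteSpace space]
  hom : A →⋆ₐ[ℂ] (space →L[ℂ] space)
  norm_le : ∀ a, ‖hom a‖ ≤ p a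

attribute [instance] Rep.normed Rep.inner Rep.complete

variable {p : Seminorm ℂ A} {q : Seminorm ℂ B}

/-- The representation `π ⊗ ρ` of the algebraic tensor product on the algebraic tensor product of
the Hilbert spaces (the operators are bounded, so that their norms do not change on passing to the
Hilbert space tensor product). -/
def repTensor (π : Rep p) (ρ : Rep q) :
    A ⊗[ℂ] B →ₐ[ℂ] (π.space ⊗[ℂ] ρ.space →L[ℂ] π.space ⊗[ℂ] ρ.space) :=
  Algebra.TensorProduct.algHomOfLinearMapTensorProduct
    (TensorProduct.lift (LinearMap.mk₂ ℂ (fun a b => TensorProduct.mapL (π.hom a) (ρ.hom b))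
      (fun a a' b => by rw [map_add, TensorProduct.mapL_add_left])
      (fun c a b => by rw [map_smul, TensorProduct.mapL_smul_left])
      (fun a b b' => by rw [map_add, TensorProduct.mapL_add_right])
      (fun c a b => by rw [map_smul, TensorProduct.mapL_smul_right])))
    (fun a a' b b' => by simp [TensorProduct.mapL_mul])
    (by
      simp only [TensorProduct.lift.tmul, LinearMap.mk₂_apply, map_one]
      exact TensorProduct.mapL_id_id)

theorem repTensor_tmul (π : Rep p) (ρ : Rep q) (a : A) (b : B) :
    repTensor π ρ (a ⊗ₜ b) = TensorProduct.mapL (π.hom a) (ρ.hom b) := rfl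

theorem opNorm_le_of_adjoint {V : Type*} [NormedAddCommGroup V] [InnerProductSpace ℂ V]
    {S T : V →L[ℂ] V} (h : ∀ s t, ⟪T s, t⟫_ℂ = ⟪s, S t⟫_ℂ) : ‖S‖ ≤ ‖T‖ := by
  refine ContinuousLinearMap.opNorm_le_bound _ (norm_nonneg _) fun t => ?_
  have h1 : ‖S t‖ * ‖S t‖ ≤ ‖T‖ * ‖t‖ * ‖S t‖ := by
    calc ‖S t‖ * ‖S t‖ = ‖⟪S t, S t⟫_ℂ‖ := by rw [inner_self_eq_norm_sq_to_K]; simp [sq]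
      _ = ‖⟪T (S t), t⟫_ℂ‖ := by rw [h]
      _ ≤ ‖T (S t)‖ * ‖t‖ := norm_inner_le_norm _ _
      _ ≤ ‖T‖ * ‖S t‖ * ‖t‖ := by gcongr; exact T.le_opNorm _
      _ = _ := by ring
  rcases (norm_nonneg (S t)).eq_or_lt with h0 | h0
  · rw [← h0]; positivity
  · exact le_of_mul_le_mul_right h1 h0

theorem exists_bound (x : A ⊗[ℂ] B) :
    ∃ C : ℝ, ∀ s : Rep p × Rep q, ‖repTensor s.1 s.2 x‖ ≤ C := by
  induction x using TensorProduct.induction_on with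
  | zero => exact ⟨0, fun s => by rw [map_zero]; exact ContinuousLinearMap.opNorm_zero.le⟩
  | tmul a b =>
    refine ⟨p a * q b, fun s => ?_⟩
    rw [repTensor_tmul]
    exact (TensorProduct.norm_mapL_le _ _).trans
      (mul_le_mul (s.1.norm_le a) (s.2.norm_le b) (norm_nonneg _) (apply_nonneg p a))
  | add x y hx hy =>
    obtain ⟨C, hC⟩ := hx
    obtain ⟨D, hD⟩ := hy
    refine ⟨C + D, fun s => ?_⟩
    rw [map_add]
    exact (ContinuousLinearMap.opNorm_add_le _ _).trans (add_le_add (hC s) (hD s))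

/-- The spatial (minimal) norm of an element of the algebraic tensor product of `A / ker p` and
`B / ker q`: the supremum of the norms `‖(π ⊗ ρ)(x)‖` over all representations `π` of `A / ker p`
and `ρ` of `B / ker q`. -/
def spatialNorm (p : Seminorm ℂ A) (q : Seminorm ℂ B) (x : A ⊗[ℂ] B) : ℝ :=
  ⨆ s : Rep p × Rep q, ‖repTensor s.1 s.2 x‖

theorem norm_repTensor_le (π : Rep p) (ρ : Rep q) (x : A ⊗[ℂ] B) :
    ‖repTensor π ρ x‖ ≤ spatialNorm p q x := by
  obtain ⟨C, hC⟩ := exists_bound (p := p) (q := q) x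
  exact le_ciSup (f := fun s : Rep p × Rep q => ‖repTensor s.1 s.2 x‖)
    ⟨C, by rintro _ ⟨s, rfl⟩; exact hC s⟩ (π, ρ)

theorem spatialNorm_nonneg (x : A ⊗[ℂ] B) : 0 ≤ spatialNorm p q x :=
  Real.iSup_nonneg fun _ => ContinuousLinearMap.opNorm_nonneg _

theorem spatialNorm_le {x : A ⊗[ℂ] B} {C : ℝ} (hC : 0 ≤ C)
    (h : ∀ (π : Rep p) (ρ : Rep q), ‖repTensor π ρ x‖ ≤ C) : spatialNorm p q x ≤ C :=
  Real.iSup_le (fun s => h s.1 s.2) hC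

/-- The spatial norm as a seminorm on the algebraic tensor product of `A` and `B`. -/
def spatialSeminorm (p : Seminorm ℂ A) (q : Seminorm ℂ B) : Seminorm ℂ (A ⊗[ℂ] B) :=
  Seminorm.ofSMulLE (spatialNorm p q)
    (le_antisymm (spatialNorm_le le_rfl fun π ρ => by
      rw [map_zero]; exact ContinuousLinearMap.opNorm_zero.le) (spatialNorm_nonneg _))
    (fun x y => spatialNorm_le (add_nonneg (spatialNorm_nonneg _) (spatialNorm_nonneg _))
      fun π ρ => by
        rw [map_add]
        exact (ContinuousLinearMap.opNorm_add_le _ _).trans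
          (add_le_add (norm_repTensor_le π ρ x) (norm_repTensor_le π ρ y)))
    (fun c x => spatialNorm_le (mul_nonneg (norm_nonneg _) (spatialNorm_nonneg _))
      fun π ρ => by
        rw [map_smul]
        exact (ContinuousLinearMap.opNorm_smul_le _ _).trans
          (mul_le_mul_of_nonneg_left (norm_repTensor_le π ρ x) (norm_nonneg _)))

theorem spatialNorm_mul_le (x y : A ⊗[ℂ] B) :
    spatialNorm p q (x * y) ≤ spatialNorm p q x * spatialNorm p q y :=
  spatialNorm_le (mul_nonneg (spatialNorm_nonneg _) (spatialNorm_nonneg _)) fun π ρ => by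
    rw [map_mul]
    exact (ContinuousLinearMap.opNorm_comp_le _ _).trans (mul_le_mul (norm_repTensor_le π ρ x)
      (norm_repTensor_le π ρ y) (ContinuousLinearMap.opNorm_nonneg _) (spatialNorm_nonneg _))

/-- The algebraic tensor product `A ⊗ B` endowed with the spatial seminorm given by `p`, `q`. -/
def SpatialTensor (_p : Seminorm ℂ A) (_q : Seminorm ℂ B) : Type _ := A ⊗[ℂ] B

namespace SpatialTensor

instance : Ring (SpatialTensor p q) := inferInstanceAs (Ring (A ⊗[ℂ] B))

instance : Algebra ℂ (SpatialTensor p q) := inferInstanceAs (Algebra ℂ (A ⊗[ℂ] B))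

instance : SeminormedRing (SpatialTensor p q) where
  __ := (inferInstance : Ring (SpatialTensor p q))
  __ := AddGroupSeminorm.toSeminormedAddCommGroup (E := SpatialTensor p q)
    (spatialSeminorm p q).toAddGroupSeminorm
  norm_mul_le x y := spatialNorm_mul_le (p := p) (q := q) x y

instance : NormedAlgebra ℂ (SpatialTensor p q) where
  __ := (inferInstance : Algebra ℂ (SpatialTensor p q))
  norm_smul_le c x := (map_smul_eq_mul (spatialSeminorm p q) c x).le

end SpatialTensor

/-- The minimal tensor product of the `C*`-algebras `A / ker p` and `B / ker q`. -/
def SpatialCompletion (p : Seminorm ℂ A) (q : Seminorm ℂ B) : Type _ :=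
  UniformSpace.Completion (SpatialTensor p q)

namespace SpatialCompletion

open UniformSpace

instance : NormedRing (SpatialCompletion p q) :=
  inferInstanceAs (NormedRing (Completion (SpatialTensor p q)))

instance : Algebra ℂ (SpatialCompletion p q) :=
  inferInstanceAs (Algebra ℂ (Completion (SpatialTensor p q)))

/-- The canonical map of the algebraic tensor product into its completion. -/
def of (p : Seminorm ℂ A) (q : Seminorm ℂ B) : A ⊗[ℂ] B →ₐ[ℂ] SpatialCompletion p q where
  toFun x := ((show SpatialTensor p q from x : SpatialTensor p q) :
    Completion (SpatialTensor p q))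
  map_one' := Completion.coe_one _
  map_mul' x y := Completion.coe_mul (α := SpatialTensor p q) x y
  map_zero' := Completion.coe_zero
  map_add' x y := Completion.coe_add (α := SpatialTensor p q) x y
  commutes' _ := rfl

theorem norm_of (x : A ⊗[ℂ] B) : ‖of p q x‖ = spatialNorm p q x :=
  Completion.norm_coe (E := SpatialTensor p q) x

theorem induction {P : SpatialCompletion p q → Prop} (hc : IsClosed {z | P z})
    (h : ∀ x : A ⊗[ℂ] B, P (of p q x)) (z : SpatialCompletion p q) : P z :=
  Completion.induction_on (α := SpatialTensor p q) z hc h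

theorem norm_smul_le' (c : ℂ) (z : SpatialCompletion p q) : ‖c • z‖ ≤ ‖c‖ * ‖z‖ :=
  norm_smul_le (α := ℂ) (β := Completion (SpatialTensor p q)) c z

end SpatialCompletion

variable [StarModule ℂ A] [StarModule ℂ B]

theorem inner_repTensor (π : Rep p) (ρ : Rep q) (x : A ⊗[ℂ] B) (s t : π.space ⊗[ℂ] ρ.space) :
    ⟪repTensor π ρ x s, t⟫_ℂ = ⟪s, repTensor π ρ (star x) t⟫_ℂ := by
  induction x using TensorProduct.induction_on with
  | zero => simp
  | add x y hx hy =>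
    rw [star_add, map_add, map_add, add_apply, add_apply,
      inner_add_left, inner_add_right, hx, hy]
  | tmul a b =>
    rw [TensorProduct.star_tmul, repTensor_tmul, repTensor_tmul]
    induction s using TensorProduct.induction_on with
    | zero => simp
    | add s s' hs hs' => rw [map_add, inner_add_left, inner_add_left, hs, hs']
    | tmul u v =>
      induction t using TensorProduct.induction_on with
      | zero => simp
      | add t t' ht ht' => rw [map_add, inner_add_right, inner_add_right, ht, ht']
      | tmul u' v' =>
        rw [TensorProduct.mapL_tmul, TensorProduct.mapL_tmul, TensorProduct.inner_tmul,
          TensorProduct.inner_tmul, map_star, map_star, ContinuousLinearMap.star_eq_adjoint,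
          ContinuousLinearMap.star_eq_adjoint, ContinuousLinearMap.adjoint_inner_right,
          ContinuousLinearMap.adjoint_inner_right]

theorem spatialNorm_star_le (x : A ⊗[ℂ] B) : spatialNorm p q (star x) ≤ spatialNorm p q x :=
  spatialNorm_le (spatialNorm_nonneg _) fun π ρ =>
    (opNorm_le_of_adjoint (inner_repTensor π ρ x)).trans (norm_repTensor_le π ρ x)

namespace SpatialTensor

instance : StarRing (SpatialTensor p q) := inferInstanceAs (StarRing (A ⊗[ℂ] B))

instance : StarModule ℂ (SpatialTensor p q) := inferInstanceAs (StarModule ℂ (A ⊗[ℂ] B))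

instance : NormedStarGroup (SpatialTensor p q) where
  norm_star_le x := spatialNorm_star_le (p := p) (q := q) x

end SpatialTensor

namespace SpatialCompletion

open UniformSpace

/-- The extension of the involution by continuity. -/
def starFun (z : SpatialCompletion p q) : SpatialCompletion p q :=
  Completion.map (star : SpatialTensor p q → SpatialTensor p q) z

theorem continuous_starFun : Continuous (starFun : SpatialCompletion p q → _) :=
  Completion.continuous_map

theorem starFun_of (x : A ⊗[ℂ] B) : starFun (of p q x) = of p q (star x) :=
  Completion.map_coe (f := (star : SpatialTensor p q → SpatialTensor p q))
    (starNormedAddGroupHom (E := SpatialTensor p q)).uniformContinuous x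

instance : StarRing (SpatialCompletion p q) where
  star := starFun
  star_involutive := induction
    (isClosed_eq (continuous_starFun.comp continuous_starFun) continuous_id)
    fun x => by rw [starFun_of, starFun_of, star_star]
  star_add z w := by
    refine induction (P := fun z => starFun (z + w) = starFun z + starFun w)
      (isClosed_eq (continuous_starFun.comp (continuous_id.add continuous_const))
        (continuous_starFun.add continuous_const)) (fun x => ?_) z
    refine induction (P := fun w => starFun (of p q x + w) = starFun (of p q x) + starFun w)
      (isClosed_eq (continuous_starFun.comp (continuous_const.add continuous_id))
        (continuous_const.add continuous_starFun)) (fun y => ?_) w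
    rw [← map_add, starFun_of, starFun_of, starFun_of, star_add, map_add]
  star_mul z w := by
    refine induction (P := fun z => starFun (z * w) = starFun w * starFun z)
      (isClosed_eq (continuous_starFun.comp (continuous_id.mul continuous_const))
        (continuous_const.mul continuous_starFun)) (fun x => ?_) z
    refine induction (P := fun w => starFun (of p q x * w) = starFun w * starFun (of p q x))
      (isClosed_eq (continuous_starFun.comp (continuous_const.mul continuous_id))
        (continuous_starFun.mul continuous_const)) (fun y => ?_) w
    rw [← map_mul, starFun_of, starFun_of, starFun_of, star_mul, map_mul]

theorem star_of (x : A ⊗[ℂ] B) : star (of p q x) = of p q (star x) := starFun_of x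

instance : ContinuousStar (SpatialCompletion p q) := ⟨continuous_starFun⟩

instance : StarModule ℂ (SpatialCompletion p q) where
  star_smul c z := by
    have hs : Continuous fun z : SpatialCompletion p q => c • z := by
      simp_rw [Algebra.smul_def]; fun_prop
    have hs' : Continuous fun z : SpatialCompletion p q => star c • star z := by
      simp_rw [Algebra.smul_def]; fun_prop
    refine induction (P := fun z => star (c • z) = star c • star z)
      (isClosed_eq (continuous_star.comp hs) hs') (fun x => ?_) z
    rw [← map_smul, star_of, star_of, star_smul, map_smul]

end SpatialCompletion

variable {Λ Δ : Type*}

/-- The diagonal map of the algebraic tensor product into the product of the `C*`-algebras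
`A_λ ⊗ B_δ`. -/
def diag (p : Λ → Seminorm ℂ A) (q : Δ → Seminorm ℂ B) :
    A ⊗[ℂ] B →⋆ₐ[ℂ] (∀ ld : Λ × Δ, SpatialCompletion (p ld.1) (q ld.2)) where
  __ := AlgHom.pi fun ld : Λ × Δ => SpatialCompletion.of (p ld.1) (q ld.2)
  map_star' x := funext fun ld => (SpatialCompletion.star_of (p := p ld.1) (q := q ld.2) x).symm

/-- The minimal tensor product as a `*`-subalgebra of the product of the `C*`-algebras
`A_λ ⊗ B_δ`: the closure of the image of the algebraic tensor product. -/
def minTensor (p : Λ → Seminorm ℂ A) (q : Δ → Seminorm ℂ B) :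
    StarSubalgebra ℂ (∀ ld : Λ × Δ, SpatialCompletion (p ld.1) (q ld.2)) :=
  (diag p q).range.topologicalClosure

/-- The minimal tensor product `A ⊗ B` of locally `C*`-algebras whose topologies are given by the
families `p` and `q` of `C*`-seminorms: the Hausdorff completion of the algebraic tensor product
for the family of the spatial seminorms of `p λ` and `q δ`. -/
def MinTensor (p : Λ → Seminorm ℂ A) (q : Δ → Seminorm ℂ B) : Type _ := minTensor p q

namespace MinTensor

variable {p : Λ → Seminorm ℂ A} {q : Δ → Seminorm ℂ B}

instance : Ring (MinTensor p q) := inferInstanceAs (Ring (minTensor p q))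

instance : Algebra ℂ (MinTensor p q) := inferInstanceAs (Algebra ℂ (minTensor p q))

instance : StarRing (MinTensor p q) := inferInstanceAs (StarRing (minTensor p q))

instance : StarModule ℂ (MinTensor p q) := inferInstanceAs (StarModule ℂ (minTensor p q))

/-- The `C*`-seminorm of `A ⊗ B` with index `(λ, δ)`. -/
def seminorm (p : Λ → Seminorm ℂ A) (q : Δ → Seminorm ℂ B) (ld : Λ × Δ) :
    Seminorm ℂ (MinTensor p q) :=
  Seminorm.ofSMulLE (fun z => ‖z.1 ld‖) norm_zero (fun z w => norm_add_le (z.1 ld) (w.1 ld))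
    (fun c z => SpatialCompletion.norm_smul_le' c (z.1 ld))

/-- The elementary tensor `a ⊗ b`. -/
def tmul (p : Λ → Seminorm ℂ A) (q : Δ → Seminorm ℂ B) (a : A) (b : B) : MinTensor p q :=
  ⟨diag p q (a ⊗ₜ b), StarSubalgebra.le_topologicalClosure _ ⟨a ⊗ₜ b, rfl⟩⟩

end MinTensor

/-! ### The tensor product of two maps -/

variable {ι κ H K : Type*} [NormedAddCommGroup H] [InnerProductSpace ℂ H] [CompleteSpace H]
  [NormedAddCommGroup K] [InnerProductSpace ℂ K] [CompleteSpace K] [Nonempty ι] [Nonempty κ]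
  {E : QuantizedDomain ι H} {F : QuantizedDomain κ K}

/-- `Φ ∈ CPCC_loc(A ⊗ B, C*(D_{E ⊗ F}))` and `Φ(a ⊗ b) = φ(a) ⊗ ψ(b)` for all `a`, `b`. -/
def IsTensorMap (p : Λ → Seminorm ℂ A) (q : Δ → Seminorm ℂ B) (φ : A →ₗ[ℂ] CStarOps E)
    (ψ : B →ₗ[ℂ] CStarOps F) (Φ : MinTensor p q →ₗ[ℂ] CStarOps (E.tensor F)) : Prop :=
  IsLocalCPCC (MinTensor.seminorm p q) Φ ∧
    ∀ a b, Φ (MinTensor.tmul p q a b) = tensorOp (φ a) (ψ b)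

open scoped Classical in
/-- The tensor product `φ ⊗ ψ` of two maps `φ ∈ CPCC_loc(A, C*(D_E))`, `ψ ∈ CPCC_loc(B, C*(D_F))`:
the unique map in `CPCC_loc(A ⊗ B, C*(D_{E ⊗ F}))` with `(φ ⊗ ψ)(a ⊗ b) = φ(a) ⊗ ψ(b)`.
For such `φ` and `ψ` this map exists, so that the default value `0` plays no role. -/
def tensorMap (p : Λ → Seminorm ℂ A) (q : Δ → Seminorm ℂ B) (φ : A →ₗ[ℂ] CStarOps E)
    (ψ : B →ₗ[ℂ] CStarOps F) : MinTensor p q →ₗ[ℂ] CStarOps (E.tensor F) :=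
  if h : ∃ Φ, IsTensorMap p q φ ψ Φ then h.choose else 0

end MinTensor

end LocCStar

end

noncomputable section

namespace LocCStar

open scoped TensorProduct InnerProductSpace ComplexOrder

/-! ### `C*`-seminorms -/

section CStarSeminorm

variable {A : Type*} [Ring A] [StarRing A] [Algebra ℂ A]

/-! Write `Φ` for `φ ⊗ ψ`. For `b ∈ B` and `η ∈ D_F`, the slice `a ↦ (id ⊗ ω_η)(χ(a ⊗ b* b))` is
positive, and it stays below the same slice of `Φ`, which is `⟪η, ψ(b* b) η⟫ φ`. Purity makes it a
multiple of `φ`. Polarization in `b` and in `η` then shows that `⟪ξ ⊗ η, χ(a ⊗ b)(ξ' ⊗ η')⟫` is the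
product of `⟪ξ, φ(a) ξ'⟫` with a scalar that does not depend on `a`, `ξ`, `ξ'`
(`exists_leftSlice_eq_smul`, `matrix_element_eq`). If `φ ≠ 0`, some `t = ⟪ξ₀, φ(a₀* a₀) ξ₀⟫` is
positive, and the scalar is read off from the other slice, `ψ' = t⁻¹ (ω_{ξ₀} ⊗ id)(χ(a₀* a₀ ⊗ ·))`.
Since `ψ - ψ'` is the same slice of `Φ - χ`, it is positive as well (`exists_factor`). If `φ = 0`,
then `χ` vanishes on elementary tensors and `ψ' = 0` will do.

For this argument, membership in `CPCC_loc` has to be tested on slices. `IsFormCPCC` replaces the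
matrix conditions by three scalar ones: a positive semidefinite kernel, local boundedness with an
arbitrary constant, and `θ(1) ≤ 1`. The equivalence rests on two facts. A matrix over `C*(D_E)` with
positive quadratic form is some `b* b` (`exists_conjTranspose_mul_self`, by gluing square roots
taken on the spaces `H_k ^ n`). The constant in the bound can be removed by iterating the
Cauchy–Schwarz inequality along the powers `h ^ (2 ^ m)` (`norm_le_of_pow_bound`). Contractivity of
a positive summand of a contractive map is then automatic (`IsFormCPCC.of_add`).

It also has to be proved that `φ ⊗ ψ` exists and is unique. A GNS construction for finitely many
vectors writes matrix elements of `φ` and `ψ` as matrix elements of representations, so those of `φ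
⊗ ψ` come from `π ⊗ ρ`; positivity and the bound by the spatial seminorms follow, and the map
extends to the completion. Uniqueness is density of the algebraic tensor product. -/

/-- `p` is submultiplicative and satisfies the `C*`-identity. -/
structure IsCStarSeminorm (p : Seminorm ℂ A) : Prop where
  mul_le : ∀ a b, p (a * b) ≤ p a * p b
  star_mul_self : ∀ a, p (star a * a) = p a ^ 2

namespace IsCStarSeminorm

variable {p : Seminorm ℂ A} (hp : IsCStarSeminorm p)

include hp

theorem le_star (a : A) : p a ≤ p (star a) := by
  have h := hp.mul_le (star a) a
  rw [hp.star_mul_self, sq] at h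
  rcases (apply_nonneg p a).eq_or_lt with h0 | h0
  · rw [← h0]; exact apply_nonneg p _
  · exact le_of_mul_le_mul_right h h0

theorem map_star (a : A) : p (star a) = p a :=
  le_antisymm (by simpa using hp.le_star (star a)) (hp.le_star a)

theorem map_one_le : p 1 ≤ 1 := by
  have h := hp.star_mul_self 1
  rw [star_one, mul_one] at h
  nlinarith [sq_nonneg (p 1 - 1)]

end IsCStarSeminorm

/-- The algebra `A` with the seminorm `p`. -/
def SeminormAlg {p : Seminorm ℂ A} (_hp : IsCStarSeminorm p) : Type _ := A

namespace SeminormAlg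

variable {p : Seminorm ℂ A} {hp : IsCStarSeminorm p}

instance : Ring (SeminormAlg hp) := inferInstanceAs (Ring A)

instance : Algebra ℂ (SeminormAlg hp) := inferInstanceAs (Algebra ℂ A)

instance : StarRing (SeminormAlg hp) := inferInstanceAs (StarRing A)

instance : SeminormedRing (SeminormAlg hp) where
  __ := (inferInstance : Ring (SeminormAlg hp))
  __ := AddGroupSeminorm.toSeminormedAddCommGroup (E := SeminormAlg hp) p.toAddGroupSeminorm
  norm_mul_le x y := hp.mul_le x y

instance : NormedAlgebra ℂ (SeminormAlg hp) where
  __ := (inferInstance : Algebra ℂ (SeminormAlg hp))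
  norm_smul_le c x := (map_smul_eq_mul p c x).le

instance : NormedStarGroup (SeminormAlg hp) where
  norm_star_le x := (hp.map_star x).le

end SeminormAlg

open UniformSpace

/-- The `C*`-algebra obtained from `A` by completion for the `C*`-seminorm `p`. -/
def SeminormCompletion {p : Seminorm ℂ A} (hp : IsCStarSeminorm p) : Type _ :=
  Completion (SeminormAlg hp)

namespace SeminormCompletion

variable {p : Seminorm ℂ A} {hp : IsCStarSeminorm p}

instance : NormedRing (SeminormCompletion hp) :=
  inferInstanceAs (NormedRing (Completion (SeminormAlg hp)))

instance : Algebra ℂ (SeminormCompletion hp) :=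
  inferInstanceAs (Algebra ℂ (Completion (SeminormAlg hp)))

instance : NormedAlgebra ℂ (SeminormCompletion hp) where
  __ := (inferInstance : Algebra ℂ (SeminormCompletion hp))
  norm_smul_le c z := norm_smul_le (α := ℂ) (β := Completion (SeminormAlg hp)) c z

instance : CompleteSpace (SeminormCompletion hp) :=
  inferInstanceAs (CompleteSpace (Completion (SeminormAlg hp)))

/-- The canonical map of `A` into its completion. -/
def of (hp : IsCStarSeminorm p) : A →ₐ[ℂ] SeminormCompletion hp where
  toFun x := ((show SeminormAlg hp from x : SeminormAlg hp) : Completion (SeminormAlg hp))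
  map_one' := Completion.coe_one _
  map_mul' x y := Completion.coe_mul (α := SeminormAlg hp) x y
  map_zero' := Completion.coe_zero
  map_add' x y := Completion.coe_add (α := SeminormAlg hp) x y
  commutes' _ := rfl

theorem norm_of (x : A) : ‖of hp x‖ = p x := Completion.norm_coe (E := SeminormAlg hp) x

theorem denseRange_of : DenseRange (of hp) := Completion.denseRange_coe (α := SeminormAlg hp)

theorem induction {P : SeminormCompletion hp → Prop} (hc : IsClosed {z | P z})
    (h : ∀ x : A, P (of hp x)) (z : SeminormCompletion hp) : P z :=
  Completion.induction_on (α := SeminormAlg hp) z hc h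

/-- The extension of the involution by continuity. -/
def starFun (z : SeminormCompletion hp) : SeminormCompletion hp :=
  Completion.map (star : SeminormAlg hp → SeminormAlg hp) z

theorem continuous_starFun : Continuous (starFun : SeminormCompletion hp → _) :=
  Completion.continuous_map

theorem starFun_of (x : A) : starFun (of hp x) = of hp (star x) :=
  Completion.map_coe (f := (star : SeminormAlg hp → SeminormAlg hp))
    (starNormedAddGroupHom (E := SeminormAlg hp)).uniformContinuous x

instance : StarRing (SeminormCompletion hp) where
  star := starFun
  star_involutive := induction
    (isClosed_eq (continuous_starFun.comp continuous_starFun) continuous_id)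
    fun x => by rw [starFun_of, starFun_of, star_star]
  star_add z w := by
    refine induction (P := fun z => starFun (z + w) = starFun z + starFun w)
      (isClosed_eq (continuous_starFun.comp (continuous_id.add continuous_const))
        (continuous_starFun.add continuous_const)) (fun x => ?_) z
    refine induction (P := fun w => starFun (of hp x + w) = starFun (of hp x) + starFun w)
      (isClosed_eq (continuous_starFun.comp (continuous_const.add continuous_id))
        (continuous_const.add continuous_starFun)) (fun y => ?_) w
    rw [← map_add, starFun_of, starFun_of, starFun_of, star_add, map_add]
  star_mul z w := by
    refine induction (P := fun z => starFun (z * w) = starFun w * starFun z)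
      (isClosed_eq (continuous_starFun.comp (continuous_id.mul continuous_const))
        (continuous_const.mul continuous_starFun)) (fun x => ?_) z
    refine induction (P := fun w => starFun (of hp x * w) = starFun w * starFun (of hp x))
      (isClosed_eq (continuous_starFun.comp (continuous_const.mul continuous_id))
        (continuous_starFun.mul continuous_const)) (fun y => ?_) w
    rw [← map_mul, starFun_of, starFun_of, starFun_of, star_mul, map_mul]

theorem star_of (x : A) : star (of hp x) = of hp (star x) := starFun_of x

instance : ContinuousStar (SeminormCompletion hp) := ⟨continuous_starFun⟩

instance : CStarRing (SeminormCompletion hp) where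
  norm_mul_self_le z := by
    refine induction (P := fun z => ‖z‖ * ‖z‖ ≤ ‖star z * z‖)
      (isClosed_le (by fun_prop) (by fun_prop)) (fun x => ?_) z
    rw [star_of, ← map_mul, norm_of, norm_of, hp.star_mul_self, sq]

variable [StarModule ℂ A]

instance : StarModule ℂ (SeminormCompletion hp) where
  star_smul c z := by
    refine induction (P := fun z => star (c • z) = star c • star z)
      (isClosed_eq (continuous_star.comp (continuous_const_smul c))
        (continuous_star.const_smul (star c))) (fun x => ?_) z
    rw [← map_smul, star_of, star_of, star_smul, map_smul]

instance : CStarAlgebra (SeminormCompletion hp) where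

instance : PartialOrder (SeminormCompletion hp) := CStarAlgebra.spectralOrder _

instance : StarOrderedRing (SeminormCompletion hp) := CStarAlgebra.spectralOrderedRing _

end SeminormCompletion

/-! ### Seminorms of matrices over an algebra with a `C*`-seminorm. -/

namespace IsCStarSeminorm

variable [StarModule ℂ A] {p : Seminorm ℂ A} (hp : IsCStarSeminorm p)

include hp

/-- In the completion every `star (x j) * x j` is positive, and the norm of a `C*`-algebra is
monotone on positive elements. -/
theorem sq_le_sum {n : ℕ} (x : Fin n → A) (i : Fin n) :
    p (x i) ^ 2 ≤ p (∑ j, star (x j) * x j) := by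
  rw [← hp.star_mul_self, ← SeminormCompletion.norm_of (hp := hp),
    ← SeminormCompletion.norm_of (hp := hp)]
  have h : ∀ j, 0 ≤ SeminormCompletion.of hp (star (x j) * x j) := fun j => by
    rw [map_mul, ← SeminormCompletion.star_of]; exact star_mul_self_nonneg _
  refine CStarAlgebra.norm_le_norm_of_nonneg_of_le (h i) ?_
  rw [map_sum]
  exact Finset.single_le_sum (f := fun j => SeminormCompletion.of hp (star (x j) * x j))
    (fun j _ => h j) (Finset.mem_univ i)

omit [StarRing A] [StarModule ℂ A] hp in
theorem _root_.LocCStar.seminorm_sum_le (p : Seminorm ℂ A) {n : ℕ} (x : Fin n → A) :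
    p (∑ j, x j) ≤ ∑ j, p (x j) :=
  Finset.le_sum_of_subadditive p (map_zero p).le (map_add_le_add p) _ _

omit [StarModule ℂ A] in
theorem sum_le {n : ℕ} (x : Fin n → A) : p (∑ j, star (x j) * x j) ≤ ∑ j, p (x j) ^ 2 :=
  (seminorm_sum_le p _).trans (Finset.sum_le_sum fun j _ => (hp.star_mul_self _).le)

open scoped Matrix

/-- A crude bound. It makes the supremum in `matSeminorm` finite and settles the case of null
vectors, which cannot be normalized. -/
theorem mulVec_sum_le {n : ℕ} (a : Matrix (Fin n) (Fin n) A) (x : Fin n → A) :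
    p (∑ i, star ((a *ᵥ x) i) * (a *ᵥ x) i) ≤
      (∑ i, (∑ j, p (a i j)) ^ 2) * p (∑ j, star (x j) * x j) := by
  refine (hp.sum_le _).trans ?_
  rw [Finset.sum_mul]
  refine Finset.sum_le_sum fun i _ => ?_
  have hx : ∀ j, p (x j) ≤ √(p (∑ j, star (x j) * x j)) := fun j =>
    Real.le_sqrt_of_sq_le (hp.sq_le_sum x j)
  have h1 : p ((a *ᵥ x) i) ≤ (∑ j, p (a i j)) * √(p (∑ j, star (x j) * x j)) := by
    rw [Finset.sum_mul]
    refine (seminorm_sum_le p _).trans (Finset.sum_le_sum fun j _ => ?_)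
    exact (hp.mul_le _ _).trans (mul_le_mul_of_nonneg_left (hx j) (apply_nonneg p _))
  calc p ((a *ᵥ x) i) ^ 2 ≤ ((∑ j, p (a i j)) * √(p (∑ j, star (x j) * x j))) ^ 2 := by
        gcongr
    _ = _ := by rw [mul_pow, Real.sq_sqrt (apply_nonneg p _)]

theorem bddAbove_matSeminorm {n : ℕ} (a : Matrix (Fin n) (Fin n) A) :
    BddAbove {r : ℝ | ∃ x : Fin n → A, p (∑ j, star (x j) * x j) ≤ 1 ∧
      r = √(p (∑ i, star ((a *ᵥ x) i) * (a *ᵥ x) i))} := by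
  refine ⟨√(∑ i, (∑ j, p (a i j)) ^ 2), ?_⟩
  rintro _ ⟨x, hx, rfl⟩
  refine Real.sqrt_le_sqrt ((hp.mulVec_sum_le a x).trans ?_)
  exact mul_le_of_le_one_right (Finset.sum_nonneg fun i _ => sq_nonneg _) hx

omit [StarModule ℂ A] hp in
theorem _root_.LocCStar.matSeminorm_nonneg (p : Seminorm ℂ A) {n : ℕ}
    (a : Matrix (Fin n) (Fin n) A) : 0 ≤ matSeminorm p a :=
  Real.sSup_nonneg (by rintro _ ⟨x, -, rfl⟩; exact Real.sqrt_nonneg _)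

/-- Homogeneity: `x` is rescaled to a vector of length one. When its length is zero, `mulVec_sum_le`
forces the left side to vanish. -/
theorem sqrt_mulVec_le {n : ℕ} (a : Matrix (Fin n) (Fin n) A) (x : Fin n → A) :
    √(p (∑ i, star ((a *ᵥ x) i) * (a *ᵥ x) i)) ≤
      matSeminorm p a * √(p (∑ j, star (x j) * x j)) := by
  set s := √(p (∑ j, star (x j) * x j)) with hs
  have hs2 : p (∑ j, star (x j) * x j) = s ^ 2 := (Real.sq_sqrt (apply_nonneg p _)).symm
  rcases (Real.sqrt_nonneg (p (∑ j, star (x j) * x j))).eq_or_lt with h0 | h0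
  · have h1 := hp.mulVec_sum_le a x
    rw [hs2, hs, ← h0] at h1
    have h2 : p (∑ i, star ((a *ᵥ x) i) * (a *ᵥ x) i) = 0 :=
      le_antisymm (by simpa using h1) (apply_nonneg p _)
    rw [h2, hs, ← h0]; simp
  · have hs0 : (0 : ℝ) < s := h0
    have key : ∀ (y : Fin n → A), p (∑ i, star (((s⁻¹ : ℝ) : ℂ) • y i) * (((s⁻¹ : ℝ) : ℂ) • y i)) =
        (s⁻¹) ^ 2 * p (∑ i, star (y i) * y i) := fun y => by
      simp only [star_smul, smul_mul_smul_comm, ← Finset.smul_sum, map_smul_eq_mul]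
      simp [abs_of_pos hs0, sq]
    have h1 := le_csSup (hp.bddAbove_matSeminorm a) ⟨((s⁻¹ : ℝ) : ℂ) • x, by
      simp only [Pi.smul_apply, key]; rw [hs2]; exact (by field_simp : s⁻¹ ^ 2 * s ^ 2 = 1).le, rfl⟩
    rw [Matrix.mulVec_smul] at h1
    simp only [Pi.smul_apply, key] at h1
    rw [Real.sqrt_mul (sq_nonneg _), Real.sqrt_sq (inv_nonneg.2 hs0.le)] at h1
    rwa [inv_mul_le_iff₀ hs0, mul_comm] at h1

theorem le_matSeminorm {n : ℕ} (a : Matrix (Fin n) (Fin n) A) (i j : Fin n) :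
    p (a i j) ≤ matSeminorm p a := by
  have h := hp.sqrt_mulVec_le a (Pi.single j 1)
  have h1 : √(p (∑ k, star ((Pi.single j 1 : Fin n → A) k) * (Pi.single j 1 : Fin n → A) k)) ≤ 1 := by
    rw [Finset.sum_eq_single j (fun k _ hk => by simp [hk]) (by simp)]
    simpa using hp.map_one_le
  rw [Matrix.mulVec_single_one] at h
  refine le_trans ?_ (h.trans (mul_le_of_le_one_right (matSeminorm_nonneg p a) h1))
  exact Real.le_sqrt_of_sq_le (hp.sq_le_sum (fun i => a i j) i)

/-- Reduces the relation `a =_λ 0` in `M_n(A)` to the entries, so that the bounds for matrices of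
size one control it. -/
theorem matSeminorm_eq_zero_iff {n : ℕ} (a : Matrix (Fin n) (Fin n) A) :
    matSeminorm p a = 0 ↔ ∀ i j, p (a i j) = 0 := by
  refine ⟨fun h i j => le_antisymm (h ▸ hp.le_matSeminorm a i j) (apply_nonneg p _), fun h => ?_⟩
  refine le_antisymm (Real.sSup_nonpos ?_) (matSeminorm_nonneg p a)
  rintro _ ⟨x, -, rfl⟩
  have h1 := hp.mulVec_sum_le a x
  simp only [h, Finset.sum_const_zero] at h1
  rw [Real.sqrt_eq_zero_of_nonpos (by simpa using h1)]

theorem matSeminorm_one_by_one (a : A) : matSeminorm p (fun _ _ : Fin 1 => a) = p a := by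
  refine le_antisymm (Real.sSup_le ?_ (apply_nonneg p a))
    (hp.le_matSeminorm (fun _ _ : Fin 1 => a) 0 0)
  rintro _ ⟨x, hx, rfl⟩
  simp only [Matrix.mulVec, dotProduct, Finset.univ_unique, Fin.default_eq_zero,
    Finset.sum_singleton, hp.star_mul_self] at hx ⊢
  rw [Real.sqrt_sq (apply_nonneg p _)]
  refine (hp.mul_le _ _).trans (mul_le_of_le_one_right (apply_nonneg p a) ?_)
  exact (sq_le_one_iff₀ (apply_nonneg p _)).1 hx

/-- The norm of the matrix over the completion is bounded by `matSeminorm`. -/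
theorem norm_cstarMatrix_le {n : ℕ} (a : Matrix (Fin n) (Fin n) A) :
    ‖CStarMatrix.ofMatrix (a.map (SeminormCompletion.of hp))‖ ≤ matSeminorm p a := by
  have key : ∀ w : Fin n → SeminormCompletion hp,
      √‖∑ i, star (∑ j, SeminormCompletion.of hp (a i j) * w j) *
        ∑ j, SeminormCompletion.of hp (a i j) * w j‖ ≤
      matSeminorm p a * √‖∑ j, star (w j) * w j‖ := by
    intro w
    have hd : DenseRange (Pi.map fun _ : Fin n => (SeminormCompletion.of hp : A → _)) :=
      DenseRange.piMap fun _ => SeminormCompletion.denseRange_of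
    refine hd.induction_on w (isClosed_le (by fun_prop) (by fun_prop)) fun x => ?_
    simp only [Pi.map_apply, ← map_mul, ← map_sum, SeminormCompletion.star_of,
      SeminormCompletion.norm_of]
    exact hp.sqrt_mulVec_le a x
  -- The norm of `CStarMatrix` comes from the action on row vectors from the right, `matSeminorm`
  -- from columns. Taking the adjoint of the matrix and of the entries of the vector exchanges the
  -- two.
  rw [← norm_star, CStarMatrix.norm_def]
  refine ContinuousLinearMap.opNorm_le_bound _ (matSeminorm_nonneg p a) fun v => ?_
  have h := key fun j => star (v j)
  rw [WithCStarModule.pi_norm, WithCStarModule.pi_norm, CStarMatrix.toCLM_apply_eq_sum]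
  simp only [WithCStarModule.inner_def, CStarMatrix.star_apply, star_sum, star_mul, star_star,
    WithCStarModule.equiv_symm_pi_apply] at h ⊢
  exact h

/-- Matrices over the completion form a `C*`-algebra, where `‖(M* M) ^ k‖ ≤ ‖M‖ ^ (2k)`. This is the
growth condition needed for `norm_le_of_pow_bound`. -/
theorem entry_pow_le {n : ℕ} (a : Matrix (Fin n) (Fin n) A) (k : ℕ) (hk : k ≠ 0) (i j : Fin n) :
    p (((aᴴ * a) ^ k) i j) ≤ (matSeminorm p a ^ 2) ^ k := by
  set M : CStarMatrix (Fin n) (Fin n) (SeminormCompletion hp) :=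
    CStarMatrix.ofMatrix (a.map (SeminormCompletion.of hp)) with hM
  have h1 : CStarMatrix.ofMatrix (((aᴴ * a) ^ k).map (SeminormCompletion.of hp)) =
      (star M * M) ^ k := by
    have h2 : ((aᴴ * a) ^ k).map (SeminormCompletion.of hp) =
        ((a.map (SeminormCompletion.of hp))ᴴ * a.map (SeminormCompletion.of hp)) ^ k := by
      have := map_pow (SeminormCompletion.of hp).mapMatrix (aᴴ * a) k
      rw [map_mul] at this
      simp only [AlgHom.mapMatrix_apply] at this
      rw [this]
      congr 2
      ext i j
      simp [SeminormCompletion.star_of]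
    rw [h2]
    exact map_pow CStarMatrix.ofMatrixStarAlgEquiv _ k
  have h3 : ‖(star M * M) ^ k‖ ≤ (matSeminorm p a ^ 2) ^ k := by
    refine (norm_pow_le' _ (Nat.pos_of_ne_zero hk)).trans ?_
    rw [CStarRing.norm_star_mul_self, ← sq]
    gcongr
    exact hp.norm_cstarMatrix_le a
  rw [← SeminormCompletion.norm_of (hp := hp)]
  refine le_trans ?_ h3
  rw [← h1]
  exact CStarMatrix.norm_entry_le_norm
    (M := CStarMatrix.ofMatrix (((aᴴ * a) ^ k).map (SeminormCompletion.of hp)))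

end IsCStarSeminorm

end CStarSeminorm

/-! ### Positive functionals -/

section PositiveFunctional

variable {R : Type*} [Ring R] [StarRing R] [Algebra ℂ R] [StarModule ℂ R]

/-- Positivity makes `f` real at `(a + b)* (a + b)` and at `(a + ib)* (a + ib)`; comparing imaginary
parts gives the symmetry. -/
theorem map_star_of_pos {f : R →ₗ[ℂ] ℂ} (hf : ∀ a, 0 ≤ f (star a * a)) (a b : R) :
    starRingEnd ℂ (f (star a * b)) = f (star b * a) := by
  have him : ∀ a, (f (star a * a)).im = 0 := fun a => (Complex.nonneg_iff.1 (hf a)).2.symm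
  have h1 := him (a + b)
  have h2 := him (a + Complex.I • b)
  have h3 := him b
  simp only [star_add, star_smul, add_mul, mul_add, map_add, smul_mul_assoc, mul_smul_comm,
    map_smul, Complex.add_im, him, smul_eq_mul, Complex.mul_im, Complex.star_def, Complex.conj_I,
    Complex.I_re, Complex.I_im, Complex.neg_re, Complex.neg_im, Complex.mul_re] at h1 h2
  apply Complex.ext
  · simp; linarith
  · simp; linarith

/-- The semi-inner product `⟨a, b⟩ = f (a* b)` of a positive functional. -/
abbrev posFunctionalCore {f : R →ₗ[ℂ] ℂ} (hf : ∀ a, 0 ≤ f (star a * a)) :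
    PreInnerProductSpace.Core ℂ R where
  inner a b := f (star a * b)
  conj_inner_symm a b := map_star_of_pos hf b a
  re_inner_nonneg a := (Complex.nonneg_iff.1 (hf a)).1
  add_left a b c := by rw [star_add, add_mul, map_add]
  smul_left a b c := by rw [star_smul, smul_mul_assoc, map_smul]; rfl

theorem norm_sq_le_of_pos {f : R →ₗ[ℂ] ℂ} (hf : ∀ a, 0 ≤ f (star a * a)) (a : R) :
    ‖f a‖ ^ 2 ≤ (f 1).re * ‖f (star a * a)‖ := by
  have h := @InnerProductSpace.Core.inner_mul_inner_self_le ℂ R _ _ _ (posFunctionalCore hf) 1 a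
  change ‖f (star 1 * a)‖ * ‖f (star a * 1)‖ ≤ (f (star 1 * 1)).re * (f (star a * a)).re at h
  have h2 : ‖f (star a * 1)‖ = ‖f (star 1 * a)‖ := by
    rw [← map_star_of_pos hf 1 a, RCLike.norm_conj]
  rw [h2, star_one, one_mul, mul_one, ← sq] at h
  refine h.trans (mul_le_mul_of_nonneg_left (Complex.re_le_norm _) ?_)
  have := hf 1
  rw [star_one, one_mul] at this
  exact (Complex.nonneg_iff.1 this).1

/-- A positive functional that grows on the powers of a self-adjoint element `h` at most
like `r ^ k` satisfies `|f h| ≤ r f(1)`. -/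
theorem norm_le_of_pow_bound {f : R →ₗ[ℂ] ℂ} (hf : ∀ a, 0 ≤ f (star a * a)) {h : R}
    (hh : star h = h) {r C : ℝ} (hr : 0 ≤ r) (hC : ∀ k ≠ 0, ‖f (h ^ k)‖ ≤ C * r ^ k) :
    ‖f h‖ ≤ r * (f 1).re := by
  set u := (f 1).re with hu
  have hu0 : 0 ≤ u := by
    have := hf 1
    rw [star_one, one_mul] at this
    exact (Complex.nonneg_iff.1 this).1
  have hstep : ∀ k, ‖f (h ^ k)‖ ^ 2 ≤ u * ‖f (h ^ (2 * k))‖ := fun k => by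
    have := norm_sq_le_of_pos hf (h ^ k)
    rwa [star_pow, hh, ← pow_add, ← two_mul] at this
  -- Iterated Cauchy–Schwarz: `|f h| ^ (2 ^ m) ≤ u ^ (2 ^ m - 1) |f (h ^ (2 ^ m))|`, with a factor
  -- `u` on both sides to avoid the subtraction in the exponent.
  have hind : ∀ m : ℕ, u * ‖f h‖ ^ (2 ^ m) ≤ u ^ (2 ^ m) * ‖f (h ^ (2 ^ m))‖ := by
    intro m
    induction m with
    | zero => simp
    | succ m ih =>
      rcases hu0.eq_or_lt with h0 | h0
      · simp [← h0]
      have h1 : (u * ‖f h‖ ^ (2 ^ m)) ^ 2 ≤ (u ^ (2 ^ m) * ‖f (h ^ (2 ^ m))‖) ^ 2 := by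
        gcongr
      have h2 := hstep (2 ^ m)
      have h3 : u * (u * ‖f h‖ ^ (2 ^ (m + 1))) ≤
          u * (u ^ (2 ^ (m + 1)) * ‖f (h ^ (2 ^ (m + 1)))‖) := by
        calc u * (u * ‖f h‖ ^ (2 ^ (m + 1))) = (u * ‖f h‖ ^ (2 ^ m)) ^ 2 := by
              rw [pow_succ 2 m, pow_mul]; ring
          _ ≤ _ := h1
          _ = u ^ (2 ^ (m + 1)) * ‖f (h ^ (2 ^ m))‖ ^ 2 := by
              rw [mul_pow, pow_succ 2 m, pow_mul]
          _ ≤ u ^ (2 ^ (m + 1)) * (u * ‖f (h ^ (2 * 2 ^ m))‖) := by gcongr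
          _ = _ := by rw [pow_succ' 2 m]; ring
      exact le_of_mul_le_mul_left h3 h0
  rcases hu0.eq_or_lt with h0 | h0
  · have h1 := hstep 1
    rw [← h0] at h1 ⊢
    rw [zero_mul, pow_one] at h1
    have : ‖f h‖ = 0 := by nlinarith [norm_nonneg (f h)]
    rw [this]; simp
  by_contra! hlt
  rcases hr.eq_or_lt with hr0 | hr0
  · have h1 := hstep 1
    have h2 := hC (2 * 1) (by norm_num)
    rw [← hr0] at h2 hlt
    simp only [mul_one, ne_eq, OfNat.ofNat_ne_zero, not_false_eq_true, zero_pow, mul_zero,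
      zero_mul, pow_one] at h1 h2 hlt
    nlinarith [norm_nonneg (f (h ^ 2)), norm_nonneg (f h)]
  have hru : 0 < r * u := mul_pos hr0 h0
  -- A ratio greater than one has unbounded powers, while `hind` and `hC` bound its powers of
  -- exponent `2 ^ m` by `C / u`.
  have hq : 1 < ‖f h‖ / (r * u) := (one_lt_div hru).2 hlt
  have hbound : ∀ m : ℕ, (‖f h‖ / (r * u)) ^ (2 ^ m) ≤ C / u := by
    intro m
    rw [div_pow, div_le_div_iff₀ (by positivity) h0]
    calc ‖f h‖ ^ 2 ^ m * u = u * ‖f h‖ ^ 2 ^ m := mul_comm _ _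
      _ ≤ u ^ (2 ^ m) * ‖f (h ^ (2 ^ m))‖ := hind m
      _ ≤ u ^ (2 ^ m) * (C * r ^ (2 ^ m)) := by gcongr; exact hC _ (by positivity)
      _ = C * (r * u) ^ 2 ^ m := by rw [mul_pow]; ring
  obtain ⟨n, hn⟩ := pow_unbounded_of_one_lt (C / u) hq
  have h1 := hbound n
  have h2 : (‖f h‖ / (r * u)) ^ n ≤ (‖f h‖ / (r * u)) ^ (2 ^ n) :=
    pow_le_pow_right₀ hq.le Nat.lt_two_pow_self.le
  linarith

end PositiveFunctional

/-! ### Positive operators on Hilbert spaces -/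

section Hilbert

variable {X Y : Type*} [NormedAddCommGroup X] [InnerProductSpace ℂ X] [CompleteSpace X]
  [NormedAddCommGroup Y] [InnerProductSpace ℂ Y] [CompleteSpace Y]

theorem nonneg_of_form {T : X →L[ℂ] X} (h0 : ∀ x, 0 ≤ ⟪x, T x⟫_ℂ) : 0 ≤ T := by
  rw [ContinuousLinearMap.nonneg_iff_isPositive, ContinuousLinearMap.isPositive_iff_complex]
  intro x
  have h := Complex.nonneg_iff.1 (h0 x)
  rw [← inner_conj_symm]
  constructor
  · apply Complex.ext
    · simp only [RCLike.re_to_complex, Complex.ofReal_re]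
    · simp [-inner_conj_symm, ← h.2]
  · simpa [-inner_conj_symm] using h.1

theorem norm_le_of_form {T : X →L[ℂ] X} {c : ℝ} (hc : 0 ≤ c) (h0 : ∀ x, 0 ≤ ⟪x, T x⟫_ℂ)
    (h1 : ∀ x, (⟪x, T x⟫_ℂ).re ≤ c * ‖x‖ ^ 2) : ‖T‖ ≤ c := by
  have hpos := nonneg_of_form h0
  rw [CStarAlgebra.norm_le_iff_le_algebraMap T hc hpos, ← sub_nonneg]
  refine nonneg_of_form fun x => ?_
  have h2 : ⟪x, (algebraMap ℝ (X →L[ℂ] X) c - T) x⟫_ℂ = ((c * ‖x‖ ^ 2 : ℝ) : ℂ) - ⟪x, T x⟫_ℂ := by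
    rw [sub_apply, inner_sub_right]
    congr 1
    change ⟪x, (c • x : X)⟫_ℂ = _
    rw [← Complex.coe_smul, inner_smul_right, inner_self_eq_norm_sq_to_K]
    push_cast; rfl
  rw [h2]
  have h := Complex.nonneg_iff.1 (h0 x)
  refine Complex.nonneg_iff.2 ⟨?_, ?_⟩
  · rw [Complex.sub_re, Complex.ofReal_re]; linarith [h1 x]
  · rw [Complex.sub_im, Complex.ofReal_im, ← h.2, sub_zero]

/-- The positive square root of a positive operator. -/
def opSqrt (T : X →L[ℂ] X) : X →L[ℂ] X := CFC.sqrt T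

theorem opSqrt_mul_self {T : X →L[ℂ] X} (h0 : ∀ x, 0 ≤ ⟪x, T x⟫_ℂ) : opSqrt T * opSqrt T = T :=
  CFC.sqrt_mul_sqrt_self T (nonneg_of_form h0)

theorem inner_opSqrt (T : X →L[ℂ] X) (x y : X) : ⟪opSqrt T x, y⟫_ℂ = ⟪x, opSqrt T y⟫_ℂ :=
  ((ContinuousLinearMap.nonneg_iff_isPositive (opSqrt T)).1 (CFC.sqrt_nonneg _)).isSymmetric x y

/-- The square root of a positive operator commutes with the inclusion of a reducing subspace. -/
theorem opSqrt_comp_isometry (V : X →ₗᵢ[ℂ] Y) {T : X →L[ℂ] X} {S : Y →L[ℂ] Y}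
    (hT : ∀ x, 0 ≤ ⟪x, T x⟫_ℂ) (hS : ∀ x, 0 ≤ ⟪x, S x⟫_ℂ) (h : ∀ x, S (V x) = V (T x)) (x : X) :
    opSqrt S (V x) = V (opSqrt T x) := by
  replace hT := nonneg_of_form hT
  replace hS := nonneg_of_form hS
  unfold opSqrt
  set W : X →L[ℂ] Y := V.toContinuousLinearMap with hW
  set W' : Y →L[ℂ] X := ContinuousLinearMap.adjoint W with hW'
  have hWW : ∀ x, W' (W x) = x := fun x => by
    refine ext_inner_right ℂ fun y => ?_
    rw [ContinuousLinearMap.adjoint_inner_left]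
    exact V.inner_map_map x y
  have hTs : ∀ x y, ⟪T x, y⟫_ℂ = ⟪x, T y⟫_ℂ := fun x y =>
    ((ContinuousLinearMap.nonneg_iff_isPositive T).1 hT).isSymmetric x y
  have hSs : ∀ x y, ⟪S x, y⟫_ℂ = ⟪x, S y⟫_ℂ := fun x y =>
    ((ContinuousLinearMap.nonneg_iff_isPositive S).1 hS).isSymmetric x y
  have hWS : ∀ y, W' (S y) = T (W' y) := fun y => by
    refine ext_inner_right ℂ fun z => ?_
    rw [ContinuousLinearMap.adjoint_inner_left, hTs, ContinuousLinearMap.adjoint_inner_left, hSs]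
    exact congrArg _ (h z)
  -- The range of `V` reduces `S`, so the projection `W W'` commutes with `S`, and by functional
  -- calculus with its square root.
  have hcomm : Commute S (W ∘L W') := by
    ext y
    change S (V (W' y)) = V (W' (S y))
    rw [h, hWS]
  have hR : Commute (CFC.sqrt S) (W ∘L W') := by
    rw [CFC.sqrt_eq_cfc]
    exact hcomm.cfc_nnreal _
  have hR' : ∀ y, CFC.sqrt S (W (W' y)) = W (W' (CFC.sqrt S y)) := fun y =>
    congrArg (fun Q : Y →L[ℂ] Y => Q y) hR
  have hpos : 0 ≤ W' ∘L CFC.sqrt S ∘L W := by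
    have := ((ContinuousLinearMap.nonneg_iff_isPositive _).1 (CFC.sqrt_nonneg S)).adjoint_conj W
    exact (ContinuousLinearMap.nonneg_iff_isPositive _).2 this
  -- The compression of `√S` to the range of `V` is positive and squares to `T`; positive square
  -- roots are unique.
  have huniq : CFC.sqrt T = W' ∘L CFC.sqrt S ∘L W := by
    refine CFC.sqrt_unique ?_ hpos
    ext x
    change W' (CFC.sqrt S (W (W' (CFC.sqrt S (W x))))) = T x
    rw [hR', hWW]
    have h1 : CFC.sqrt S (CFC.sqrt S (W x)) = S (W x) :=
      congrArg (fun Q : Y →L[ℂ] Y => Q (W x)) (CFC.sqrt_mul_sqrt_self S hS)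
    rw [h1, hWS, hWW]
  rw [huniq]
  change CFC.sqrt S (W x) = W (W' (CFC.sqrt S (W x)))
  rw [← hR', hWW]

end Hilbert

/-! ### Operators on a quantized domain -/

section Operators

variable {ι H : Type*} [NormedAddCommGroup H] [InnerProductSpace ℂ H] {E : QuantizedDomain ι H}

namespace CStarOps

theorem mul_apply (S T : CStarOps E) (x : E.dom) : (S * T).1 x = S.1 (T.1 x) := rfl

theorem add_apply (S T : CStarOps E) (x : E.dom) : (S + T).1 x = S.1 x + T.1 x := rfl

theorem sub_apply (S T : CStarOps E) (x : E.dom) : (S - T).1 x = S.1 x - T.1 x := rfl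

theorem smul_apply (c : ℂ) (T : CStarOps E) (x : E.dom) : (c • T).1 x = c • T.1 x := rfl

theorem zero_apply (x : E.dom) : (0 : CStarOps E).1 x = 0 := rfl

/-- Evaluation at a vector of the union space. -/
def evalLin (x : E.dom) : CStarOps E →ₗ[ℂ] E.dom where
  toFun T := T.1 x
  map_add' _ _ := rfl
  map_smul' _ _ := rfl

theorem sum_apply {α : Type*} (s : Finset α) (T : α → CStarOps E) (x : E.dom) :
    (∑ i ∈ s, T i).1 x = ∑ i ∈ s, (T i).1 x := map_sum (evalLin x) T s

theorem restr_mul (k : ι) (S T : CStarOps E) : restr k (S * T) = restr k S * restr k T := rfl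

theorem norm_apply_le (k : ι) (T : CStarOps E) {x : E.dom} (hx : (x : H) ∈ E.sub k) :
    ‖T.1 x‖ ≤ seminorm E k T * ‖x‖ := (restr k T).le_opNorm ⟨x, hx⟩

theorem seminorm_le {k : ι} {T : CStarOps E} {c : ℝ} (hc : 0 ≤ c)
    (h : ∀ x : E.dom, (x : H) ∈ E.sub k → ‖T.1 x‖ ≤ c * ‖x‖) : seminorm E k T ≤ c :=
  ContinuousLinearMap.opNorm_le_bound _ hc fun x => h ⟨x, E.sub_le_dom k x.2⟩ x.2

variable [Nonempty ι]

theorem ext_restr {S T : CStarOps E} (h : ∀ k, restr k S = restr k T) : S = T := by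
  refine ext' fun x => Subtype.ext ?_
  obtain ⟨k, hk⟩ := E.mem_dom.1 x.2
  exact congrArg (fun R : E.sub k →L[ℂ] E.sub k => (R ⟨x, hk⟩ : H)) (h k)

theorem exists_common_sub {n : ℕ} (x : Fin n → E.dom) : ∃ k, ∀ i, (x i : H) ∈ E.sub k := by
  choose f hf using fun i => E.mem_dom.1 (x i).2
  obtain ⟨k, hk⟩ := E.directed_sub.finite_le f
  exact ⟨k, fun i => hk i (hf i)⟩

/-- A coherent family of bounded operators on the subspaces `H_k`, with a coherent family of
adjoints, comes from an operator in `C*(D_E)`. -/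
theorem exists_of_family (R R' : ∀ k, E.sub k →L[ℂ] E.sub k)
    (hR : ∀ k l (h : E.sub k ≤ E.sub l) (x : E.sub k), (R l ⟨x, h x.2⟩ : H) = R k x)
    (hR' : ∀ k l (h : E.sub k ≤ E.sub l) (x : E.sub k), (R' l ⟨x, h x.2⟩ : H) = R' k x)
    (hadj : ∀ k x y, ⟪R k x, y⟫_ℂ = ⟪x, R' k y⟫_ℂ) :
    ∃ T : CStarOps E, ∀ k, restr k T = R k := by
  have key : ∀ Q : ∀ k, E.sub k →L[ℂ] E.sub k,
      (∀ k l (h : E.sub k ≤ E.sub l) (x : E.sub k), (Q l ⟨x, h x.2⟩ : H) = Q k x) →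
      ∃ T : Module.End ℂ E.dom, ∀ k (x : E.dom) (hx : (x : H) ∈ E.sub k),
        (T x : H) = Q k ⟨x, hx⟩ := by
    intro Q hQ
    -- The value at `x` may be computed in any subspace containing `x`: two of them lie in a third
    -- one, where coherence applies.
    have h1 : ∀ k l (x : E.dom) (hk : (x : H) ∈ E.sub k) (hl : (x : H) ∈ E.sub l),
        (Q k ⟨x, hk⟩ : H) = Q l ⟨x, hl⟩ := by
      intro k l x hk hl
      obtain ⟨m, hm, hm'⟩ := E.directed_sub k l
      exact (hQ k m hm ⟨x, hk⟩).symm.trans (hQ l m hm' ⟨x, hl⟩)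
    choose κ hκ using fun x : E.dom => E.mem_dom.1 x.2
    refine ⟨{ toFun := fun x => ⟨Q (κ x) ⟨x, hκ x⟩, E.sub_le_dom _ (Q (κ x) ⟨x, hκ x⟩).2⟩
              map_add' := fun x y => ?_, map_smul' := fun c x => ?_ }, fun k x hx => ?_⟩
    · obtain ⟨m, hm, hm'⟩ := E.directed_sub (κ x) (κ y)
      refine Subtype.ext ?_
      change (Q (κ (x + y)) ⟨(x : H) + y, hκ (x + y)⟩ : H) =
        (Q (κ x) ⟨x, hκ x⟩ : H) + Q (κ y) ⟨y, hκ y⟩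
      rw [h1 (κ x) m x (hκ x) (hm (hκ x)), h1 (κ y) m y (hκ y) (hm' (hκ y)),
        show (Q (κ (x + y)) ⟨(x : H) + y, hκ (x + y)⟩ : H) = _ from
          h1 (κ (x + y)) m (x + y) (hκ _) (add_mem (hm (hκ x)) (hm' (hκ y)))]
      exact congrArg Subtype.val (map_add (Q m) ⟨x, hm (hκ x)⟩ ⟨y, hm' (hκ y)⟩)
    · refine Subtype.ext ?_
      change (Q (κ (c • x)) ⟨c • (x : H), hκ (c • x)⟩ : H) = c • (Q (κ x) ⟨x, hκ x⟩ : H)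
      rw [show (Q (κ (c • x)) ⟨c • (x : H), hκ (c • x)⟩ : H) = _ from
        h1 (κ (c • x)) (κ x) (c • x) (hκ _) ((E.sub (κ x)).smul_mem c (hκ x))]
      exact congrArg Subtype.val (map_smul (Q (κ x)) c ⟨x, hκ x⟩)
    · exact h1 _ _ x _ _
  obtain ⟨T, hT⟩ := key R hR
  obtain ⟨T', hT'⟩ := key R' hR'
  refine ⟨⟨T, mem_of_adjoint T T' (fun k x hx => ?_) (fun k x hx => ?_)
    (fun k => ⟨‖R k‖, fun x hx => ?_⟩) fun x y => ?_⟩, fun k => ?_⟩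
  · rw [hT k x hx]; exact Subtype.prop _
  · rw [hT' k x hx]; exact Subtype.prop _
  · change ‖(T x : H)‖ ≤ _
    rw [hT k x hx]; exact (R k).le_opNorm ⟨x, hx⟩
  · obtain ⟨k, hk⟩ := E.mem_dom.1 x.2
    obtain ⟨l, hl⟩ := E.mem_dom.1 y.2
    obtain ⟨m, hm, hm'⟩ := E.directed_sub k l
    rw [hT m x (hm hk), hT' m y (hm' hl)]
    exact hadj m ⟨x, hm hk⟩ ⟨y, hm' hl⟩
  · ext x
    exact hT k ⟨x, E.sub_le_dom k x.2⟩ x.2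

variable [CompleteSpace H]

theorem inner_left_star (T : CStarOps E) (x y : E.dom) :
    ⟪T.1 x, y⟫_ℂ = ⟪x, (star T).1 y⟫_ℂ := inner_star T x y

theorem inner_right_star (T : CStarOps E) (x y : E.dom) :
    ⟪x, T.1 y⟫_ℂ = ⟪(star T).1 x, y⟫_ℂ := by
  rw [inner_left_star, star_star]

theorem restr_star (k : ι) (T : CStarOps E) :
    restr k (star T) = ContinuousLinearMap.adjoint (restr k T) := by
  rw [ContinuousLinearMap.eq_adjoint_iff]
  intro x y
  exact (inner_right_star T ⟨x, E.sub_le_dom k x.2⟩ ⟨y, E.sub_le_dom k y.2⟩).symm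

theorem isCStarSeminorm (k : ι) : IsCStarSeminorm (seminorm E k) where
  mul_le S T := by
    exact norm_mul_le (restr k S) (restr k T)
  star_mul_self T := by
    rw [seminorm_apply, seminorm_apply, restr_mul, restr_star, sq]
    exact CStarRing.norm_star_mul_self (x := restr k T)

theorem ext_form {S T : CStarOps E} (h : ∀ x, ⟪x, S.1 x⟫_ℂ = ⟪x, T.1 x⟫_ℂ) : S = T := by
  refine Subtype.ext ((ext_inner_map S.1 T.1).1 fun x => ?_)
  rw [← inner_conj_symm, h x, inner_conj_symm]

theorem seminorm_le_of_form {k : ι} {T : CStarOps E} {c : ℝ} (hc : 0 ≤ c)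
    (h0 : ∀ x : E.dom, (x : H) ∈ E.sub k → 0 ≤ ⟪x, T.1 x⟫_ℂ)
    (h1 : ∀ x : E.dom, (x : H) ∈ E.sub k → (⟪x, T.1 x⟫_ℂ).re ≤ c * ‖x‖ ^ 2) :
    seminorm E k T ≤ c := by
  exact norm_le_of_form hc (fun x => h0 ⟨x, E.sub_le_dom k x.2⟩ x.2)
    fun x => h1 ⟨x, E.sub_le_dom k x.2⟩ x.2

end CStarOps

end Operators

/-! ### Square roots of positive matrices over `C*(D_E)` -/

section MatrixSqrt

variable {ι H : Type*} [NormedAddCommGroup H] [InnerProductSpace ℂ H] {E : QuantizedDomain ι H}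
  {n : ℕ}

/-- The operator on `H_k ^ n` given by a matrix over `C*(D_E)`. -/
def blockOp (M : Matrix (Fin n) (Fin n) (CStarOps E)) (k : ι) :
    PiLp 2 (fun _ : Fin n => E.sub k) →L[ℂ] PiLp 2 (fun _ : Fin n => E.sub k) :=
  (PiLp.continuousLinearEquiv 2 ℂ fun _ : Fin n => E.sub k).symm ∘L
    ContinuousLinearMap.pi fun i => ∑ j, CStarOps.restr k (M i j) ∘L PiLp.proj 2 _ j

theorem blockOp_apply (M : Matrix (Fin n) (Fin n) (CStarOps E)) (k : ι)
    (x : PiLp 2 (fun _ : Fin n => E.sub k)) (i : Fin n) :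
    blockOp M k x i = ∑ j, CStarOps.restr k (M i j) (x j) := by
  simp [blockOp]

/-- The inclusion of the `j`-th summand. -/
def singleL (k : ι) (j : Fin n) : E.sub k →L[ℂ] PiLp 2 (fun _ : Fin n => E.sub k) :=
  (PiLp.continuousLinearEquiv 2 ℂ fun _ : Fin n => E.sub k).symm ∘L
    ContinuousLinearMap.single ℂ (fun _ : Fin n => E.sub k) j

theorem singleL_apply (k : ι) (j i : Fin n) (x : E.sub k) :
    singleL k j x i = if i = j then x else 0 := by
  simp [singleL, Pi.single_apply]

theorem sum_singleL (k : ι) (x : PiLp 2 (fun _ : Fin n => E.sub k)) :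
    ∑ j, singleL k j (x j) = x := by
  ext i
  simp [singleL_apply]

/-- The entry of an operator on `H_k ^ n`. -/
def entryL {k : ι} (R : PiLp 2 (fun _ : Fin n => E.sub k) →L[ℂ] PiLp 2 (fun _ : Fin n => E.sub k))
    (i j : Fin n) : E.sub k →L[ℂ] E.sub k :=
  PiLp.proj 2 _ i ∘L R ∘L singleL k j

theorem entryL_apply {k : ι}
    (R : PiLp 2 (fun _ : Fin n => E.sub k) →L[ℂ] PiLp 2 (fun _ : Fin n => E.sub k))
    (i j : Fin n) (x : E.sub k) : entryL R i j x = R (singleL k j x) i := rfl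

theorem entryL_mul {k : ι}
    (R S : PiLp 2 (fun _ : Fin n => E.sub k) →L[ℂ] PiLp 2 (fun _ : Fin n => E.sub k))
    (i j : Fin n) : entryL (R * S) i j = ∑ m, entryL R i m * entryL S m j := by
  ext x
  rw [entryL_apply, mul_apply_eq_comp, ← sum_singleL k (S (singleL k j x)), map_sum]
  simp [entryL_apply, _root_.sum_apply]

theorem inner_singleL {k : ι} (x : E.sub k) (i : Fin n)
    (y : PiLp 2 (fun _ : Fin n => E.sub k)) : ⟪singleL k i x, y⟫_ℂ = ⟪x, y i⟫_ℂ := by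
  rw [PiLp.inner_apply, Finset.sum_eq_single i]
  · simp [singleL_apply]
  · intro j _ hj; simp [singleL_apply, hj]
  · simp

theorem inner_singleL_right {k : ι} (x : E.sub k) (i : Fin n)
    (y : PiLp 2 (fun _ : Fin n => E.sub k)) : ⟪y, singleL k i x⟫_ℂ = ⟪y i, x⟫_ℂ := by
  rw [← inner_conj_symm, inner_singleL, inner_conj_symm]

theorem entryL_blockOp (M : Matrix (Fin n) (Fin n) (CStarOps E)) (k : ι) (i j : Fin n) :
    entryL (blockOp M k) i j = CStarOps.restr k (M i j) := by
  ext x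
  rw [entryL_apply, blockOp_apply, Finset.sum_eq_single j]
  · simp [singleL_apply]
  · intro m _ hm; simp [singleL_apply, hm]
  · simp

/-- The inclusion `H_k ^ n → H_l ^ n`. -/
def inclPow {k l : ι} (h : E.sub k ≤ E.sub l) :
    PiLp 2 (fun _ : Fin n => E.sub k) →ₗᵢ[ℂ] PiLp 2 (fun _ : Fin n => E.sub l) where
  toFun x := WithLp.toLp 2 fun i => Submodule.inclusion h (x i)
  map_add' x y := by ext; simp
  map_smul' c x := by ext; simp
  norm_map' x := by
    simp [PiLp.norm_eq_of_L2]

theorem inclPow_apply {k l : ι} (h : E.sub k ≤ E.sub l) (x : PiLp 2 (fun _ : Fin n => E.sub k))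
    (i : Fin n) : inclPow h x i = Submodule.inclusion h (x i) := rfl

theorem inclPow_singleL {k l : ι} (h : E.sub k ≤ E.sub l) (j : Fin n) (x : E.sub k) :
    inclPow h (singleL k j x) = singleL l j (Submodule.inclusion h x) := by
  ext i
  rw [inclPow_apply, singleL_apply, singleL_apply]
  split_ifs <;> simp

variable [Nonempty ι] [CompleteSpace H]

open scoped Matrix in
/-- A matrix over `C*(D_E)` whose quadratic form is positive is of the form `b* b`. -/
theorem exists_conjTranspose_mul_self {M : Matrix (Fin n) (Fin n) (CStarOps E)}
    (hM : ∀ x : Fin n → E.dom, 0 ≤ ∑ i, ∑ j, ⟪x i, (M i j).1 (x j)⟫_ℂ) :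
    ∃ b : Matrix (Fin n) (Fin n) (CStarOps E), M = bᴴ * b := by
  have hpos : ∀ k x, 0 ≤ ⟪x, blockOp M k x⟫_ℂ := fun k x => by
    have h := hM fun i => ⟨x i, E.sub_le_dom k (x i).2⟩
    rw [PiLp.inner_apply]
    simp only [blockOp_apply, inner_sum]
    exact h
  -- The square root is taken on each `H_k ^ n` separately. The roots fit together by
  -- `opSqrt_comp_isometry` for the inclusions `H_k ^ n → H_l ^ n`.
  set R := fun k => opSqrt (blockOp M k) with hR
  have hRR : ∀ k, R k * R k = blockOp M k := fun k => opSqrt_mul_self (hpos k)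
  have hRs : ∀ k x y, ⟪R k x, y⟫_ℂ = ⟪x, R k y⟫_ℂ := fun k x y =>
    inner_opSqrt _ x y
  have hcoh : ∀ i j k l (h : E.sub k ≤ E.sub l) (x : E.sub k),
      (entryL (R l) i j ⟨x, h x.2⟩ : H) = entryL (R k) i j x := by
    intro i j k l h x
    have h1 := opSqrt_comp_isometry (inclPow h) (hpos k) (hpos l) (fun x => by
      ext m
      simp only [blockOp_apply, inclPow_apply, map_sum]
      push_cast
      rfl) (singleL k j x)
    rw [inclPow_singleL] at h1
    exact congrArg (fun y : PiLp 2 (fun _ : Fin n => E.sub l) => (y i : H)) h1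
  have hadj : ∀ i j k x y, ⟪entryL (R k) i j x, y⟫_ℂ = ⟪x, entryL (R k) j i y⟫_ℂ := by
    intro i j k x y
    rw [entryL_apply, entryL_apply, ← inner_singleL_right, ← inner_singleL, hRs]
  -- As the square roots are self-adjoint, the entries at `(j, i)` are the coherent adjoints
  -- required for the entries at `(i, j)`.
  choose b hb using fun i j => CStarOps.exists_of_family (fun k => entryL (R k) i j)
    (fun k => entryL (R k) j i) (hcoh i j) (hcoh j i) (hadj i j)
  refine ⟨Matrix.of b, Matrix.ext fun i j => CStarOps.ext_restr fun k => ?_⟩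
  rw [Matrix.mul_apply, map_sum, ← entryL_blockOp, ← hRR, entryL_mul]
  refine Finset.sum_congr rfl fun m _ => ?_
  rw [Matrix.conjTranspose_apply, CStarOps.restr_mul, CStarOps.restr_star, Matrix.of_apply, Matrix.of_apply,
    hb, hb]
  congr 1
  rw [ContinuousLinearMap.eq_adjoint_iff]
  exact fun x y => hadj i m k x y

end MatrixSqrt

/-! ### A criterion for local complete positivity and contractivity -/

section Criterion

variable {A : Type*} [Ring A] [StarRing A] [Algebra ℂ A] {Λ : Type*}
variable {ι H : Type*} [NormedAddCommGroup H] [InnerProductSpace ℂ H] {E : QuantizedDomain ι H}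

/-- The kernel of `θ` is positive semidefinite. -/
def IsFormPos (θ : A →ₗ[ℂ] CStarOps E) : Prop :=
  ∀ (n : ℕ) (a : Fin n → A) (x : Fin n → E.dom),
    0 ≤ ∑ i, ∑ j, ⟪x i, (θ (star (a i) * a j)).1 (x j)⟫_ℂ

/-- Every component of `θ` is bounded for some seminorm. -/
def IsLocBounded (p : Λ → Seminorm ℂ A) (θ : A →ₗ[ℂ] CStarOps E) : Prop :=
  ∀ k, ∃ (l : Λ) (C : ℝ), 0 ≤ C ∧ ∀ a, CStarOps.seminorm E k (θ a) ≤ C * p l a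

theorem IsFormPos.nonneg {θ : A →ₗ[ℂ] CStarOps E} (h : IsFormPos θ) (a : A) (x : E.dom) :
    0 ≤ ⟪x, (θ (star a * a)).1 x⟫_ℂ := by
  simpa using h 1 (fun _ => a) fun _ => x

theorem IsFormPos.nonneg_one {θ : A →ₗ[ℂ] CStarOps E} (h : IsFormPos θ) (x : E.dom) :
    0 ≤ ⟪x, (θ 1).1 x⟫_ℂ := by
  simpa using h.nonneg 1 x

variable [Nonempty ι] [CompleteSpace H]

theorem IsFormPos.map_star [StarModule ℂ A] {θ : A →ₗ[ℂ] CStarOps E} (h : IsFormPos θ) (a : A) :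
    θ (star a) = star (θ a) := by
  refine CStarOps.ext_form fun x => ?_
  let f : A →ₗ[ℂ] ℂ := (innerₛₗ ℂ x) ∘ₗ CStarOps.evalLin x ∘ₗ θ
  have hf : ∀ a, 0 ≤ f (star a * a) := fun a => h.nonneg a x
  have h1 := map_star_of_pos hf 1 a
  rw [star_one, one_mul, mul_one] at h1
  change starRingEnd ℂ ⟪x, (θ a).1 x⟫_ℂ = ⟪x, (θ (star a)).1 x⟫_ℂ at h1
  rw [← h1, inner_conj_symm, CStarOps.inner_left_star]

/-- A Schwarz inequality. -/
theorem IsFormPos.norm_sq_le [StarModule ℂ A] {θ : A →ₗ[ℂ] CStarOps E} (h : IsFormPos θ)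
    (h1 : ∀ x, (⟪x, (θ 1).1 x⟫_ℂ).re ≤ ‖x‖ ^ 2) {n : ℕ} (a : Fin n → A) (x : Fin n → E.dom) :
    ‖∑ j, (θ (a j)).1 (x j)‖ ^ 2 ≤
      (∑ i, ∑ j, ⟪x i, (θ (star (a i) * a j)).1 (x j)⟫_ℂ).re := by
  set z := ∑ j, (θ (a j)).1 (x j) with hz
  -- The kernel is tested on the tuple with the pair `(1, -z)` in front. This gives `0 ≤ ⟪z, θ(1) z⟫
  -- - 2 ‖z‖² + ∑ ⟪x i, θ(a_i* a_j) x j⟫`, and `⟪z, θ(1) z⟫` has real part at most `‖z‖²`.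
  have h2 := (Complex.nonneg_iff.1 (h (n + 1) (Fin.cons 1 a) (Fin.cons (-z) x))).1
  have eA : ⟪-z, (θ 1).1 (-z)⟫_ℂ = ⟪z, (θ 1).1 z⟫_ℂ := by
    rw [map_neg, inner_neg_neg]
  have eB : ∑ j, ⟪-z, (θ (a j)).1 (x j)⟫_ℂ = -⟪z, z⟫_ℂ := by
    rw [← inner_sum, ← hz, inner_neg_left]
  have eC : ∑ i, ⟪x i, (θ (star (a i))).1 (-z)⟫_ℂ = -⟪z, z⟫_ℂ := by
    simp_rw [h.map_star, ← CStarOps.inner_left_star]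
    rw [← sum_inner, ← hz, inner_neg_right]
  simp only [Fin.sum_univ_succ, Fin.cons_zero, Fin.cons_succ, star_one, one_mul, mul_one] at h2
  rw [Finset.sum_add_distrib, eA, eB, eC] at h2
  have h3 : (⟪z, z⟫_ℂ).re = ‖z‖ ^ 2 := inner_self_eq_norm_sq (𝕜 := ℂ) z
  simp only [Complex.add_re, Complex.neg_re, h3] at h2
  linarith [h1 z]

/-- A characterization of the class of local completely positive and local completely contractive
maps by scalar conditions. -/
structure IsFormCPCC (p : Λ → Seminorm ℂ A) (θ : A →ₗ[ℂ] CStarOps E) : Prop where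
  pos : IsFormPos θ
  bdd : IsLocBounded p θ
  le_one : ∀ x, (⟪x, (θ 1).1 x⟫_ℂ).re ≤ ‖x‖ ^ 2

open scoped Matrix

theorem form_conjTranspose_mul {n : ℕ} (d : Matrix (Fin n) (Fin n) (CStarOps E))
    (x : Fin n → E.dom) : 0 ≤ ∑ i, ∑ j, ⟪x i, ((dᴴ * d) i j).1 (x j)⟫_ℂ := by
  have h : ∑ i, ∑ j, ⟪x i, ((dᴴ * d) i j).1 (x j)⟫_ℂ =
      ∑ m, ⟪∑ i, (d m i).1 (x i), ∑ j, (d m j).1 (x j)⟫_ℂ := by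
    simp only [Matrix.mul_apply, Matrix.conjTranspose_apply, CStarOps.sum_apply,
      CStarOps.mul_apply, inner_sum, sum_inner, CStarOps.inner_left_star]
    rw [Finset.sum_comm' (t' := Finset.univ) (s' := fun _ => Finset.univ) (by simp)]
    rw [Finset.sum_congr rfl fun j _ => Finset.sum_comm, Finset.sum_comm]
  rw [h]
  refine Finset.sum_nonneg fun m _ => ?_
  exact RCLike.nonneg_iff.2 ⟨inner_self_nonneg, inner_self_im _⟩

variable [StarModule ℂ A]

/-- Contractivity for matrices of size one gives the bound and `θ(1) ≤ 1`. Complete positivity at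
the Gram matrix `(a_i* a_j)` gives positivity of the kernel, the null part being zero on the vectors
of `H_k`. -/
theorem IsLocalCPCC.isFormCPCC {p : Λ → Seminorm ℂ A} (hp : ∀ l, IsCStarSeminorm (p l))
    {θ : A →ₗ[ℂ] CStarOps E} (h : IsLocalCPCC p θ) : IsFormCPCC p θ := by
  have hb : ∀ k, ∃ l, ∀ a, CStarOps.seminorm E k (θ a) ≤ p l a := by
    intro k
    obtain ⟨l, hl⟩ := h.2 k
    refine ⟨l, fun a => ?_⟩
    rw [← (CStarOps.isCStarSeminorm k).matSeminorm_one_by_one, ← (hp l).matSeminorm_one_by_one]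
    exact hl 1 fun _ _ => a
  refine ⟨fun n a x => ?_, fun k => ?_, fun x => ?_⟩
  · obtain ⟨k, hk⟩ := CStarOps.exists_common_sub x
    obtain ⟨l, hl⟩ := h.1 k
    cases n with
    | zero => simp
    | succ n =>
      -- The matrix with first row `a` and all other rows zero; `bᴴ * b` is the Gram matrix. The
      -- empty tuple is separate because a first row is needed.
      let b : Matrix (Fin (n + 1)) (Fin (n + 1)) A := Matrix.of fun i j => if i = 0 then a j else 0
      have hbb : ∀ i j, (bᴴ * b) i j = star (a i) * a j := fun i j => by
        rw [Matrix.mul_apply, Finset.sum_eq_single 0]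
        · simp [b]
        · intro m _ hm; simp [b, hm]
        · simp
      obtain ⟨d, c, hdc, hc⟩ := (hl (n + 1) (bᴴ * b)).1
        ⟨b, 0, by simp, ((hp l).matSeminorm_eq_zero_iff _).2 fun i j => by simp⟩
      rw [(CStarOps.isCStarSeminorm k).matSeminorm_eq_zero_iff] at hc
      have hform := form_conjTranspose_mul d x
      convert hform using 4 with i _ j _
      have h1 : θ (star (a i) * a j) = (dᴴ * d) i j + c i j := by
        rw [← hbb, ← Matrix.add_apply, ← hdc]; rfl
      have h2 : (c i j).1 (x j) = 0 := by
        have := CStarOps.norm_apply_le k (c i j) (hk j)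
        rw [hc, zero_mul] at this
        exact norm_le_zero_iff.1 this
      rw [h1, CStarOps.add_apply, h2, add_zero]
  · obtain ⟨l, hl⟩ := hb k
    exact ⟨l, 1, zero_le_one, fun a => by rw [one_mul]; exact hl a⟩
  · obtain ⟨k, hk⟩ := E.mem_dom.1 x.2
    obtain ⟨l, hl⟩ := hb k
    have h1 := (CStarOps.norm_apply_le k (θ 1) hk).trans
      (mul_le_of_le_one_left (norm_nonneg x) ((hl 1).trans (hp l).map_one_le))
    calc (⟪x, (θ 1).1 x⟫_ℂ).re ≤ ‖x‖ * ‖(θ 1).1 x‖ := re_inner_le_norm (𝕜 := ℂ) _ _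
      _ ≤ ‖x‖ * ‖x‖ := by gcongr
      _ = _ := (sq _).symm

/-- The constant `C` disappears from the conclusion. The functional `m ↦ ∑ ⟪y i, θ(m i j) y j⟫` on
`M_n(A)` is positive, and on the powers of `a* a` it grows at most like those of `matSeminorm a ^
2`, so `norm_le_of_pow_bound` gives constant one. The Schwarz inequality, row by row, compares the
left side with its value at `a* a`. -/
theorem IsFormCPCC.norm_sq_le {p : Λ → Seminorm ℂ A} {l : Λ} (hp : IsCStarSeminorm (p l))
    {θ : A →ₗ[ℂ] CStarOps E} (h : IsFormCPCC p θ) {k : ι} {C : ℝ}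
    (hC : ∀ a, CStarOps.seminorm E k (θ a) ≤ C * p l a) {n : ℕ} (a : Matrix (Fin n) (Fin n) A)
    (y : Fin n → E.dom) (hy : ∀ i, (y i : H) ∈ E.sub k) :
    ∑ i, ‖∑ j, (θ (a i j)).1 (y j)‖ ^ 2 ≤ matSeminorm (p l) a ^ 2 * ∑ i, ‖y i‖ ^ 2 := by
  let f : Matrix (Fin n) (Fin n) A →ₗ[ℂ] ℂ :=
    { toFun := fun m => ∑ i, ∑ j, ⟪y i, (θ (m i j)).1 (y j)⟫_ℂ
      map_add' := fun m m' => by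
        simp [CStarOps.add_apply, inner_add_right, Finset.sum_add_distrib]
      map_smul' := fun c m => by
        simp [CStarOps.smul_apply, inner_smul_right, Finset.mul_sum] }
  have hfapp : ∀ m, f m = ∑ i, ∑ j, ⟪y i, (θ (m i j)).1 (y j)⟫_ℂ := fun _ => rfl
  have hfm : ∀ m : Matrix (Fin n) (Fin n) A, f (star m * m) =
      ∑ r, ∑ i, ∑ j, ⟪y i, (θ (star (m r i) * m r j)).1 (y j)⟫_ℂ := fun m => by
    simp only [hfapp, Matrix.star_eq_conjTranspose, Matrix.mul_apply, Matrix.conjTranspose_apply,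
      map_sum, CStarOps.sum_apply, inner_sum]
    rw [Finset.sum_congr rfl fun j _ => Finset.sum_comm, Finset.sum_comm]
  have hpos : ∀ m, 0 ≤ f (star m * m) := fun m => by
    rw [hfm]
    exact Finset.sum_nonneg fun r _ => h.pos n (m r) y
  have hbound : ∀ r ≠ 0, ‖f ((star a * a) ^ r)‖ ≤
      (∑ i, ∑ j, ‖y i‖ * (|C| * ‖y j‖)) * (matSeminorm (p l) a ^ 2) ^ r := by
    intro r hr
    rw [hfapp, Finset.sum_mul]
    refine (norm_sum_le _ _).trans (Finset.sum_le_sum fun i _ => ?_)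
    rw [Finset.sum_mul]
    refine (norm_sum_le _ _).trans (Finset.sum_le_sum fun j _ => ?_)
    have h1 := hp.entry_pow_le a r hr i j
    have h2 := CStarOps.norm_apply_le k (θ (((star a * a) ^ r) i j)) (hy j)
    calc _ ≤ ‖y i‖ * ‖(θ (((star a * a) ^ r) i j)).1 (y j)‖ := norm_inner_le_norm _ _
      _ ≤ ‖y i‖ * ((|C| * (matSeminorm (p l) a ^ 2) ^ r) * ‖y j‖) := by
          gcongr
          refine h2.trans ?_
          gcongr
          refine (hC _).trans ?_
          exact mul_le_mul (le_abs_self C) h1 (apply_nonneg (p l) _) (abs_nonneg C)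
      _ = _ := by ring
  have h1 := norm_le_of_pow_bound hpos (h := star a * a) (by simp) (sq_nonneg _) hbound
  have h2 : (f 1).re ≤ ∑ i, ‖y i‖ ^ 2 := by
    rw [hfapp, Complex.re_sum]
    refine Finset.sum_le_sum fun i _ => ?_
    rw [Finset.sum_eq_single i]
    · simpa using h.le_one (y i)
    · intro j _ hj; simp [Matrix.one_apply_ne hj.symm, CStarOps.zero_apply]
    · simp
  calc ∑ i, ‖∑ j, (θ (a i j)).1 (y j)‖ ^ 2
      ≤ ∑ i, (∑ r, ∑ j, ⟪y r, (θ (star (a i r) * a i j)).1 (y j)⟫_ℂ).re :=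
        Finset.sum_le_sum fun i _ => h.pos.norm_sq_le h.le_one (a i) y
    _ = (f (star a * a)).re := by rw [hfm, Complex.re_sum]
    _ ≤ ‖f (star a * a)‖ := Complex.re_le_norm _
    _ ≤ _ := h1
    _ ≤ _ := mul_le_mul_of_nonneg_left h2 (sq_nonneg _)

/-- The quadratic form of the image of `b* b` is a sum over the rows of `b` of kernel sums, hence
positive, and such a matrix has a square root over `C*(D_E)`. For contractivity, a tuple of
operators is evaluated at a vector of `H_k`, which reduces it to a tuple of vectors. -/
theorem IsFormCPCC.isLocalCPCC {p : Λ → Seminorm ℂ A} (hp : ∀ l, IsCStarSeminorm (p l))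
    {θ : A →ₗ[ℂ] CStarOps E} (h : IsFormCPCC p θ) : IsLocalCPCC p θ := by
  refine ⟨fun k => ?_, fun k => ?_⟩
  · obtain ⟨l, C, hC0, hC⟩ := h.bdd k
    have hnull : ∀ (n : ℕ) (a : Matrix (Fin n) (Fin n) A), matSeminorm (p l) a = 0 →
        matSeminorm (CStarOps.seminorm E k) (a.map θ) = 0 := by
      intro n a ha
      rw [(hp l).matSeminorm_eq_zero_iff] at ha
      rw [(CStarOps.isCStarSeminorm k).matSeminorm_eq_zero_iff]
      intro i j
      refine le_antisymm ?_ (apply_nonneg _ _)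
      have := hC (a i j)
      rwa [ha, mul_zero] at this
    refine ⟨l, fun n a => ⟨?_, hnull n a⟩⟩
    rintro ⟨b, c, rfl, hc⟩
    obtain ⟨d, hd⟩ := exists_conjTranspose_mul_self (M := (bᴴ * b).map θ) (fun x => by
      have h1 : ∑ i, ∑ j, ⟪x i, (((bᴴ * b).map θ) i j).1 (x j)⟫_ℂ =
          ∑ r, ∑ i, ∑ j, ⟪x i, (θ (star (b r i) * b r j)).1 (x j)⟫_ℂ := by
        simp only [Matrix.map_apply, Matrix.mul_apply, Matrix.conjTranspose_apply,
          map_sum, CStarOps.sum_apply, inner_sum]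
        rw [Finset.sum_congr rfl fun j _ => Finset.sum_comm, Finset.sum_comm]
      rw [h1]
      exact Finset.sum_nonneg fun r _ => h.pos n (b r) x)
    refine ⟨d, c.map θ, ?_, hnull n c hc⟩
    rw [← hd, Matrix.map_add _ (map_add θ)]
  · obtain ⟨l, C, hC0, hC⟩ := h.bdd k
    refine ⟨l, fun n a => Real.sSup_le ?_ (matSeminorm_nonneg _ _)⟩
    rintro _ ⟨x, hx, rfl⟩
    refine (Real.sqrt_le_left (matSeminorm_nonneg _ _)).2 ?_
    have hform : ∀ (w : Fin n → CStarOps E) (ξ : E.dom),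
        ⟪ξ, (∑ i, star (w i) * w i).1 ξ⟫_ℂ = ((∑ i, ‖(w i).1 ξ‖ ^ 2 : ℝ) : ℂ) := by
      intro w ξ
      simp only [CStarOps.sum_apply, CStarOps.mul_apply, inner_sum, ← CStarOps.inner_left_star,
        inner_self_eq_norm_sq_to_K]
      push_cast
      rfl
    refine CStarOps.seminorm_le_of_form (sq_nonneg _) (fun ξ _ => ?_) fun ξ hξ => ?_
    · rw [hform, Complex.zero_le_real]; exact Finset.sum_nonneg fun i _ => sq_nonneg _
    · rw [hform, Complex.ofReal_re]
      -- Elements of `C*(D_E)` preserve `H_k`, so the vectors `(x j) ξ` are admissible.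
      have h1 := h.norm_sq_le (hp l) hC a (fun j => (x j).1 ξ) fun j => ((x j).2 k).1 ξ hξ
      have h2 : ∑ i, ‖(x i).1 ξ‖ ^ 2 ≤ ‖ξ‖ ^ 2 := by
        have h3 := congrArg Complex.re (hform x ξ)
        rw [Complex.ofReal_re] at h3
        rw [← h3]
        calc _ ≤ ‖ξ‖ * ‖(∑ i, star (x i) * x i).1 ξ‖ := re_inner_le_norm (𝕜 := ℂ) _ _
          _ ≤ ‖ξ‖ * (1 * ‖ξ‖) := by
              gcongr
              exact (CStarOps.norm_apply_le k _ hξ).trans (by gcongr)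
          _ = _ := by ring
      have h4 : ∀ i, ((a.map θ *ᵥ x) i).1 ξ = ∑ j, (θ (a i j)).1 ((x j).1 ξ) := fun i => by
        simp only [Matrix.mulVec, dotProduct, CStarOps.sum_apply, CStarOps.mul_apply,
          Matrix.map_apply]
      simp only [h4]
      exact h1.trans (mul_le_mul_of_nonneg_left h2 (sq_nonneg _))

end Criterion

/-! ### The seminorms of the minimal tensor product -/

section SpatialSeminorm

variable {A : Type*} [Ring A] [StarRing A] [Algebra ℂ A] [StarModule ℂ A]
variable {B : Type*} [Ring B] [StarRing B] [Algebra ℂ B] [StarModule ℂ B]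

theorem spatialNorm_tmul_le (p : Seminorm ℂ A) (q : Seminorm ℂ B) (a : A) (b : B) :
    spatialNorm p q (a ⊗ₜ b) ≤ p a * q b :=
  spatialNorm_le (mul_nonneg (apply_nonneg p a) (apply_nonneg q b)) fun π ρ => by
    rw [repTensor_tmul]
    exact (TensorProduct.norm_mapL_le _ _).trans
      (mul_le_mul (π.norm_le a) (ρ.norm_le b) (norm_nonneg _) (apply_nonneg p a))

/-- The essential half of the `C*`-identity on an inner product space that need not be complete,
with the adjoint supplied by hand; needed for `π ⊗ ρ` on the algebraic tensor product. -/
theorem opNorm_sq_le_of_adjoint {V : Type*} [NormedAddCommGroup V] [InnerProductSpace ℂ V]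
    {S T : V →L[ℂ] V} (h : ∀ s t, ⟪T s, t⟫_ℂ = ⟪s, S t⟫_ℂ) : ‖T‖ ^ 2 ≤ ‖S * T‖ := by
  refine (Real.le_sqrt (norm_nonneg _) (norm_nonneg _)).1 ?_
  refine ContinuousLinearMap.opNorm_le_bound _ (Real.sqrt_nonneg _) fun s => ?_
  refine (sq_le_sq₀ (norm_nonneg _) (by positivity)).1 ?_
  rw [mul_pow, Real.sq_sqrt (norm_nonneg _)]
  calc ‖T s‖ ^ 2 = ‖⟪T s, T s⟫_ℂ‖ := by rw [inner_self_eq_norm_sq_to_K]; simp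
    _ = ‖⟪s, (S * T) s⟫_ℂ‖ := by rw [h]; rfl
    _ ≤ ‖s‖ * ‖(S * T) s‖ := norm_inner_le_norm _ _
    _ ≤ ‖s‖ * (‖S * T‖ * ‖s‖) := by gcongr; exact ContinuousLinearMap.le_opNorm _ _
    _ = _ := by ring

theorem spatialNorm_star_mul_self (p : Seminorm ℂ A) (q : Seminorm ℂ B) (x : A ⊗[ℂ] B) :
    spatialNorm p q (star x * x) = spatialNorm p q x ^ 2 := by
  refine le_antisymm ?_ ?_
  · rw [sq]
    exact (spatialNorm_mul_le _ _).trans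
      (mul_le_mul_of_nonneg_right (spatialNorm_star_le x) (spatialNorm_nonneg x))
  · refine (Real.le_sqrt (spatialNorm_nonneg _) (spatialNorm_nonneg _)).1 ?_
    refine spatialNorm_le (Real.sqrt_nonneg _) fun π ρ => ?_
    refine Real.le_sqrt_of_sq_le ((opNorm_sq_le_of_adjoint (inner_repTensor π ρ x)).trans ?_)
    have h := norm_repTensor_le π ρ (star x * x)
    rw [map_mul] at h
    exact h

theorem SpatialCompletion.norm_star_mul_self' {p : Seminorm ℂ A} {q : Seminorm ℂ B}
    (z : SpatialCompletion p q) : ‖star z * z‖ = ‖z‖ ^ 2 := by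
  refine induction (P := fun z => ‖star z * z‖ = ‖z‖ ^ 2)
    (isClosed_eq (by fun_prop) (by fun_prop)) (fun x => ?_) z
  rw [star_of, ← map_mul, norm_of, norm_of, spatialNorm_star_mul_self]

namespace MinTensor

variable {Λ Δ : Type*} {p : Λ → Seminorm ℂ A} {q : Δ → Seminorm ℂ B}

theorem isCStarSeminorm (ld : Λ × Δ) : IsCStarSeminorm (seminorm p q ld) where
  mul_le z w := norm_mul_le (z.1 ld) (w.1 ld)
  star_mul_self z := SpatialCompletion.norm_star_mul_self' (z.1 ld)

/-- The canonical map of the algebraic tensor product into the minimal tensor product. -/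
def of (p : Λ → Seminorm ℂ A) (q : Δ → Seminorm ℂ B) : A ⊗[ℂ] B →ₗ[ℂ] MinTensor p q where
  toFun x := ⟨diag p q x, StarSubalgebra.le_topologicalClosure _ ⟨x, rfl⟩⟩
  map_add' x y := Subtype.ext (map_add (diag p q) x y)
  map_smul' c x := Subtype.ext (map_smul (diag p q) c x)

theorem of_tmul (a : A) (b : B) : of p q (a ⊗ₜ b) = tmul p q a b := rfl

theorem of_star (x : A ⊗[ℂ] B) : of p q (star x) = star (of p q x) :=
  Subtype.ext (map_star (diag p q) x)

theorem of_mul (x y : A ⊗[ℂ] B) : of p q (x * y) = of p q x * of p q y :=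
  Subtype.ext (map_mul (diag p q) x y)

theorem of_one : of p q 1 = 1 := Subtype.ext (map_one (diag p q))

theorem seminorm_of (ld : Λ × Δ) (x : A ⊗[ℂ] B) :
    seminorm p q ld (of p q x) = spatialNorm (p ld.1) (q ld.2) x :=
  SpatialCompletion.norm_of (p := p ld.1) (q := q ld.2) x

theorem seminorm_tmul_le (ld : Λ × Δ) (a : A) (b : B) :
    seminorm p q ld (tmul p q a b) ≤ p ld.1 a * q ld.2 b := by
  rw [← of_tmul, seminorm_of]
  exact spatialNorm_tmul_le _ _ a b

theorem star_tmul_mul_tmul (a a' : A) (b b' : B) :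
    star (tmul p q a b) * tmul p q a' b' = tmul p q (star a * a') (star b * b') := by
  rw [← of_tmul, ← of_tmul, ← of_star, ← of_mul, TensorProduct.star_tmul,
    Algebra.TensorProduct.tmul_mul_tmul, of_tmul]

/-- The map `a ↦ a ⊗ b`. -/
def tmulLeft (p : Λ → Seminorm ℂ A) (q : Δ → Seminorm ℂ B) (b : B) : A →ₗ[ℂ] MinTensor p q :=
  of p q ∘ₗ (TensorProduct.mk ℂ A B).flip b

/-- The map `b ↦ a ⊗ b`. -/
def tmulRight (p : Λ → Seminorm ℂ A) (q : Δ → Seminorm ℂ B) (a : A) : B →ₗ[ℂ] MinTensor p q :=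
  of p q ∘ₗ TensorProduct.mk ℂ A B a

theorem tmulLeft_apply (a : A) (b : B) : tmulLeft p q b a = tmul p q a b := rfl

/-- The closure is taken in a product topology, so finitely many coordinates can be approximated at
once; two suffice to compare two maps that are bounded for different seminorms. -/
theorem exists_of_approx (z : MinTensor p q) (l l' : Λ × Δ) {ε : ℝ} (hε : 0 < ε) :
    ∃ x, seminorm p q l (z - of p q x) < ε ∧ seminorm p q l' (z - of p q x) < ε := by
  have hz : z.1 ∈ closure (Set.range (diag p q)) := z.2
  have hopen : IsOpen {w : ∀ ld : Λ × Δ, SpatialCompletion (p ld.1) (q ld.2) |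
      ‖z.1 l - w l‖ < ε ∧ ‖z.1 l' - w l'‖ < ε} :=
    IsOpen.and (isOpen_lt (by fun_prop) continuous_const)
      (isOpen_lt (by fun_prop) continuous_const)
  obtain ⟨_, ⟨h1, h2⟩, x, rfl⟩ := mem_closure_iff.1 hz _ hopen (by simp [hε])
  exact ⟨x, h1, h2⟩

variable {ι H : Type*} [NormedAddCommGroup H] [InnerProductSpace ℂ H] {E : QuantizedDomain ι H}
  [Nonempty ι]

/-- Uniqueness of `φ ⊗ ψ`: two locally bounded maps that agree on the dense algebraic tensor product
are equal. -/
theorem ext_of_isLocBounded {Φ Ψ : MinTensor p q →ₗ[ℂ] CStarOps E}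
    (hΦ : IsLocBounded (seminorm p q) Φ) (hΨ : IsLocBounded (seminorm p q) Ψ)
    (h : ∀ a b, Φ (tmul p q a b) = Ψ (tmul p q a b)) : Φ = Ψ := by
  have h' : ∀ x, Φ (of p q x) = Ψ (of p q x) := fun x =>
    congrArg (fun f : A ⊗[ℂ] B →ₗ[ℂ] CStarOps E => f x)
      (TensorProduct.ext' (g := Φ ∘ₗ of p q) (h := Ψ ∘ₗ of p q) h)
  refine LinearMap.ext fun z => CStarOps.ext' fun y => ?_
  obtain ⟨k, hk⟩ := E.mem_dom.1 y.2
  obtain ⟨l, C, hC0, hC⟩ := hΦ k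
  obtain ⟨l', C', hC0', hC'⟩ := hΨ k
  suffices h0 : CStarOps.seminorm E k (Φ z - Ψ z) ≤ 0 by
    have h1 := (CStarOps.norm_apply_le k (Φ z - Ψ z) hk).trans
      (mul_nonpos_of_nonpos_of_nonneg h0 (norm_nonneg y))
    exact sub_eq_zero.1 (norm_le_zero_iff.1 h1)
  refine le_of_forall_pos_le_add fun ε hε => ?_
  rw [zero_add]
  obtain ⟨x, hx, hx'⟩ := exists_of_approx z l l' (ε := ε / (C + C' + 1)) (by positivity)
  have h1 : Φ z - Ψ z = Φ (z - of p q x) - Ψ (z - of p q x) := by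
    rw [map_sub, map_sub, h']; abel
  calc CStarOps.seminorm E k (Φ z - Ψ z)
      ≤ CStarOps.seminorm E k (Φ (z - of p q x)) + CStarOps.seminorm E k (Ψ (z - of p q x)) := by
        rw [h1]; exact map_sub_le_add _ _ _
    _ ≤ C * (ε / (C + C' + 1)) + C' * (ε / (C + C' + 1)) :=
        add_le_add ((hC _).trans (mul_le_mul_of_nonneg_left hx.le hC0))
          ((hC' _).trans (mul_le_mul_of_nonneg_left hx'.le hC0'))
    _ ≤ ε := by
        rw [← add_mul, mul_div_assoc', div_le_iff₀ (by positivity)]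
        nlinarith

end MinTensor

end SpatialSeminorm

/-! ### Compressions -/

section Slice

variable {ι κ H L : Type*} [NormedAddCommGroup H] [InnerProductSpace ℂ H] [CompleteSpace H]
  [NormedAddCommGroup L] [InnerProductSpace ℂ L] [CompleteSpace L] [Nonempty ι] [Nonempty κ]
  {E : QuantizedDomain ι H} {G : QuantizedDomain κ L}

/-- The bounded operator `V` is compatible with the quantized domains. -/
def IsCompatible (E : QuantizedDomain ι H) (G : QuantizedDomain κ L) (V : H →L[ℂ] L) : Prop :=
  ∀ i, ∃ k, (∀ x ∈ E.sub i, V x ∈ G.sub k) ∧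
    ∀ y ∈ G.sub k, ContinuousLinearMap.adjoint V y ∈ E.sub i

namespace IsCompatible

variable {V : H →L[ℂ] L}

/-- The restriction of `V` to the union spaces. -/
def domMap (hV : IsCompatible E G V) : E.dom →ₗ[ℂ] G.dom where
  toFun x := ⟨V x, by
    obtain ⟨i, hi⟩ := E.mem_dom.1 x.2
    obtain ⟨k, hk, -⟩ := hV i
    exact G.sub_le_dom k (hk x hi)⟩
  map_add' x y := Subtype.ext (map_add V (x : H) y)
  map_smul' c x := Subtype.ext (map_smul V c (x : H))

theorem adjoint_mem (hV : IsCompatible E G V) (T : CStarOps G) (x : E.dom) {i : ι}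
    (hi : (x : H) ∈ E.sub i) :
    ContinuousLinearMap.adjoint V (T.1 (hV.domMap x) : L) ∈ E.sub i := by
  obtain ⟨k, hk, hk'⟩ := hV i
  exact hk' _ ((T.2 k).1 _ (hk x hi))

/-- The compression of an operator as a linear map on the union space. -/
def sliceLin (hV : IsCompatible E G V) (T : CStarOps G) : Module.End ℂ E.dom where
  toFun x := ⟨ContinuousLinearMap.adjoint V (T.1 (hV.domMap x) : L), by
    obtain ⟨i, hi⟩ := E.mem_dom.1 x.2
    exact E.sub_le_dom i (hV.adjoint_mem T x hi)⟩
  map_add' x y := Subtype.ext (by simp)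
  map_smul' c x := Subtype.ext (by simp)

theorem inner_sliceLin (hV : IsCompatible E G V) (T : CStarOps G) (x y : E.dom) :
    ⟪x, hV.sliceLin T y⟫_ℂ = ⟪hV.domMap x, T.1 (hV.domMap y)⟫_ℂ :=
  ContinuousLinearMap.adjoint_inner_right V (x : H) (T.1 (hV.domMap y) : L)

theorem norm_sliceLin_le (hV : IsCompatible E G V) (T : CStarOps G) {i : ι} {k : κ}
    (hk : ∀ x ∈ E.sub i, V x ∈ G.sub k) {x : E.dom} (hx : (x : H) ∈ E.sub i) :
    ‖hV.sliceLin T x‖ ≤ ‖V‖ ^ 2 * CStarOps.seminorm G k T * ‖x‖ := by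
  calc ‖hV.sliceLin T x‖ ≤ ‖ContinuousLinearMap.adjoint V‖ * ‖T.1 (hV.domMap x)‖ :=
        (ContinuousLinearMap.adjoint V).le_opNorm _
    _ ≤ ‖V‖ * (CStarOps.seminorm G k T * (‖V‖ * ‖x‖)) := by
        rw [LinearIsometryEquiv.norm_map]
        gcongr
        refine (CStarOps.norm_apply_le k T (hk x hx)).trans ?_
        gcongr
        exact V.le_opNorm x
    _ = _ := by ring

/-- The compression `T ↦ V* T V`. -/
def slice (hV : IsCompatible E G V) : CStarOps G →ₗ[ℂ] CStarOps E where
  toFun T := ⟨hV.sliceLin T, CStarOps.mem_of_adjoint _ (hV.sliceLin (star T))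
    (fun i x hx => hV.adjoint_mem T x hx) (fun i x hx => hV.adjoint_mem (star T) x hx)
    (fun i => by
      obtain ⟨k, hk, -⟩ := hV i
      exact ⟨_, fun x hx => hV.norm_sliceLin_le T hk hx⟩)
    (fun x y => by
      change ⟪hV.sliceLin T x, y⟫_ℂ = ⟪x, hV.sliceLin (star T) y⟫_ℂ
      rw [← inner_conj_symm, inner_sliceLin, inner_sliceLin, inner_conj_symm,
        CStarOps.inner_left_star])⟩
  map_add' S T := CStarOps.ext' fun x => Subtype.ext
    (map_add (ContinuousLinearMap.adjoint V) (S.1 (hV.domMap x) : L) (T.1 (hV.domMap x)))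
  map_smul' c T := CStarOps.ext' fun x => Subtype.ext
    (map_smul (ContinuousLinearMap.adjoint V) c (T.1 (hV.domMap x) : L))

theorem inner_slice (hV : IsCompatible E G V) (T : CStarOps G) (x y : E.dom) :
    ⟪x, (hV.slice T).1 y⟫_ℂ = ⟪hV.domMap x, T.1 (hV.domMap y)⟫_ℂ :=
  hV.inner_sliceLin T x y

theorem exists_seminorm_slice_le (hV : IsCompatible E G V) (i : ι) :
    ∃ k, ∀ T, CStarOps.seminorm E i (hV.slice T) ≤ ‖V‖ ^ 2 * CStarOps.seminorm G k T := by
  obtain ⟨k, hk, -⟩ := hV i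
  exact ⟨k, fun T => CStarOps.seminorm_le (mul_nonneg (sq_nonneg _) (apply_nonneg _ _))
    fun x hx => hV.norm_sliceLin_le T hk hx⟩

variable {A R : Type*} [Ring A] [StarRing A] [Algebra ℂ A] [Ring R] [StarRing R] [Algebra ℂ R]

/-- The kernel of the compressed map at `(a_i, x_i)` is the kernel of `χ` at `(u(a_i), V x_i)`. -/
theorem isFormPos_slice (hV : IsCompatible E G V) {χ : R →ₗ[ℂ] CStarOps G} (hχ : IsFormPos χ)
    {m : A →ₗ[ℂ] R} {u : A → R} (hm : ∀ a b, m (star a * b) = star (u a) * u b) :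
    IsFormPos (hV.slice ∘ₗ χ ∘ₗ m) := by
  intro n a x
  simp only [LinearMap.comp_apply, inner_slice, hm]
  exact hχ n (fun i => u (a i)) fun i => hV.domMap (x i)

theorem isLocBounded_slice {Λ Δ : Type*} {p : Λ → Seminorm ℂ A} {P : Δ → Seminorm ℂ R}
    (hV : IsCompatible E G V) {χ : R →ₗ[ℂ] CStarOps G} (hχ : IsLocBounded P χ)
    {m : A →ₗ[ℂ] R} (hm : ∀ d, ∃ (l : Λ) (C : ℝ), 0 ≤ C ∧ ∀ a, P d (m a) ≤ C * p l a) :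
    IsLocBounded p (hV.slice ∘ₗ χ ∘ₗ m) := by
  intro i
  obtain ⟨k, hk⟩ := hV.exists_seminorm_slice_le i
  obtain ⟨d, C, hC0, hC⟩ := hχ k
  obtain ⟨l, D, hD0, hD⟩ := hm d
  refine ⟨l, ‖V‖ ^ 2 * (C * D), by positivity, fun a => (hk _).trans ?_⟩
  rw [mul_assoc, mul_assoc]
  gcongr
  exact (hC _).trans (by gcongr; exact hD a)

end IsCompatible

end Slice

/-! ### Slices of operators on a tensor product -/

section TensorSlices

variable {ι κ H K : Type*} [NormedAddCommGroup H] [InnerProductSpace ℂ H]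
  [NormedAddCommGroup K] [InnerProductSpace ℂ K]

theorem htmul_add_left (x x' : H) (y : K) : htmul (x + x') y = htmul x y + htmul x' y := by
  simp [htmul, TensorProduct.add_tmul, UniformSpace.Completion.coe_add]

theorem htmul_add_right (x : H) (y y' : K) : htmul x (y + y') = htmul x y + htmul x y' := by
  simp [htmul, TensorProduct.tmul_add, UniformSpace.Completion.coe_add]

theorem htmul_smul_left (c : ℂ) (x : H) (y : K) : htmul (c • x) y = c • htmul x y := by
  rw [htmul, ← TensorProduct.smul_tmul', UniformSpace.Completion.coe_smul]; rfl

theorem htmul_smul_right (c : ℂ) (x : H) (y : K) : htmul x (c • y) = c • htmul x y := by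
  simp [htmul, UniformSpace.Completion.coe_smul]

theorem norm_htmul (x : H) (y : K) : ‖htmul x y‖ = ‖x‖ * ‖y‖ := by
  simp [htmul]

/-- The operator `x ↦ x ⊗ y`. -/
def htmulLeft (y : K) : H →L[ℂ] HTensor H K :=
  LinearMap.mkContinuous
    { toFun := fun x => htmul x y
      map_add' := fun x x' => htmul_add_left x x' y
      map_smul' := fun c x => htmul_smul_left c x y } ‖y‖
    fun x => by rw [mul_comm]; exact (norm_htmul x y).le

/-- The operator `y ↦ x ⊗ y`. -/
def htmulRight (x : H) : K →L[ℂ] HTensor H K :=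
  LinearMap.mkContinuous
    { toFun := fun y => htmul x y
      map_add' := fun y y' => htmul_add_right x y y'
      map_smul' := fun c y => htmul_smul_right c x y } ‖x‖
    fun y => (norm_htmul x y).le

variable [CompleteSpace H] [CompleteSpace K]

theorem adjoint_htmulLeft (x : H) (y y' : K) :
    ContinuousLinearMap.adjoint (htmulLeft (H := H) y) (htmul x y') = ⟪y, y'⟫_ℂ • x := by
  refine ext_inner_left ℂ fun v => ?_
  rw [ContinuousLinearMap.adjoint_inner_right, inner_smul_right]
  exact (inner_htmul v x y y').trans (mul_comm _ _)

theorem adjoint_htmulRight (x x' : H) (y : K) :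
    ContinuousLinearMap.adjoint (htmulRight (K := K) x) (htmul x' y) = ⟪x, x'⟫_ℂ • y := by
  refine ext_inner_left ℂ fun v => ?_
  rw [ContinuousLinearMap.adjoint_inner_right, inner_smul_right]
  exact inner_htmul x x' v y

variable [Nonempty ι] [Nonempty κ] {E : QuantizedDomain ι H} {F : QuantizedDomain κ K}

/-- If `y ∈ K_j`, the index `(i, j)` serves for `i`: the adjoint sends `x ⊗ y'` to `⟪y, y'⟫ x`, and
`H_i` is closed. -/
theorem isCompatible_htmulLeft (y : F.dom) :
    IsCompatible E (E.tensor F) (htmulLeft (H := H) (y : K)) := by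
  intro i
  obtain ⟨j, hj⟩ := F.mem_dom.1 y.2
  refine ⟨(i, j), fun x hx => htmul_mem hx hj, ?_⟩
  refine subTensor_induction
    (P := fun z => ContinuousLinearMap.adjoint (htmulLeft (H := H) (y : K)) z ∈ E.sub i)
    ((E.isClosed_sub i).preimage (ContinuousLinearMap.continuous _)) ?_ ?_ ?_ ?_
  · rw [map_zero]; exact zero_mem _
  · intro z w h h'; rw [map_add]; exact add_mem h h'
  · intro c z h; rw [map_smul]; exact Submodule.smul_mem _ _ h
  · intro x hx y' _
    rw [adjoint_htmulLeft]; exact Submodule.smul_mem _ _ hx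

theorem isCompatible_htmulRight (x : E.dom) :
    IsCompatible F (E.tensor F) (htmulRight (K := K) (x : H)) := by
  intro j
  obtain ⟨i, hi⟩ := E.mem_dom.1 x.2
  refine ⟨(i, j), fun y hy => htmul_mem hi hy, ?_⟩
  refine subTensor_induction
    (P := fun z => ContinuousLinearMap.adjoint (htmulRight (K := K) (x : H)) z ∈ F.sub j)
    ((F.isClosed_sub j).preimage (ContinuousLinearMap.continuous _)) ?_ ?_ ?_ ?_
  · rw [map_zero]; exact zero_mem _
  · intro z w h h'; rw [map_add]; exact add_mem h h'
  · intro c z h; rw [map_smul]; exact Submodule.smul_mem _ _ h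
  · intro x' _ y hy
    rw [adjoint_htmulRight]; exact Submodule.smul_mem _ _ hy

/-- The elementary tensor of vectors of the union spaces. -/
def dtmul (x : E.dom) (y : F.dom) : (E.tensor F).dom := ⟨htmul (x : H) (y : K), htmul_mem_dom x y⟩

omit [CompleteSpace H] [CompleteSpace K] in
theorem inner_dtmul (x x' : E.dom) (y y' : F.dom) :
    ⟪dtmul x y, dtmul x' y'⟫_ℂ = ⟪x, x'⟫_ℂ * ⟪y, y'⟫_ℂ :=
  inner_htmul (x : H) (x' : H) (y : K) (y' : K)

omit [CompleteSpace H] [CompleteSpace K] in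
theorem dtmul_add_right (x : E.dom) (y y' : F.dom) :
    dtmul x (y + y') = dtmul x y + dtmul x y' := Subtype.ext (htmul_add_right _ _ _)

omit [CompleteSpace H] [CompleteSpace K] in
theorem dtmul_smul_left (c : ℂ) (x : E.dom) (y : F.dom) :
    dtmul (c • x) y = c • dtmul x y := Subtype.ext (htmul_smul_left _ _ _)

omit [CompleteSpace H] [CompleteSpace K] in
theorem dtmul_smul_right (c : ℂ) (x : E.dom) (y : F.dom) :
    dtmul x (c • y) = c • dtmul x y := Subtype.ext (htmul_smul_right _ _ _)

theorem tensorOp_dtmul (T : CStarOps E) (S : CStarOps F) (x : E.dom) (y : F.dom) :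
    (tensorOp T S).1 (dtmul x y) = dtmul (T.1 x) (S.1 y) :=
  Subtype.ext (tensorOp_htmul T S x y)

theorem inner_slice_left (y : F.dom) (T : CStarOps (E.tensor F)) (x x' : E.dom) :
    ⟪x, ((isCompatible_htmulLeft y).slice T).1 x'⟫_ℂ = ⟪dtmul x y, T.1 (dtmul x' y)⟫_ℂ :=
  IsCompatible.inner_slice _ T x x'

theorem inner_slice_right (x : E.dom) (T : CStarOps (E.tensor F)) (y y' : F.dom) :
    ⟪y, ((isCompatible_htmulRight x).slice T).1 y'⟫_ℂ = ⟪dtmul x y, T.1 (dtmul x y')⟫_ℂ :=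
  IsCompatible.inner_slice _ T y y'

theorem CStarOps.ext_inner {S T : CStarOps E} (h : ∀ x y, ⟪x, S.1 y⟫_ℂ = ⟪x, T.1 y⟫_ℂ) :
    S = T := CStarOps.ext' fun y => ext_inner_left ℂ fun x => h x y

theorem slice_left_tensorOp (y : F.dom) (T : CStarOps E) (S : CStarOps F) :
    (isCompatible_htmulLeft (E := E) y).slice (tensorOp T S) = ⟪y, S.1 y⟫_ℂ • T :=
  CStarOps.ext_inner fun x x' => by
    rw [inner_slice_left, tensorOp_dtmul, inner_dtmul, CStarOps.smul_apply, inner_smul_right,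
      mul_comm]

theorem slice_right_tensorOp (x : E.dom) (T : CStarOps E) (S : CStarOps F) :
    (isCompatible_htmulRight (F := F) x).slice (tensorOp T S) = ⟪x, T.1 x⟫_ℂ • S :=
  CStarOps.ext_inner fun y y' => by
    rw [inner_slice_right, tensorOp_dtmul, inner_dtmul, CStarOps.smul_apply, inner_smul_right]

/-- Operators on a tensor product are determined by their matrix elements at elementary tensors. -/
theorem CStarOps.ext_dtmul {S T : CStarOps (E.tensor F)}
    (h : ∀ x y x' y', ⟪dtmul x y, S.1 (dtmul x' y')⟫_ℂ = ⟪dtmul x y, T.1 (dtmul x' y')⟫_ℂ) :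
    S = T := by
  rw [← sub_eq_zero]
  set D := S - T with hD
  have hD0 : ∀ x y x' y', ⟪dtmul x y, D.1 (dtmul x' y')⟫_ℂ = 0 := fun x y x' y' => by
    rw [hD, CStarOps.sub_apply, inner_sub_right, h, sub_self]
  refine CStarOps.ext' fun z => ?_
  obtain ⟨i, j, hz, -⟩ := exists_common z z
  -- On all of the union space `D` need not be continuous. With `D` moved to the left, the pairing
  -- is continuous in `z` and density of elementary tensors applies.
  have h1 : ∀ (x : E.dom) (y : F.dom), ⟪dtmul x y, D.1 z⟫_ℂ = 0 := by
    intro x y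
    rw [CStarOps.inner_right_star]
    refine subTensor_induction
      (P := fun z => ⟪((star D).1 (dtmul x y) : HTensor H K), z⟫_ℂ = 0)
      (isClosed_eq (by fun_prop) continuous_const) (inner_zero_right _) ?_ ?_ ?_ _ hz
    · intro z w h h'; rw [inner_add_right, h, h', add_zero]
    · intro c z h; rw [inner_smul_right, h, mul_zero]
    · intro x' hx' y' hy'
      exact (CStarOps.inner_right_star D (dtmul x y)
        (dtmul ⟨x', E.sub_le_dom i hx'⟩ ⟨y', F.sub_le_dom j hy'⟩)).symm.trans (hD0 _ _ _ _)
  -- The vector `D z` again lies in `H_i ⊗ K_j`, so orthogonality to elementary tensors makes it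
  -- orthogonal to itself.
  have h2 : ⟪(D.1 z : HTensor H K), (D.1 z : HTensor H K)⟫_ℂ = 0 := by
    refine subTensor_induction
      (P := fun w => ⟪w, (D.1 z : HTensor H K)⟫_ℂ = 0)
      (isClosed_eq (by fun_prop) continuous_const) (inner_zero_left _) ?_ ?_ ?_ _
      ((D.2 (i, j)).1 z hz)
    · intro z w h h'; rw [inner_add_left, h, h', add_zero]
    · intro c z h; rw [inner_smul_left, h, mul_zero]
    · intro x hx y hy
      exact h1 ⟨x, E.sub_le_dom i hx⟩ ⟨y, F.sub_le_dom j hy⟩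
  exact Subtype.ext (inner_self_eq_zero.1 h2)

end TensorSlices

/-! ### Polarization -/

/-- The diagonal at `x + y` gives `D x y + D y x = 0`, the one at `x + i y` gives `D x y - D y x =
0`. -/
theorem sesquilinear_eq_zero {X : Type*} [AddCommGroup X] [Module ℂ X] {D : X → X → ℂ}
    (hal : ∀ x x' y, D (x + x') y = D x y + D x' y) (har : ∀ x y y', D x (y + y') = D x y + D x y')
    (hsl : ∀ c x y, D (c • x) y = starRingEnd ℂ c * D x y) (hsr : ∀ c x y, D x (c • y) = c * D x y)
    (h : ∀ x, D x x = 0) (x y : X) : D x y = 0 := by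
  have h1 := h (x + y)
  have h2 := h (x + Complex.I • y)
  simp only [hal, har, hsl, hsr, h, Complex.conj_I] at h1 h2
  have h3 : D x y - D y x = 0 := by
    linear_combination (-Complex.I) * h2 + (D x y - D y x) * Complex.I_mul_I
  linear_combination (1 / 2) * h1 + (1 / 2) * h3

/-! ### Pure maps -/

section Pure

variable {A : Type*} [Ring A] [StarRing A] [Algebra ℂ A] [StarModule ℂ A] {Λ : Type*}
  {p : Λ → Seminorm ℂ A}
  {ι H : Type*} [NormedAddCommGroup H] [InnerProductSpace ℂ H] [CompleteSpace H] [Nonempty ι]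
  {E : QuantizedDomain ι H}

omit [StarModule ℂ A] in
theorem IsFormPos.smul {θ : A →ₗ[ℂ] CStarOps E} (h : IsFormPos θ) {r : ℝ} (hr : 0 ≤ r) :
    IsFormPos ((r : ℂ) • θ) := by
  intro n a x
  simp only [LinearMap.smul_apply, CStarOps.smul_apply, inner_smul_right, ← Finset.mul_sum]
  exact mul_nonneg (Complex.zero_le_real.2 hr) (h n a x)

omit [StarModule ℂ A] [StarRing A] [CompleteSpace H] [Nonempty ι] in
theorem IsLocBounded.smul {θ : A →ₗ[ℂ] CStarOps E} (h : IsLocBounded p θ) (c : ℂ) :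
    IsLocBounded p (c • θ) := by
  intro k
  obtain ⟨l, C, hC0, hC⟩ := h k
  refine ⟨l, ‖c‖ * C, by positivity, fun a => ?_⟩
  rw [LinearMap.smul_apply, map_smul_eq_mul, mul_assoc]
  gcongr
  exact hC a

-- Since the other summand is positive, `θ(1) ≤ φ(1) ≤ 1`. Thus only positivity and local
-- boundedness have to be checked when one map is compared with another.
omit [StarModule ℂ A] in
theorem IsFormCPCC.of_add {φ θ θ' : A →ₗ[ℂ] CStarOps E} (hφ : IsFormCPCC p φ) (hsum : θ + θ' = φ)
    (hθ : IsFormPos θ) (hθ' : IsFormPos θ') (hb : IsLocBounded p θ) : IsFormCPCC p θ := by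
  refine ⟨hθ, hb, fun x => le_trans ?_ (hφ.le_one x)⟩
  rw [← hsum, LinearMap.add_apply, CStarOps.add_apply, inner_add_right, Complex.add_re]
  linarith [(Complex.nonneg_iff.1 (hθ'.nonneg_one x)).1]

/-- Polarization of `(a, b) ↦ ⟪x, θ(a* b) x⟫`, read at `(1, a)`; an operator on a complex space is
determined by its quadratic form. -/
theorem IsFormPos.eq_zero_of_forall {θ : A →ₗ[ℂ] CStarOps E}
    (h : ∀ a x, ⟪x, (θ (star a * a)).1 x⟫_ℂ = 0) : θ = 0 := by
  refine LinearMap.ext fun a => CStarOps.ext_form fun x => ?_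
  have h1 := sesquilinear_eq_zero (X := A) (D := fun a b => ⟪x, (θ (star a * b)).1 x⟫_ℂ)
    (by simp [add_mul, CStarOps.add_apply, inner_add_right])
    (by simp [mul_add, CStarOps.add_apply, inner_add_right])
    (by simp [CStarOps.smul_apply, inner_smul_right])
    (by simp [CStarOps.smul_apply, inner_smul_right]) (fun a => h a x) 1 a
  rw [star_one, one_mul] at h1
  rw [h1, LinearMap.zero_apply, CStarOps.zero_apply, inner_zero_right]

/-- A positive map below a multiple of a pure map is a multiple of it. -/
theorem IsPure.exists_eq_smul (hp : ∀ l, IsCStarSeminorm (p l)) {φ θ : A →ₗ[ℂ] CStarOps E}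
    (hpure : IsPure p φ) (hφ : IsFormCPCC p φ) {s : ℝ} (hs : 0 ≤ s) (hθ : IsFormPos θ)
    (hb : IsLocBounded p θ) (hθ' : IsFormPos ((s : ℂ) • φ - θ))
    (hb' : IsLocBounded p ((s : ℂ) • φ - θ)) : ∃ c : ℂ, θ = c • φ := by
  -- For `s = 0` both `θ` and `-θ` are positive, so `θ = 0`. For `s > 0`, division by `s` produces a
  -- map dominated by `φ` itself, to which purity applies.
  rcases hs.eq_or_lt with h0 | h0
  · refine ⟨0, ?_⟩
    rw [zero_smul]
    refine IsFormPos.eq_zero_of_forall fun a x => le_antisymm ?_ (hθ.nonneg a x)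
    have := hθ'.nonneg a x
    rw [← h0] at this
    rw [LinearMap.sub_apply, CStarOps.sub_apply, LinearMap.smul_apply, CStarOps.smul_apply,
      inner_sub_right, inner_smul_right, Complex.ofReal_zero, zero_mul, zero_sub] at this
    exact neg_nonneg.1 this
  · have hs' : (s : ℂ) ≠ 0 := Complex.ofReal_ne_zero.2 h0.ne'
    set ψ : A →ₗ[ℂ] CStarOps E := ((s⁻¹ : ℝ) : ℂ) • θ with hψ
    have hsub : φ - ψ = ((s⁻¹ : ℝ) : ℂ) • ((s : ℂ) • φ - θ) := by
      rw [smul_sub, smul_smul, hψ]; push_cast; rw [inv_mul_cancel₀ hs', one_smul]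
    have h1 : IsFormPos ψ := hθ.smul (inv_nonneg.2 hs)
    have h2 : IsFormPos (φ - ψ) := hsub ▸ hθ'.smul (inv_nonneg.2 hs)
    have h3 : IsLocBounded p ψ := hb.smul _
    have h4 : IsLocBounded p (φ - ψ) := hsub ▸ hb'.smul _
    obtain ⟨α, -, hα⟩ := hpure ψ
      ((hφ.of_add (add_sub_cancel ψ φ) h1 h2 h3).isLocalCPCC hp)
      ((hφ.of_add (sub_add_cancel φ ψ) h2 h1 h4).isLocalCPCC hp)
    refine ⟨s * α, ?_⟩
    rw [mul_smul, ← hα, hψ, smul_smul]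
    push_cast
    rw [mul_inv_cancel₀ hs', one_smul]

end Pure

/-! ### Factorization of maps dominated by a tensor product with a pure factor. -/

section Domination

variable {A : Type*} [Ring A] [StarRing A] [Algebra ℂ A] [StarModule ℂ A] {Λ : Type*}
  {p : Λ → Seminorm ℂ A} {B : Type*} [Ring B] [StarRing B] [Algebra ℂ B] [StarModule ℂ B]
  {Δ : Type*} {q : Δ → Seminorm ℂ B}
  {ι κ H K : Type*} [NormedAddCommGroup H] [InnerProductSpace ℂ H] [CompleteSpace H]
  [NormedAddCommGroup K] [InnerProductSpace ℂ K] [CompleteSpace K] [Nonempty ι] [Nonempty κ]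
  {E : QuantizedDomain ι H} {F : QuantizedDomain κ K}

/-- The slice `a ↦ (id ⊗ ω_y)(χ(a ⊗ b* b))`. -/
def leftSlice (χ : MinTensor p q →ₗ[ℂ] CStarOps (E.tensor F)) (b : B) (y : F.dom) :
    A →ₗ[ℂ] CStarOps E :=
  (isCompatible_htmulLeft y).slice ∘ₗ χ ∘ₗ MinTensor.tmulLeft p q (star b * b)

/-- The slice `b ↦ (ω_x ⊗ id)(χ(a* a ⊗ b))`. -/
def rightSlice (χ : MinTensor p q →ₗ[ℂ] CStarOps (E.tensor F)) (a : A) (x : E.dom) :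
    B →ₗ[ℂ] CStarOps F :=
  (isCompatible_htmulRight x).slice ∘ₗ χ ∘ₗ MinTensor.tmulRight p q (star a * a)

theorem leftSlice_apply (χ : MinTensor p q →ₗ[ℂ] CStarOps (E.tensor F)) (b : B) (y : F.dom)
    (a : A) : leftSlice χ b y a =
      (isCompatible_htmulLeft y).slice (χ (MinTensor.tmul p q a (star b * b))) := rfl

theorem rightSlice_apply (χ : MinTensor p q →ₗ[ℂ] CStarOps (E.tensor F)) (a : A) (x : E.dom)
    (b : B) : rightSlice χ a x b =
      (isCompatible_htmulRight x).slice (χ (MinTensor.tmul p q (star a * a) b)) := rfl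

theorem leftSlice_sub (χ χ' : MinTensor p q →ₗ[ℂ] CStarOps (E.tensor F)) (b : B) (y : F.dom) :
    leftSlice (χ - χ') b y = leftSlice χ b y - leftSlice χ' b y := by
  simp only [leftSlice, LinearMap.sub_comp, LinearMap.comp_sub]

theorem rightSlice_sub (χ χ' : MinTensor p q →ₗ[ℂ] CStarOps (E.tensor F)) (a : A) (x : E.dom) :
    rightSlice (χ - χ') a x = rightSlice χ a x - rightSlice χ' a x := by
  simp only [rightSlice, LinearMap.sub_comp, LinearMap.comp_sub]

/-- This is why the fixed entry is `b* b`: `(a ⊗ b)* (a' ⊗ b) = a* a' ⊗ b* b`. -/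
theorem isFormPos_leftSlice {χ : MinTensor p q →ₗ[ℂ] CStarOps (E.tensor F)} (hχ : IsFormPos χ)
    (b : B) (y : F.dom) : IsFormPos (leftSlice χ b y) :=
  IsCompatible.isFormPos_slice _ hχ (u := fun a => MinTensor.tmul p q a b) fun a a' => by
    rw [MinTensor.star_tmul_mul_tmul]; rfl

theorem isFormPos_rightSlice {χ : MinTensor p q →ₗ[ℂ] CStarOps (E.tensor F)} (hχ : IsFormPos χ)
    (a : A) (x : E.dom) : IsFormPos (rightSlice χ a x) :=
  IsCompatible.isFormPos_slice _ hχ (u := fun b => MinTensor.tmul p q a b) fun b b' => by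
    rw [MinTensor.star_tmul_mul_tmul]; rfl

theorem isLocBounded_leftSlice {χ : MinTensor p q →ₗ[ℂ] CStarOps (E.tensor F)}
    (hχ : IsLocBounded (MinTensor.seminorm p q) χ) (b : B) (y : F.dom) :
    IsLocBounded p (leftSlice χ b y) :=
  IsCompatible.isLocBounded_slice _ hχ fun ld => ⟨ld.1, q ld.2 (star b * b), apply_nonneg _ _,
    fun a => (MinTensor.seminorm_tmul_le ld a (star b * b)).trans_eq (mul_comm _ _)⟩

theorem isLocBounded_rightSlice {χ : MinTensor p q →ₗ[ℂ] CStarOps (E.tensor F)}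
    (hχ : IsLocBounded (MinTensor.seminorm p q) χ) (a : A) (x : E.dom) :
    IsLocBounded q (rightSlice χ a x) :=
  IsCompatible.isLocBounded_slice _ hχ fun ld => ⟨ld.2, p ld.1 (star a * a), apply_nonneg _ _,
    fun b => MinTensor.seminorm_tmul_le ld (star a * a) b⟩

theorem IsFormPos.exists_nonneg {θ : A →ₗ[ℂ] CStarOps E} (h : IsFormPos θ) (a : A) (x : E.dom) :
    ∃ s : ℝ, 0 ≤ s ∧ ⟪x, (θ (star a * a)).1 x⟫_ℂ = s := by
  have h1 := Complex.nonneg_iff.1 (h.nonneg a x)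
  exact ⟨_, h1.1, Complex.ext rfl h1.2.symm⟩

/-- If `χ` is dominated by `φ ⊗ ψ` and `φ` is pure, the slices of `χ` are multiples of `φ`. -/
theorem exists_leftSlice_eq_smul (hp : ∀ l, IsCStarSeminorm (p l))
    {φ : A →ₗ[ℂ] CStarOps E} {ψ : B →ₗ[ℂ] CStarOps F}
    {Φ χ : MinTensor p q →ₗ[ℂ] CStarOps (E.tensor F)} (hpure : IsPure p φ)
    (hφ : IsFormCPCC p φ) (hψ : IsFormPos ψ)
    (hΦ : ∀ a b, Φ (MinTensor.tmul p q a b) = tensorOp (φ a) (ψ b))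
    (hχ : IsFormCPCC (MinTensor.seminorm p q) χ)
    (hΦχ : IsFormCPCC (MinTensor.seminorm p q) (Φ - χ)) (b : B) (y : F.dom) :
    ∃ c : ℂ, leftSlice χ b y = c • φ := by
  obtain ⟨s, hs, hsy⟩ := hψ.exists_nonneg b y
  have h1 : leftSlice Φ b y = (s : ℂ) • φ := LinearMap.ext fun a => by
    rw [leftSlice_apply, hΦ, slice_left_tensorOp, hsy, LinearMap.smul_apply]
  -- The remainder `s φ - leftSlice χ b y` is the slice of `Φ - χ`, hence positive and locally
  -- bounded.
  refine hpure.exists_eq_smul hp hφ hs (isFormPos_leftSlice hχ.pos b y)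
    (isLocBounded_leftSlice hχ.bdd b y) ?_ ?_
  · rw [← h1, ← leftSlice_sub]; exact isFormPos_leftSlice hΦχ.pos b y
  · rw [← h1, ← leftSlice_sub]; exact isLocBounded_leftSlice hΦχ.bdd b y

/-- Proportionality of the slices extends to all matrix elements by polarization. -/
theorem matrix_element_eq {φ : A →ₗ[ℂ] CStarOps E}
    {χ : MinTensor p q →ₗ[ℂ] CStarOps (E.tensor F)}
    (h : ∀ b y, ∃ c : ℂ, leftSlice χ b y = c • φ) (a a₀ : A) (x x' x₀ : E.dom) (b : B)
    (y y' : F.dom) :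
    ⟪x₀, (φ a₀).1 x₀⟫_ℂ * ⟪dtmul x y, (χ (MinTensor.tmul p q a b)).1 (dtmul x' y')⟫_ℂ =
      ⟪dtmul x₀ y, (χ (MinTensor.tmul p q a₀ b)).1 (dtmul x₀ y')⟫_ℂ * ⟪x, (φ a).1 x'⟫_ℂ := by
  let m : A → B →ₗ[ℂ] MinTensor p q := fun a => MinTensor.tmulRight p q a
  let D : B → F.dom → F.dom → ℂ := fun b y y' =>
    ⟪x₀, (φ a₀).1 x₀⟫_ℂ * ⟪dtmul x y, (χ (m a b)).1 (dtmul x' y')⟫_ℂ -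
      ⟪dtmul x₀ y, (χ (m a₀ b)).1 (dtmul x₀ y')⟫_ℂ * ⟪x, (φ a).1 x'⟫_ℂ
  -- The factor `c` depends on `b` and `y` only, so it cancels in the cross-multiplied identity.
  -- That form also makes `D` linear in `b` and sesquilinear in `y`, `y'`, ready for polarization.
  have hdiag : ∀ b y, D (star b * b) y y = 0 := by
    intro b y
    obtain ⟨c, hc⟩ := h b y
    have h1 : ∀ a x x', ⟪dtmul x y, (χ (m a (star b * b))).1 (dtmul x' y)⟫_ℂ =
        c * ⟪x, (φ a).1 x'⟫_ℂ := fun a x x' => by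
      have h2 := congrArg (fun θ : A →ₗ[ℂ] CStarOps E => ⟪x, (θ a).1 x'⟫_ℂ) hc
      simp only [leftSlice_apply, inner_slice_left, LinearMap.smul_apply, CStarOps.smul_apply,
        inner_smul_right] at h2
      exact h2
    simp only [D, h1]
    ring
  -- From `b* b` to arbitrary `b`: polarization of `(b, b') ↦ D (b* b') y y`, read at `(1, b)`.
  have hb : ∀ b y, D b y y = 0 := by
    intro b y
    have h1 := sesquilinear_eq_zero (X := B) (D := fun b b' => D (star b * b') y y)
      (fun b b' c => by
        simp only [D, star_add, add_mul, map_add, CStarOps.add_apply, inner_add_right]; ring)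
      (fun b b' c => by
        simp only [D, mul_add, map_add, CStarOps.add_apply, inner_add_right]; ring)
      (fun c b b' => by
        simp only [D, star_smul, smul_mul_assoc, map_smul, CStarOps.smul_apply, inner_smul_right]
        simp only [← starRingEnd_apply]
        ring)
      (fun c b b' => by
        simp only [D, mul_smul_comm, map_smul, CStarOps.smul_apply, inner_smul_right]; ring)
      (fun b => hdiag b y) 1 b
    simpa using h1
  have h1 := sesquilinear_eq_zero (X := F.dom) (D := fun y y' => D b y y')
    (fun y y' z => by
      simp only [D, dtmul_add_right, inner_add_left]; ring)
    (fun y z z' => by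
      simp only [D, dtmul_add_right, map_add, inner_add_right]; ring)
    (fun c y z => by
      simp only [D, dtmul_smul_right, inner_smul_left]; ring)
    (fun c y z => by
      simp only [D, dtmul_smul_right, map_smul, inner_smul_right]; ring)
    (fun y => hb b y) y y'
  exact sub_eq_zero.1 h1

theorem IsLocBounded.zero [Nonempty Δ] :
    IsLocBounded q (0 : B →ₗ[ℂ] CStarOps F) := fun k =>
  ⟨Classical.arbitrary Δ, 0, le_rfl, fun b => by simp⟩

theorem tensorOp_zero_left (S : CStarOps F) : tensorOp (0 : CStarOps E) S = 0 :=
  CStarOps.ext_dtmul fun x y x' y' => by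
    rw [tensorOp_dtmul, inner_dtmul, CStarOps.zero_apply, CStarOps.zero_apply]; simp

/-- A map dominated by `φ ⊗ ψ`, with `φ` pure, is of the form `φ ⊗ ψ'`. -/
theorem exists_factor [Nonempty Δ] (hp : ∀ l, IsCStarSeminorm (p l))
    {φ : A →ₗ[ℂ] CStarOps E} {ψ : B →ₗ[ℂ] CStarOps F}
    {Φ χ : MinTensor p q →ₗ[ℂ] CStarOps (E.tensor F)} (hpure : IsPure p φ)
    (hφ : IsFormCPCC p φ) (hψ : IsFormCPCC q ψ)
    (hΦ : ∀ a b, Φ (MinTensor.tmul p q a b) = tensorOp (φ a) (ψ b))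
    (hχ : IsFormCPCC (MinTensor.seminorm p q) χ)
    (hΦχ : IsFormCPCC (MinTensor.seminorm p q) (Φ - χ)) :
    ∃ ψ' : B →ₗ[ℂ] CStarOps F, IsFormCPCC q ψ' ∧ IsFormCPCC q (ψ - ψ') ∧
      ∀ a b, χ (MinTensor.tmul p q a b) = tensorOp (φ a) (ψ' b) := by
  rcases eq_or_ne φ 0 with h0 | h0
  -- For `φ = 0`, domination makes both `χ` and `-χ` positive at `a* a ⊗ b* b`. Polarization in `b`,
  -- then in `a`, shows that `χ` vanishes on elementary tensors.
  · refine ⟨0, ⟨fun n a x => by simp [CStarOps.zero_apply], IsLocBounded.zero, fun x => by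
      simp [CStarOps.zero_apply]⟩, by rwa [sub_zero], fun a b => ?_⟩
    have hz : ∀ a b w, ⟪w, (χ (MinTensor.tmul p q (star a * a) (star b * b))).1 w⟫_ℂ = 0 := by
      intro a b w
      have h1 := hχ.pos.nonneg (MinTensor.tmul p q a b) w
      have h2 := hΦχ.pos.nonneg (MinTensor.tmul p q a b) w
      rw [MinTensor.star_tmul_mul_tmul] at h1 h2
      rw [LinearMap.sub_apply, hΦ, h0, LinearMap.zero_apply, tensorOp_zero_left,
        CStarOps.sub_apply, CStarOps.zero_apply, zero_sub, inner_neg_right] at h2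
      exact le_antisymm (neg_nonneg.1 h2) h1
    have h1 : ∀ a, χ ∘ₗ MinTensor.tmulRight p q (star a * a) = 0 := fun a =>
      IsFormPos.eq_zero_of_forall (hz a)
    have h2 : χ ∘ₗ MinTensor.tmulLeft p q b = 0 := IsFormPos.eq_zero_of_forall fun a w => by
      have h3 : χ (MinTensor.tmul p q (star a * a) b) = 0 :=
        congrArg (fun f : B →ₗ[ℂ] CStarOps (E.tensor F) => f b) (h1 a)
      rw [LinearMap.comp_apply, MinTensor.tmulLeft_apply, h3, CStarOps.zero_apply,
        inner_zero_right]
    rw [h0, LinearMap.zero_apply, tensorOp_zero_left]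
    exact congrArg (fun f : A →ₗ[ℂ] CStarOps (E.tensor F) => f a) h2
  -- By polarization, a nonzero `φ` has a nonzero diagonal value.
  obtain ⟨a₀, x₀, ht⟩ : ∃ a₀ x₀, ⟪x₀, (φ (star a₀ * a₀)).1 x₀⟫_ℂ ≠ 0 := by
    by_contra! hcon
    exact h0 (IsFormPos.eq_zero_of_forall hcon)
  obtain ⟨t, ht0, hts⟩ := hφ.pos.exists_nonneg a₀ x₀
  have ht' : (t : ℂ) ≠ 0 := hts ▸ ht
  have hΦs : rightSlice Φ a₀ x₀ = (t : ℂ) • ψ := LinearMap.ext fun b => by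
    rw [rightSlice_apply, hΦ, slice_right_tensorOp, hts, LinearMap.smul_apply]
  -- Normalized so that the same slice of `Φ` is exactly `ψ`; hence `ψ - ψ'` is a slice of `Φ - χ`.
  set ψ' : B →ₗ[ℂ] CStarOps F := ((t⁻¹ : ℝ) : ℂ) • rightSlice χ a₀ x₀ with hψ'
  have hsub : ψ - ψ' = ((t⁻¹ : ℝ) : ℂ) • rightSlice (Φ - χ) a₀ x₀ := by
    rw [rightSlice_sub, hΦs, smul_sub, smul_smul, hψ']
    push_cast
    rw [inv_mul_cancel₀ ht', one_smul]
  have h1 : IsFormPos ψ' := (isFormPos_rightSlice hχ.pos a₀ x₀).smul (inv_nonneg.2 ht0)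
  have h2 : IsFormPos (ψ - ψ') :=
    hsub ▸ (isFormPos_rightSlice hΦχ.pos a₀ x₀).smul (inv_nonneg.2 ht0)
  have h3 : IsLocBounded q ψ' := (isLocBounded_rightSlice hχ.bdd a₀ x₀).smul _
  have h4 : IsLocBounded q (ψ - ψ') := hsub ▸ (isLocBounded_rightSlice hΦχ.bdd a₀ x₀).smul _
  refine ⟨ψ', hψ.of_add (add_sub_cancel ψ' ψ) h1 h2 h3, hψ.of_add (sub_add_cancel ψ ψ') h2 h1 h4,
    fun a b => CStarOps.ext_dtmul fun x y x' y' => ?_⟩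
  have h5 := matrix_element_eq (exists_leftSlice_eq_smul hp hpure hφ hψ.pos hΦ hχ hΦχ) a (star a₀ * a₀) x x' x₀ b y y'
  have h6 : ⟪y, (ψ' b).1 y'⟫_ℂ = (t : ℂ)⁻¹ *
      ⟪dtmul x₀ y, (χ (MinTensor.tmul p q (star a₀ * a₀) b)).1 (dtmul x₀ y')⟫_ℂ := by
    rw [hψ', LinearMap.smul_apply, CStarOps.smul_apply, inner_smul_right, rightSlice_apply,
      inner_slice_right]
    push_cast; rfl
  rw [tensorOp_dtmul, inner_dtmul, h6]
  rw [hts] at h5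
  field_simp
  linear_combination h5

end Domination

/-! ### The GNS representation of a positive matrix of functionals -/

section GNS

universe w

variable {A : Type w} [Ring A] [StarRing A] [Algebra ℂ A] {N : ℕ}

/-- The sesquilinear form on `A ^ N` given by a matrix of functionals. -/
def kernelForm (f : Fin N → Fin N → A →ₗ[ℂ] ℂ) (v w : Fin N → A) : ℂ :=
  ∑ r, ∑ s, f r s (star (v r) * w s)

/-- The matrix of functionals is positive. -/
def IsPosKernel (f : Fin N → Fin N → A →ₗ[ℂ] ℂ) : Prop := ∀ v, 0 ≤ kernelForm f v v

variable {f : Fin N → Fin N → A →ₗ[ℂ] ℂ}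

theorem kernelForm_add_left (v v' w : Fin N → A) :
    kernelForm f (v + v') w = kernelForm f v w + kernelForm f v' w := by
  simp [kernelForm, add_mul, Finset.sum_add_distrib]

theorem kernelForm_add_right (v w w' : Fin N → A) :
    kernelForm f v (w + w') = kernelForm f v w + kernelForm f v w' := by
  simp [kernelForm, mul_add, Finset.sum_add_distrib]

theorem kernelForm_smul_right (c : ℂ) (v w : Fin N → A) :
    kernelForm f v (c • w) = c * kernelForm f v w := by
  simp [kernelForm, Finset.mul_sum]

theorem kernelForm_mul_right (a : A) (v w : Fin N → A) :
    kernelForm f v (fun s => a * w s) = kernelForm f (fun r => star a * v r) w := by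
  simp [kernelForm, mul_assoc]

variable [StarModule ℂ A]

theorem kernelForm_smul_left (c : ℂ) (v w : Fin N → A) :
    kernelForm f (c • v) w = starRingEnd ℂ c * kernelForm f v w := by
  simp [kernelForm, Finset.mul_sum]

/-- The difference of the two sides is sesquilinear and vanishes on the diagonal, where the form is
real. -/
theorem IsPosKernel.conj_symm (hf : IsPosKernel f) (v w : Fin N → A) :
    starRingEnd ℂ (kernelForm f w v) = kernelForm f v w := by
  refine (sub_eq_zero.1 (sesquilinear_eq_zero (X := Fin N → A)
    (D := fun v w => kernelForm f v w - starRingEnd ℂ (kernelForm f w v)) ?_ ?_ ?_ ?_ ?_ v w)).symm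
  · intro v v' w; simp only [kernelForm_add_left, kernelForm_add_right, map_add]; ring
  · intro v v' w; simp only [kernelForm_add_left, kernelForm_add_right, map_add]; ring
  · intro c v w; simp only [kernelForm_smul_left, kernelForm_smul_right, map_mul]; ring
  · intro c v w
    simp only [kernelForm_smul_left, kernelForm_smul_right, map_mul, Complex.conj_conj]; ring
  · intro v
    rw [Complex.conj_eq_iff_im.2 (Complex.nonneg_iff.1 (hf v)).2.symm, sub_self]

/-- `A ^ N` with the semi-inner product given by a positive matrix of functionals. -/
def PreGNS (_hf : IsPosKernel f) : Type w := Fin N → A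

namespace PreGNS

variable {hf : IsPosKernel f}

instance : AddCommGroup (PreGNS hf) := inferInstanceAs (AddCommGroup (Fin N → A))

instance : Module ℂ (PreGNS hf) := inferInstanceAs (Module ℂ (Fin N → A))

/-- The semi-inner product. -/
abbrev core (hf : IsPosKernel f) : PreInnerProductSpace.Core ℂ (PreGNS hf) where
  inner v w := kernelForm f v w
  conj_inner_symm v w := hf.conj_symm v w
  re_inner_nonneg v := (Complex.nonneg_iff.1 (hf v)).1
  add_left v v' w := kernelForm_add_left v v' w
  smul_left v w c := kernelForm_smul_left c v w

instance : SeminormedAddCommGroup (PreGNS hf) :=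
  InnerProductSpace.Core.toSeminormedAddCommGroup (c := core hf)

instance : InnerProductSpace ℂ (PreGNS hf) := InnerProductSpace.ofCore (core hf)

/-- Coordinatewise left multiplication. -/
def lmul (c : A) (v : PreGNS hf) : PreGNS hf := fun r => c * v r

/-- The standard basis vectors. -/
def single (hf : IsPosKernel f) (r : Fin N) : PreGNS hf := Pi.single (M := fun _ => A) r 1

theorem inner_def (v w : PreGNS hf) : ⟪v, w⟫_ℂ = kernelForm f v w := rfl

theorem norm_sq (v : PreGNS hf) : ‖v‖ ^ 2 = (kernelForm f v v).re :=
  (inner_self_eq_norm_sq (𝕜 := ℂ) v).symm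

omit [StarModule ℂ A] in
theorem _root_.LocCStar.IsCStarSeminorm.pow_le {p : Seminorm ℂ A} (hp : IsCStarSeminorm p) (a : A)
    {k : ℕ} (hk : k ≠ 0) : p (a ^ k) ≤ p a ^ k := by
  induction k with
  | zero => exact absurd rfl hk
  | succ k ih =>
    rcases eq_or_ne k 0 with rfl | h
    · simp
    · rw [pow_succ, pow_succ]
      exact (hp.mul_le _ _).trans (mul_le_mul_of_nonneg_right (ih h) (apply_nonneg p a))

/-- The functional `a ↦ ⟪v, a v⟫` is positive and bounded by a multiple of `p`. On `(c* c) ^ k` it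
grows at most like `p(c) ^ (2k)`, so `norm_le_of_pow_bound` yields `⟪c v, c v⟫ ≤ p(c)² ⟪v, v⟫`. -/
theorem norm_mul_le {p : Seminorm ℂ A} (hp : IsCStarSeminorm p) {C : ℝ}
    (hC : ∀ r s a, ‖f r s a‖ ≤ C * p a) (c : A) (v : PreGNS hf) :
    ‖lmul c v‖ ≤ p c * ‖v‖ := by
  refine (sq_le_sq₀ (norm_nonneg _) (mul_nonneg (apply_nonneg p c) (norm_nonneg _))).1 ?_
  rw [mul_pow, norm_sq, norm_sq]
  let g : A →ₗ[ℂ] ℂ :=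
    { toFun := fun a => kernelForm f v fun s => a * v s
      map_add' := fun a b => by
        simp only [add_mul]; exact kernelForm_add_right _ _ _
      map_smul' := fun z a => by
        simp only [smul_mul_assoc]; exact kernelForm_smul_right _ _ _ }
  have hg : ∀ a, g a = kernelForm f v fun s => a * v s := fun _ => rfl
  have hgs : ∀ a, g (star a * a) = kernelForm f (fun r => a * v r) fun s => a * v s := fun a => by
    rw [hg]
    simp only [mul_assoc]
    rw [kernelForm_mul_right (star a) v (fun s => a * v s), star_star]
  have hpos : ∀ a, 0 ≤ g (star a * a) := fun a => by rw [hgs]; exact hf _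
  have hbound : ∀ k ≠ 0, ‖g ((star c * c) ^ k)‖ ≤
      (∑ r, ∑ s, |C| * p (v r) * p (v s)) * (p c ^ 2) ^ k := by
    intro k hk
    change ‖∑ r, ∑ s, f r s (star (v r) * ((star c * c) ^ k * v s))‖ ≤ _
    rw [Finset.sum_mul]
    refine (norm_sum_le _ _).trans (Finset.sum_le_sum fun r _ => ?_)
    rw [Finset.sum_mul]
    refine (norm_sum_le _ _).trans (Finset.sum_le_sum fun s _ => ?_)
    have h1 : p ((star c * c) ^ k) ≤ (p c ^ 2) ^ k := by
      rw [← hp.star_mul_self]; exact hp.pow_le _ hk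
    have h2 : p (star (v r) * ((star c * c) ^ k * v s)) ≤ p (v r) * ((p c ^ 2) ^ k * p (v s)) := by
      refine (hp.mul_le _ _).trans ?_
      rw [hp.map_star]
      refine mul_le_mul_of_nonneg_left ?_ (apply_nonneg p _)
      exact (hp.mul_le _ _).trans (mul_le_mul_of_nonneg_right h1 (apply_nonneg p _))
    calc _ ≤ C * p (star (v r) * ((star c * c) ^ k * v s)) := hC r s _
      _ ≤ |C| * (p (v r) * ((p c ^ 2) ^ k * p (v s))) :=
          mul_le_mul (le_abs_self C) h2 (apply_nonneg p _) (abs_nonneg C)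
      _ = _ := by ring
  have h1 := norm_le_of_pow_bound hpos (h := star c * c) (by simp) (sq_nonneg (p c)) hbound
  rw [hgs, hg 1] at h1
  simp only [one_mul] at h1
  exact (Complex.re_le_norm _).trans h1

/-- Left multiplication on `A ^ N`. -/
def leftMul {p : Seminorm ℂ A} (hp : IsCStarSeminorm p) {C : ℝ}
    (hC : ∀ r s a, ‖f r s a‖ ≤ C * p a) (hf : IsPosKernel f) (c : A) :
    PreGNS hf →L[ℂ] PreGNS hf :=
  LinearMap.mkContinuous
    { toFun := lmul c
      map_add' := fun v w => funext fun r => mul_add c (v r) (w r)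
      map_smul' := fun z v => funext fun r => mul_smul_comm z c (v r) } (p c)
    (norm_mul_le hp hC c)

theorem leftMul_apply {p : Seminorm ℂ A} (hp : IsCStarSeminorm p) {C : ℝ}
    (hC : ∀ r s a, ‖f r s a‖ ≤ C * p a) (c : A) (v : PreGNS hf) :
    leftMul hp hC hf c v = lmul c v := rfl

open UniformSpace

/-- The GNS representation. -/
def rep {p : Seminorm ℂ A} (hp : IsCStarSeminorm p) {C : ℝ}
    (hC : ∀ r s a, ‖f r s a‖ ≤ C * p a) (hf : IsPosKernel f) : Rep p where
  space := Completion (PreGNS hf)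
  hom :=
    { toFun := fun c => (leftMul hp hC hf c).completion
      map_one' := by
        ext z
        induction z using Completion.induction_on with
        | hp => exact isClosed_eq (by fun_prop) (by fun_prop)
        | ih v =>
          rw [ContinuousLinearMap.completion_apply_coe, leftMul_apply]
          exact congrArg _ (funext fun r => one_mul (v r))
      map_mul' := fun a b => by
        ext z
        induction z using Completion.induction_on with
        | hp => exact isClosed_eq (by fun_prop) (by fun_prop)
        | ih v =>
          rw [mul_apply_eq_comp, ContinuousLinearMap.completion_apply_coe,
            ContinuousLinearMap.completion_apply_coe, ContinuousLinearMap.completion_apply_coe,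
            leftMul_apply, leftMul_apply, leftMul_apply]
          exact congrArg _ (funext fun r => mul_assoc a b (v r))
      map_zero' := by
        ext z
        induction z using Completion.induction_on with
        | hp => exact isClosed_eq (by fun_prop) (by fun_prop)
        | ih v =>
          rw [ContinuousLinearMap.completion_apply_coe, leftMul_apply]
          refine Eq.trans (congrArg _ ?_) Completion.coe_zero
          exact funext fun r => zero_mul (v r)
      map_add' := fun a b => by
        ext z
        induction z using Completion.induction_on with
        | hp => exact isClosed_eq (by fun_prop) (by fun_prop)
        | ih v =>
          rw [add_apply, ContinuousLinearMap.completion_apply_coe,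
            ContinuousLinearMap.completion_apply_coe, ContinuousLinearMap.completion_apply_coe,
            leftMul_apply, leftMul_apply, leftMul_apply, ← Completion.coe_add]
          exact congrArg _ (funext fun r => add_mul a b (v r))
      commutes' := fun z => by
        ext y
        induction y using Completion.induction_on with
        | hp => exact isClosed_eq (by fun_prop) (by fun_prop)
        | ih v =>
          rw [ContinuousLinearMap.completion_apply_coe, leftMul_apply,
            ContinuousLinearMap.algebraMap_apply, ← Completion.coe_smul]
          exact congrArg _ (funext fun r => (Algebra.smul_def z (v r)).symm)
      map_star' := fun a => by
        refine (ContinuousLinearMap.eq_adjoint_iff _ _).2 fun x y => ?_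
        induction x, y using Completion.induction_on₂ with
        | hp => exact isClosed_eq (by fun_prop) (by fun_prop)
        | ih v w =>
          rw [ContinuousLinearMap.completion_apply_coe, ContinuousLinearMap.completion_apply_coe,
            Completion.inner_coe, Completion.inner_coe, leftMul_apply, leftMul_apply, inner_def,
            inner_def]
          exact (kernelForm_mul_right a v w).symm }
  norm_le a := by
    refine ContinuousLinearMap.opNorm_le_bound _ (apply_nonneg p a) fun z => ?_
    induction z using Completion.induction_on with
    | hp => exact isClosed_le (by fun_prop) (by fun_prop)
    | ih v =>
      change ‖(leftMul hp hC hf a).completion v‖ ≤ _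
      rw [ContinuousLinearMap.completion_apply_coe, Completion.norm_coe, Completion.norm_coe]
      exact norm_mul_le hp hC a v

/-- The standard basis vectors of `A ^ N` in the GNS space. -/
def vec {p : Seminorm ℂ A} (hp : IsCStarSeminorm p) {C : ℝ}
    (hC : ∀ r s a, ‖f r s a‖ ≤ C * p a) (hf : IsPosKernel f) (r : Fin N) : (rep hp hC hf).space :=
  (single hf r : Completion (PreGNS hf))

theorem inner_vec {p : Seminorm ℂ A} (hp : IsCStarSeminorm p) {C : ℝ}
    (hC : ∀ r s a, ‖f r s a‖ ≤ C * p a) (a : A) (r s : Fin N) :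
    ⟪vec hp hC hf r, (rep hp hC hf).hom a (vec hp hC hf s)⟫_ℂ = f r s a := by
  change ⟪(single hf r : Completion (PreGNS hf)),
    (leftMul hp hC hf a).completion (single hf s : Completion (PreGNS hf))⟫_ℂ = _
  rw [ContinuousLinearMap.completion_apply_coe, Completion.inner_coe, leftMul_apply, inner_def]
  simp only [kernelForm, single, lmul]
  rw [Finset.sum_eq_single r, Finset.sum_eq_single s]
  · simp
  · intro s' _ hs; simp [hs]
  · simp
  · intro r' _ hr; simp [hr]
  · simp

end PreGNS

/-- A Stinespring dilation restricted to finitely many vectors. Working on `A ^ N` instead of `A ⊗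
H_k` keeps the space in the universe of `A`, as `Rep` requires. -/
theorem exists_gns_rep {p : Seminorm ℂ A} (hp : IsCStarSeminorm p)
    {ι H : Type*} [NormedAddCommGroup H] [InnerProductSpace ℂ H] {E : QuantizedDomain ι H}
    {φ : A →ₗ[ℂ] CStarOps E} (hφ : IsFormPos φ) {k : ι} {C : ℝ}
    (hC : ∀ a, CStarOps.seminorm E k (φ a) ≤ C * p a) {N : ℕ} (x : Fin N → E.dom)
    (hx : ∀ r, (x r : H) ∈ E.sub k) :
    ∃ (π : Rep p) (g : Fin N → π.space), ∀ a r s,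
      ⟪g r, π.hom a (g s)⟫_ℂ = ⟪x r, (φ a).1 (x s)⟫_ℂ := by
  let f : Fin N → Fin N → A →ₗ[ℂ] ℂ := fun r s => innerₛₗ ℂ (x r) ∘ₗ CStarOps.evalLin (x s) ∘ₗ φ
  have hf : IsPosKernel f := fun v => hφ N v x
  have hb : ∀ r s a, ‖f r s a‖ ≤ (∑ r, ∑ s, ‖x r‖ * ‖x s‖) * |C| * p a := by
    intro r s a
    have h1 : ‖x r‖ * ‖x s‖ ≤ ∑ r, ∑ s, ‖x r‖ * ‖x s‖ :=
      (Finset.single_le_sum (f := fun s => ‖x r‖ * ‖x s‖) (fun s _ => by positivity)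
        (Finset.mem_univ s)).trans (Finset.single_le_sum (f := fun r => ∑ s, ‖x r‖ * ‖x s‖)
          (fun r _ => Finset.sum_nonneg fun s _ => by positivity) (Finset.mem_univ r))
    calc ‖⟪x r, (φ a).1 (x s)⟫_ℂ‖ ≤ ‖x r‖ * ‖(φ a).1 (x s)‖ := norm_inner_le_norm _ _
      _ ≤ ‖x r‖ * (|C| * p a * ‖x s‖) := by
          gcongr
          refine (CStarOps.norm_apply_le k _ (hx s)).trans ?_
          gcongr
          exact (hC a).trans (mul_le_mul_of_nonneg_right (le_abs_self C) (apply_nonneg p a))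
      _ = ‖x r‖ * ‖x s‖ * (|C| * p a) := by ring
      _ ≤ _ := by
          exact (mul_le_mul_of_nonneg_right h1
            (mul_nonneg (abs_nonneg C) (apply_nonneg p a))).trans_eq (by ring)
  exact ⟨PreGNS.rep hp hb hf, PreGNS.vec hp hb hf, fun a r s => PreGNS.inner_vec hp hb a r s⟩

end GNS

/-! ### The tensor product of two maps on the algebraic tensor product -/

section AlgTensorMap

universe u v

variable {A : Type u} [Ring A] [StarRing A] [Algebra ℂ A] [StarModule ℂ A] {Λ : Type*}
  {p : Λ → Seminorm ℂ A} {B : Type v} [Ring B] [StarRing B] [Algebra ℂ B] [StarModule ℂ B]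
  {Δ : Type*} {q : Δ → Seminorm ℂ B}
  {ι κ H K : Type*} [NormedAddCommGroup H] [InnerProductSpace ℂ H] [CompleteSpace H]
  [NormedAddCommGroup K] [InnerProductSpace ℂ K] [CompleteSpace K] [Nonempty ι] [Nonempty κ]
  {E : QuantizedDomain ι H} {F : QuantizedDomain κ K}

theorem inner_tensorOp_dtmul (T : CStarOps E) (S : CStarOps F) (x x' : E.dom) (y y' : F.dom) :
    ⟪dtmul x y, (tensorOp T S).1 (dtmul x' y')⟫_ℂ = ⟪x, T.1 x'⟫_ℂ * ⟪y, S.1 y'⟫_ℂ := by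
  rw [tensorOp_dtmul, inner_dtmul]

omit [Nonempty ι] in
theorem CStarOps.norm_compress_le (T : CStarOps E) (i : ι) :
    ‖CStarOps.compress T i‖ ≤ CStarOps.seminorm E i T := by
  refine ContinuousLinearMap.opNorm_le_bound _ (apply_nonneg _ _) fun x => ?_
  refine ((CStarOps.restr i T).le_opNorm _).trans ?_
  rw [CStarOps.seminorm_apply]
  gcongr
  exact (E.sub i).norm_orthogonalProjectionOnto_apply_le x

theorem seminorm_tensorOp_le (T : CStarOps E) (S : CStarOps F) (ij : ι × κ) :
    CStarOps.seminorm (E.tensor F) ij (tensorOp T S) ≤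
      CStarOps.seminorm E ij.1 T * CStarOps.seminorm F ij.2 S := by
  have hb : ‖boundedTensor T S ij.1 ij.2‖ ≤
      CStarOps.seminorm E ij.1 T * CStarOps.seminorm F ij.2 S := by
    have h0 : ‖boundedTensor T S ij.1 ij.2‖ ≤ ‖CStarOps.compress T ij.1‖ *
        ‖CStarOps.compress S ij.2‖ := by
      refine ContinuousLinearMap.opNorm_le_bound _ (by positivity) fun z => ?_
      induction z using UniformSpace.Completion.induction_on with
      | hp => exact isClosed_le (by fun_prop) (by fun_prop)
      | ih t =>
        rw [boundedTensor, ContinuousLinearMap.completion_apply_coe,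
          UniformSpace.Completion.norm_coe, UniformSpace.Completion.norm_coe]
        exact (ContinuousLinearMap.le_opNorm _ _).trans
          (mul_le_mul_of_nonneg_right (TensorProduct.norm_mapL_le _ _) (norm_nonneg _))
    exact h0.trans (mul_le_mul (T.norm_compress_le _) (S.norm_compress_le _) (norm_nonneg _)
      (apply_nonneg _ _))
  refine CStarOps.seminorm_le (mul_nonneg (apply_nonneg _ _) (apply_nonneg _ _)) fun z hz => ?_
  have h1 : ‖(tensorOp T S).1 z‖ = ‖boundedTensor T S ij.1 ij.2 (z : HTensor H K)‖ :=
    congrArg norm (tensorFun_eq T S z hz)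
  rw [h1]
  exact (ContinuousLinearMap.le_opNorm _ _).trans
    (mul_le_mul_of_nonneg_right hb (norm_nonneg _))

/-- The map `a ⊗ b ↦ φ(a) ⊗ ψ(b)` on the algebraic tensor product. -/
def algTensorMap (φ : A →ₗ[ℂ] CStarOps E) (ψ : B →ₗ[ℂ] CStarOps F) :
    A ⊗[ℂ] B →ₗ[ℂ] CStarOps (E.tensor F) :=
  TensorProduct.lift (LinearMap.mk₂ ℂ (fun a b => tensorOp (φ a) (ψ b))
    (fun a a' b => CStarOps.ext_dtmul fun x y x' y' => by
      simp only [map_add, CStarOps.add_apply, inner_add_right, inner_tensorOp_dtmul, add_mul])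
    (fun c a b => CStarOps.ext_dtmul fun x y x' y' => by
      simp only [map_smul, CStarOps.smul_apply, inner_smul_right, inner_tensorOp_dtmul, mul_assoc])
    (fun a b b' => CStarOps.ext_dtmul fun x y x' y' => by
      simp only [map_add, CStarOps.add_apply, inner_add_right, inner_tensorOp_dtmul, mul_add])
    (fun c a b => CStarOps.ext_dtmul fun x y x' y' => by
      simp only [map_smul, CStarOps.smul_apply, inner_smul_right, inner_tensorOp_dtmul,
        mul_left_comm]))

theorem algTensorMap_tmul (φ : A →ₗ[ℂ] CStarOps E) (ψ : B →ₗ[ℂ] CStarOps F) (a : A) (b : B) :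
    algTensorMap φ ψ (a ⊗ₜ b) = tensorOp (φ a) (ψ b) := rfl

/-- The matrix elements of `φ ⊗ ψ` at elementary tensors are matrix elements of a tensor product
of representations. -/
theorem exists_rep_algTensorMap {pl : Seminorm ℂ A} {qd : Seminorm ℂ B} (hp : IsCStarSeminorm pl)
    (hq : IsCStarSeminorm qd) {φ : A →ₗ[ℂ] CStarOps E} {ψ : B →ₗ[ℂ] CStarOps F}
    (hφ : IsFormPos φ) (hψ : IsFormPos ψ) {i : ι} {j : κ} {C D : ℝ}
    (hC : ∀ a, CStarOps.seminorm E i (φ a) ≤ C * pl a)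
    (hD : ∀ b, CStarOps.seminorm F j (ψ b) ≤ D * qd b) {N : ℕ} (ξ : Fin N → E.dom)
    (η : Fin N → F.dom) (hξ : ∀ s, (ξ s : H) ∈ E.sub i) (hη : ∀ s, (η s : K) ∈ F.sub j) :
    ∃ (π : Rep pl) (ρ : Rep qd) (G : Fin N → π.space ⊗[ℂ] ρ.space), ∀ x s s',
      ⟪dtmul (ξ s) (η s), (algTensorMap φ ψ x).1 (dtmul (ξ s') (η s'))⟫_ℂ =
        ⟪G s, repTensor π ρ x (G s')⟫_ℂ := by
  obtain ⟨π, g, hg⟩ := exists_gns_rep hp hφ hC ξ hξ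
  obtain ⟨ρ, h, hh⟩ := exists_gns_rep hq hψ hD η hη
  refine ⟨π, ρ, fun s => g s ⊗ₜ h s, fun x s s' => ?_⟩
  induction x using TensorProduct.induction_on with
  | zero => simp [CStarOps.zero_apply]
  | add x y hx hy =>
    rw [map_add, map_add, CStarOps.add_apply, _root_.add_apply, inner_add_right, inner_add_right,
      hx, hy]
  | tmul a b =>
    rw [algTensorMap_tmul, inner_tensorOp_dtmul, repTensor_tmul, TensorProduct.mapL_tmul,
      TensorProduct.inner_tmul, hg, hh]

/-- The vectors of `H_i ⊗ K_j` which are finite sums of elementary tensors. -/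
def finiteTensors (E : QuantizedDomain ι H) (F : QuantizedDomain κ K) (ij : ι × κ) :
    Set ((E.tensor F).sub ij) :=
  {z | (z : HTensor H K) ∈ Submodule.span ℂ
    (Set.image2 htmul (E.sub ij.1 : Set H) (F.sub ij.2 : Set K))}

theorem dense_finiteTensors (ij : ι × κ) : Dense (finiteTensors E F ij) := by
  intro z
  have hz : (z : HTensor H K) ∈ closure (Submodule.span ℂ
    (Set.image2 htmul (E.sub ij.1 : Set H) (F.sub ij.2 : Set K)) : Set (HTensor H K)) := z.2
  rw [Topology.IsInducing.subtypeVal.closure_eq_preimage_closure_image]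
  refine closure_mono ?_ hz
  intro w hw
  exact ⟨⟨w, Submodule.le_topologicalClosure _ hw⟩, hw, rfl⟩

theorem exists_sum_dtmul {ij : ι × κ} {z : (E.tensor F).sub ij} (hz : z ∈ finiteTensors E F ij) :
    ∃ (N : ℕ) (ξ : Fin N → E.dom) (η : Fin N → F.dom), (∀ s, (ξ s : H) ∈ E.sub ij.1) ∧
      (∀ s, (η s : K) ∈ F.sub ij.2) ∧
      (⟨z, (E.tensor F).sub_le_dom ij z.2⟩ : (E.tensor F).dom) = ∑ s, dtmul (ξ s) (η s) := by
  obtain ⟨N, c, g, hg⟩ := (Submodule.mem_span_set' (R := ℂ)).1 hz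
  choose x hx y hy hxy using fun s => (g s).2
  refine ⟨N, fun s => c s • ⟨x s, E.sub_le_dom _ (hx s)⟩, fun s => ⟨y s, F.sub_le_dom _ (hy s)⟩,
    fun s => (E.sub ij.1).smul_mem _ (hx s), hy, Subtype.ext ?_⟩
  simp only [dtmul_smul_left]
  rw [AddSubmonoidClass.coe_finsetSum]
  refine hg.symm.trans (Finset.sum_congr rfl fun s _ => ?_)
  rw [← hxy s]
  rfl

/-- On finite sums of elementary tensors the kernel sum is the square of the norm of a vector of `π
⊗ ρ`. Such sums are dense in `H_i ⊗ K_j`, and the form is continuous there. -/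
theorem isFormPos_algTensorMap (hp : ∀ l, IsCStarSeminorm (p l)) (hq : ∀ d, IsCStarSeminorm (q d))
    {φ : A →ₗ[ℂ] CStarOps E} {ψ : B →ₗ[ℂ] CStarOps F} (hφ : IsFormCPCC p φ)
    (hψ : IsFormCPCC q ψ) : IsFormPos (algTensorMap φ ψ) := by
  intro n a ζ
  obtain ⟨ij, hζ⟩ := CStarOps.exists_common_sub ζ
  obtain ⟨l, C, -, hC⟩ := hφ.bdd ij.1
  obtain ⟨d, D, -, hD⟩ := hψ.bdd ij.2
  let Q : (Fin n → (E.tensor F).sub ij) → ℂ := fun w => ∑ m, ∑ m',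
    ⟪w m, CStarOps.restr ij (algTensorMap φ ψ (star (a m) * a m')) (w m')⟫_ℂ
  suffices h : ∀ w, 0 ≤ Q w from h fun m => ⟨ζ m, hζ m⟩
  have hclosed : IsClosed {w | 0 ≤ Q w} := isClosed_le continuous_const (by fun_prop)
  intro w
  refine closure_minimal (s := Set.univ.pi fun _ => finiteTensors E F ij) (fun w hw => ?_) hclosed
    (dense_pi Set.univ (fun _ _ => dense_finiteTensors ij) w)
  choose N ξ η hξ hη hw' using fun m => exists_sum_dtmul (hw m (Set.mem_univ m))
  -- The elementary tensors of all the vectors `w m` are put into one list, so that a single pair of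
  -- representations serves for every matrix element.
  let e := Fintype.equivFin (Σ m, Fin (N m))
  obtain ⟨π, ρ, G, hG⟩ := exists_rep_algTensorMap (hp l) (hq d) hφ.pos hψ.pos hC hD
    (fun t => ξ (e.symm t).1 (e.symm t).2) (fun t => η (e.symm t).1 (e.symm t).2)
    (fun _ => hξ _ _) fun _ => hη _ _
  have hG' : ∀ x (s s' : Σ m, Fin (N m)), ⟪dtmul (ξ s.1 s.2) (η s.1 s.2),
      (algTensorMap φ ψ x).1 (dtmul (ξ s'.1 s'.2) (η s'.1 s'.2))⟫_ℂ =
        ⟪G (e s), repTensor π ρ x (G (e s'))⟫_ℂ := fun x s s' => by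
    have h := hG x (e s) (e s')
    rwa [e.symm_apply_apply s, e.symm_apply_apply s'] at h
  have key : Q w = ⟪∑ s : Σ m, Fin (N m), repTensor π ρ (a s.1) (G (e s)),
      ∑ s : Σ m, Fin (N m), repTensor π ρ (a s.1) (G (e s))⟫_ℂ := by
    rw [Fintype.sum_sigma, sum_inner]
    refine Finset.sum_congr rfl fun m _ => ?_
    rw [inner_sum]
    refine Finset.sum_congr rfl fun m' _ => ?_
    refine Eq.trans (b := ⟪(⟨w m, (E.tensor F).sub_le_dom ij (w m).2⟩ : (E.tensor F).dom),
      (algTensorMap φ ψ (star (a m) * a m')).1 ⟨w m', (E.tensor F).sub_le_dom ij (w m').2⟩⟫_ℂ)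
      rfl ?_
    rw [hw', hw', map_sum, sum_inner, sum_inner]
    refine Finset.sum_congr rfl fun r _ => ?_
    rw [inner_sum, inner_sum]
    refine Finset.sum_congr rfl fun r' _ => ?_
    rw [hG' _ ⟨m, r⟩ ⟨m', r'⟩, inner_repTensor, map_mul]
    rfl
  change 0 ≤ Q w
  rw [key]
  refine le_of_le_of_eq ?_ (inner_self_eq_norm_sq_to_K (𝕜 := ℂ)
    (∑ s : Σ m, Fin (N m), repTensor π ρ (a s.1) (G (e s)))).symm
  rw [← RCLike.ofReal_pow]
  exact RCLike.ofReal_nonneg.2 (sq_nonneg _)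

theorem algTensorMap_le_one {φ : A →ₗ[ℂ] CStarOps E} {ψ : B →ₗ[ℂ] CStarOps F}
    (hφ : IsFormCPCC p φ) (hψ : IsFormCPCC q ψ) (z : (E.tensor F).dom) :
    (⟪z, (algTensorMap φ ψ 1).1 z⟫_ℂ).re ≤ ‖z‖ ^ 2 := by
  obtain ⟨ij, hz⟩ := (E.tensor F).mem_dom.1 z.2
  have h1 : CStarOps.seminorm E ij.1 (φ 1) ≤ 1 :=
    CStarOps.seminorm_le_of_form zero_le_one (fun x _ => hφ.pos.nonneg_one x)
      fun x _ => by rw [one_mul]; exact hφ.le_one x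
  have h2 : CStarOps.seminorm F ij.2 (ψ 1) ≤ 1 :=
    CStarOps.seminorm_le_of_form zero_le_one (fun x _ => hψ.pos.nonneg_one x)
      fun x _ => by rw [one_mul]; exact hψ.le_one x
  have h3 : CStarOps.seminorm (E.tensor F) ij (algTensorMap φ ψ 1) ≤ 1 :=
    (seminorm_tensorOp_le (φ 1) (ψ 1) ij).trans (mul_le_one₀ h1 (apply_nonneg _ _) h2)
  calc (⟪z, (algTensorMap φ ψ 1).1 z⟫_ℂ).re ≤ ‖⟪z, (algTensorMap φ ψ 1).1 z⟫_ℂ‖ :=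
        Complex.re_le_norm _
    _ ≤ ‖z‖ * ‖(algTensorMap φ ψ 1).1 z‖ := norm_inner_le_norm _ _
    _ ≤ ‖z‖ * (1 * ‖z‖) := by
        gcongr
        exact (CStarOps.norm_apply_le ij _ hz).trans (by gcongr)
    _ = ‖z‖ ^ 2 := by ring

/-- The constants in the bounds of `φ` and `ψ` drop out. They serve only to build `π` and `ρ`, while
the length of the representing vector is controlled by `⟪z, (φ ⊗ ψ)(1) z⟫ ≤ ‖z‖²`. -/
theorem exists_seminorm_algTensorMap_le (hp : ∀ l, IsCStarSeminorm (p l))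
    (hq : ∀ d, IsCStarSeminorm (q d)) {φ : A →ₗ[ℂ] CStarOps E} {ψ : B →ₗ[ℂ] CStarOps F}
    (hφ : IsFormCPCC p φ) (hψ : IsFormCPCC q ψ) (ij : ι × κ) : ∃ ld : Λ × Δ, ∀ x,
      CStarOps.seminorm (E.tensor F) ij (algTensorMap φ ψ x) ≤
        spatialNorm (p ld.1) (q ld.2) x := by
  obtain ⟨l, C, -, hC⟩ := hφ.bdd ij.1
  obtain ⟨d, D, -, hD⟩ := hψ.bdd ij.2
  refine ⟨(l, d), fun x => ?_⟩
  have hle := algTensorMap_le_one hφ hψ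
  have hform : ∀ (x : A ⊗[ℂ] B) (w : (E.tensor F).sub ij),
      ‖⟪w, CStarOps.restr ij (algTensorMap φ ψ x) w⟫_ℂ‖ ≤
        spatialNorm (p l) (q d) x * ‖w‖ ^ 2 := by
    intro x w
    refine closure_minimal (s := finiteTensors E F ij)
      (t := {w | ‖⟪w, CStarOps.restr ij (algTensorMap φ ψ x) w⟫_ℂ‖ ≤
        spatialNorm (p l) (q d) x * ‖w‖ ^ 2}) (fun w hw => ?_)
      (isClosed_le (by fun_prop) (by fun_prop)) (dense_finiteTensors ij w)
    obtain ⟨N, ξ, η, hξ, hη, hw'⟩ := exists_sum_dtmul hw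
    obtain ⟨π, ρ, G, hG⟩ := exists_rep_algTensorMap (hp l) (hq d) hφ.pos hψ.pos hC hD ξ η hξ hη
    set z : (E.tensor F).dom := ⟨w, (E.tensor F).sub_le_dom ij w.2⟩ with hzdef
    have hz : ∀ x, ⟪z, (algTensorMap φ ψ x).1 z⟫_ℂ = ⟪∑ s, G s, repTensor π ρ x (∑ s, G s)⟫_ℂ := by
      intro x
      rw [hw', map_sum, map_sum, sum_inner, sum_inner]
      refine Finset.sum_congr rfl fun s _ => ?_
      rw [inner_sum, inner_sum]
      exact Finset.sum_congr rfl fun s' _ => hG x s s'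
    have h1 : ‖∑ s, G s‖ ^ 2 ≤ ‖z‖ ^ 2 := by
      refine le_trans (le_of_eq ?_) (hle z)
      rw [hz, map_one]
      exact (inner_self_eq_norm_sq (𝕜 := ℂ) _).symm
    change ‖⟪z, (algTensorMap φ ψ x).1 z⟫_ℂ‖ ≤ spatialNorm (p l) (q d) x * ‖z‖ ^ 2
    rw [hz]
    calc _ ≤ ‖∑ s, G s‖ * ‖repTensor π ρ x (∑ s, G s)‖ := norm_inner_le_norm _ _
      _ ≤ ‖∑ s, G s‖ * (spatialNorm (p l) (q d) x * ‖∑ s, G s‖) := by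
          gcongr
          exact (ContinuousLinearMap.le_opNorm _ _).trans
            (mul_le_mul_of_nonneg_right (norm_repTensor_le π ρ x) (norm_nonneg _))
      _ = spatialNorm (p l) (q d) x * ‖∑ s, G s‖ ^ 2 := by ring
      _ ≤ _ := mul_le_mul_of_nonneg_left h1 (spatialNorm_nonneg x)
  refine CStarOps.seminorm_le (spatialNorm_nonneg x) fun z hz => ?_
  refine (sq_le_sq₀ (norm_nonneg _) (mul_nonneg (spatialNorm_nonneg x) (norm_nonneg _))).1 ?_
  -- The Schwarz inequality bounds `‖(φ ⊗ ψ)(x) z‖²` by the quadratic form at `x* x`; the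
  -- `C*`-identity of the spatial norm then gives the operator bound.
  have h1 := (isFormPos_algTensorMap hp hq hφ hψ).norm_sq_le hle (fun _ : Fin 1 => x) fun _ => z
  simp only [Fin.sum_univ_one] at h1
  refine h1.trans ((Complex.re_le_norm _).trans ((hform (star x * x) ⟨z, hz⟩).trans_eq ?_))
  rw [spatialNorm_star_mul_self, mul_pow]
  rfl

end AlgTensorMap

/-! ### Extension to the minimal tensor product -/

section Extension

variable {A : Type*} [Ring A] [StarRing A] [Algebra ℂ A] [StarModule ℂ A] {Λ : Type*}
  {p : Λ → Seminorm ℂ A} {B : Type*} [Ring B] [StarRing B] [Algebra ℂ B] [StarModule ℂ B]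
  {Δ : Type*} {q : Δ → Seminorm ℂ B}

theorem SpatialCompletion.dense_range_of (p : Seminorm ℂ A) (q : Seminorm ℂ B) :
    DenseRange (SpatialCompletion.of p q) := fun z =>
  SpatialCompletion.induction (P := fun z => z ∈ closure (Set.range (SpatialCompletion.of p q)))
    isClosed_closure (fun x => subset_closure ⟨x, rfl⟩) z

theorem SpatialCompletion.continuous_smul' {p : Seminorm ℂ A} {q : Seminorm ℂ B} (c : ℂ) :
    Continuous fun z : SpatialCompletion p q => c • z := by
  simp_rw [Algebra.smul_def]; fun_prop

theorem SpatialCompletion.exists_extension {p : Seminorm ℂ A} {q : Seminorm ℂ B} {V : Type*}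
    [NormedAddCommGroup V] [NormedSpace ℂ V] [CompleteSpace V] (f : A ⊗[ℂ] B →ₗ[ℂ] V)
    (hf : ∀ x, ‖f x‖ ≤ spatialNorm p q x) :
    ∃ g : SpatialCompletion p q →ₗ[ℂ] V, Continuous g ∧ (∀ x, g (SpatialCompletion.of p q x) = f x)
      ∧ ∀ z, ‖g z‖ ≤ ‖z‖ := by
  let f' : SpatialTensor p q →ₗ[ℂ] V := f
  have hu : UniformContinuous f' :=
    (LinearMap.mkContinuous f' 1 fun x => by rw [one_mul]; exact hf x).uniformContinuous
  let g : SpatialCompletion p q → V := UniformSpace.Completion.extension f'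
  have hg : Continuous g := UniformSpace.Completion.continuous_extension
  have hgo : ∀ x, g (SpatialCompletion.of p q x) = f x := fun x =>
    UniformSpace.Completion.extension_coe hu x
  refine ⟨{ toFun := g, map_add' := fun z w => ?_, map_smul' := fun c z => ?_ }, hg, hgo, ?_⟩
  · refine SpatialCompletion.induction (P := fun z => g (z + w) = g z + g w)
      (isClosed_eq (by fun_prop) (by fun_prop)) (fun x => ?_) z
    refine SpatialCompletion.induction
      (P := fun w => g (SpatialCompletion.of p q x + w) = g (SpatialCompletion.of p q x) + g w)
      (isClosed_eq (by fun_prop) (by fun_prop)) (fun y => ?_) w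
    rw [← map_add, hgo, hgo, hgo, map_add]
  · refine SpatialCompletion.induction (P := fun z => g (c • z) = c • g z)
      (isClosed_eq (hg.comp (continuous_smul' c)) (by fun_prop)) (fun x => ?_) z
    rw [← map_smul, hgo, hgo, map_smul]
  · exact SpatialCompletion.induction (P := fun z => ‖g z‖ ≤ ‖z‖)
      (isClosed_le (by fun_prop) (by fun_prop)) fun x => by
        rw [hgo, SpatialCompletion.norm_of]; exact hf x

theorem MinTensor.induction {P : (∀ ld : Λ × Δ, SpatialCompletion (p ld.1) (q ld.2)) → Prop}
    (hc : IsClosed {w | P w}) (h : ∀ x, P (diag p q x)) (z : MinTensor p q) : P z.1 :=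
  closure_minimal (s := Set.range (diag p q)) (by rintro _ ⟨x, rfl⟩; exact h x) hc z.2

variable {ι H : Type*} [NormedAddCommGroup H] [InnerProductSpace ℂ H] [CompleteSpace H]
  [Nonempty ι] {E : QuantizedDomain ι H}

/-- A positive map on the algebraic tensor product which is bounded for the spatial seminorms
extends to the minimal tensor product. -/
theorem MinTensor.exists_extension {Φ₀ : A ⊗[ℂ] B →ₗ[ℂ] CStarOps E} (hpos : IsFormPos Φ₀)
    (hone : ∀ x, (⟪x, (Φ₀ 1).1 x⟫_ℂ).re ≤ ‖x‖ ^ 2)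
    (hb : ∀ k, ∃ ld : Λ × Δ, ∀ x, CStarOps.seminorm E k (Φ₀ x) ≤ spatialNorm (p ld.1) (q ld.2) x) :
    ∃ Φ : MinTensor p q →ₗ[ℂ] CStarOps E, IsFormCPCC (MinTensor.seminorm p q) Φ ∧
      ∀ x, Φ (MinTensor.of p q x) = Φ₀ x := by
  -- The component on `H_k` involves only the coordinate `ld k`, so it extends to that one
  -- completion. The extensions are coherent by density and are glued by
  -- `CStarOps.exists_of_family`, with adjoints from `star z`.
  choose ld hld using hb
  choose G hGc hGof hGn using fun k => SpatialCompletion.exists_extension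
    (p := p (ld k).1) (q := q (ld k).2) (V := E.sub k →L[ℂ] E.sub k)
    (CStarOps.restr k ∘ₗ Φ₀) (hld k)
  have hfam : ∀ z : MinTensor p q, ∃ T : CStarOps E, ∀ k, CStarOps.restr k T = G k (z.1 (ld k)) := by
    have hcoh : ∀ (z : MinTensor p q) k l (h : E.sub k ≤ E.sub l) (x : E.sub k),
        (G l (z.1 (ld l)) ⟨x, h x.2⟩ : H) = G k (z.1 (ld k)) x := by
      intro z k l h x
      refine MinTensor.induction
        (P := fun w => (G l (w (ld l)) ⟨x, h x.2⟩ : H) = G k (w (ld k)) x)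
        (isClosed_eq (by fun_prop) (by fun_prop)) (fun y => ?_) z
      change (G l (SpatialCompletion.of _ _ y) ⟨x, h x.2⟩ : H) = G k (SpatialCompletion.of _ _ y) x
      rw [hGof, hGof]
      rfl
    refine fun z => CStarOps.exists_of_family _ (fun k => G k ((star z).1 (ld k))) (hcoh z)
      (hcoh (star z)) fun k x y => ?_
    change ⟪G k (z.1 (ld k)) x, y⟫_ℂ = ⟪x, G k (star (z.1 (ld k))) y⟫_ℂ
    refine SpatialCompletion.induction
      (P := fun w => ⟪G k w x, y⟫_ℂ = ⟪x, G k (star w) y⟫_ℂ)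
      (isClosed_eq (by fun_prop) (by fun_prop)) (fun t => ?_) (z.1 (ld k))
    rw [SpatialCompletion.star_of, hGof, hGof, LinearMap.comp_apply, LinearMap.comp_apply,
      hpos.map_star, CStarOps.restr_star, ContinuousLinearMap.adjoint_inner_right]
  choose T hT using hfam
  let Φ : MinTensor p q →ₗ[ℂ] CStarOps E :=
    { toFun := T
      map_add' := fun z w => CStarOps.ext_restr fun k => by
        rw [map_add, hT, hT, hT, ← map_add]; rfl
      map_smul' := fun c z => CStarOps.ext_restr fun k => by
        rw [map_smul, hT, hT, RingHom.id_apply, ← map_smul]; rfl }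
  have hΦ : ∀ k z, CStarOps.restr k (Φ z) = G k (z.1 (ld k)) := fun k z => hT z k
  have hof : ∀ x, Φ (MinTensor.of p q x) = Φ₀ x := fun x => CStarOps.ext_restr fun k =>
    (hΦ k _).trans (hGof k x)
  refine ⟨Φ, ⟨fun n a x => ?_, fun k => ⟨ld k, 1, zero_le_one, fun z => ?_⟩, fun x => ?_⟩, hof⟩
  · obtain ⟨k, hk⟩ := CStarOps.exists_common_sub x
    let y : Fin n → E.sub k := fun i => ⟨x i, hk i⟩
    let Q : (Fin n → SpatialCompletion (p (ld k).1) (q (ld k).2)) → ℂ := fun w =>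
      ∑ i, ∑ j, ⟪y i, G k (star (w i) * w j) (y j)⟫_ℂ
    have hQ : ∑ i, ∑ j, ⟪x i, (Φ (star (a i) * a j)).1 (x j)⟫_ℂ = Q fun i => (a i).1 (ld k) := by
      refine Finset.sum_congr rfl fun i _ => Finset.sum_congr rfl fun j _ => ?_
      exact congrArg (fun R : E.sub k →L[ℂ] E.sub k => ⟪y i, R (y j)⟫_ℂ)
        (hΦ k (star (a i) * a j))
    rw [hQ]
    -- For fixed vectors of `H_k`, positivity is a closed condition on the coordinates at `ld k`, so
    -- it may be checked on the algebraic tensor product.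
    have hclosed : IsClosed {w | 0 ≤ Q w} := isClosed_le continuous_const (by fun_prop)
    refine closure_minimal (s := Set.univ.pi fun _ => Set.range (SpatialCompletion.of _ _))
      (fun w hw => ?_) hclosed
      (dense_pi Set.univ (fun _ _ => SpatialCompletion.dense_range_of _ _) _)
    choose b hb using fun i => hw i (Set.mem_univ i)
    have hQ' : Q w = ∑ i, ∑ j, ⟪x i, (Φ₀ (star (b i) * b j)).1 (x j)⟫_ℂ := by
      refine Finset.sum_congr rfl fun i _ => Finset.sum_congr rfl fun j _ => ?_
      rw [← hb, ← hb, SpatialCompletion.star_of, ← map_mul, hGof]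
      rfl
    change 0 ≤ Q w
    rw [hQ']
    exact hpos n b x
  · rw [CStarOps.seminorm_apply, hΦ, one_mul]
    exact hGn k _
  · rw [← MinTensor.of_one, hof]
    exact hone x

end Extension

/-! ### The tensor product of two maps on the minimal tensor product -/

section TensorMap

variable {A : Type*} [Ring A] [StarRing A] [Algebra ℂ A] [StarModule ℂ A] {Λ : Type*}
  {p : Λ → Seminorm ℂ A} {B : Type*} [Ring B] [StarRing B] [Algebra ℂ B] [StarModule ℂ B]
  {Δ : Type*} {q : Δ → Seminorm ℂ B}
  {ι κ H K : Type*} [NormedAddCommGroup H] [InnerProductSpace ℂ H] [CompleteSpace H]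
  [NormedAddCommGroup K] [InnerProductSpace ℂ K] [CompleteSpace K] [Nonempty ι] [Nonempty κ]
  {E : QuantizedDomain ι H} {F : QuantizedDomain κ K}

theorem exists_isTensorMap (hp : ∀ l, IsCStarSeminorm (p l)) (hq : ∀ d, IsCStarSeminorm (q d))
    {φ : A →ₗ[ℂ] CStarOps E} {ψ : B →ₗ[ℂ] CStarOps F} (hφ : IsFormCPCC p φ)
    (hψ : IsFormCPCC q ψ) : ∃ Φ, IsTensorMap p q φ ψ Φ := by
  obtain ⟨Φ, hΦ, h⟩ := MinTensor.exists_extension (isFormPos_algTensorMap hp hq hφ hψ)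
    (algTensorMap_le_one hφ hψ) (exists_seminorm_algTensorMap_le hp hq hφ hψ)
  exact ⟨Φ, hΦ.isLocalCPCC MinTensor.isCStarSeminorm, fun a b => h (a ⊗ₜ b)⟩

theorem isTensorMap_tensorMap {φ : A →ₗ[ℂ] CStarOps E} {ψ : B →ₗ[ℂ] CStarOps F}
    (h : ∃ Φ, IsTensorMap p q φ ψ Φ) : IsTensorMap p q φ ψ (tensorMap p q φ ψ) := by
  rw [tensorMap, dif_pos h]
  exact h.choose_spec

theorem IsTensorMap.eq_tensorMap {φ : A →ₗ[ℂ] CStarOps E} {ψ : B →ₗ[ℂ] CStarOps F}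
    {Φ : MinTensor p q →ₗ[ℂ] CStarOps (E.tensor F)} (h : IsTensorMap p q φ ψ Φ) :
    Φ = tensorMap p q φ ψ := by
  have h' := isTensorMap_tensorMap ⟨Φ, h⟩
  refine MinTensor.ext_of_isLocBounded (h.1.isFormCPCC MinTensor.isCStarSeminorm).bdd
    (h'.1.isFormCPCC MinTensor.isCStarSeminorm).bdd fun a b => ?_
  rw [h.2, h'.2]

end TensorMap

theorem IsLocallyCStarAlgebra.isCStarSeminorm {A Λ : Type*} [Nonempty Λ] [Ring A] [StarRing A]
    [Algebra ℂ A] [UniformSpace A] {p : Λ → Seminorm ℂ A} (h : IsLocallyCStarAlgebra p) (l : Λ) :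
    IsCStarSeminorm (p l) := ⟨h.mul_le l, h.star_mul_self l⟩

end LocCStar

end

open LocCStar in
/-- Let `A`, `B` be unital locally `C*`-algebras, `φ ∈ CPCC_loc(A, C*(D_E))` pure,
`ψ ∈ CPCC_loc(B, C*(D_F))` and `χ ∈ CPCC_loc(A ⊗ B, C*(D_{E ⊗ F}))`. If `χ` is dominated by
`φ ⊗ ψ`, then `χ = φ ⊗ ψ'` for some `ψ' ∈ CPCC_loc(B, C*(D_F))` dominated by `ψ`. -/
theorem mainTheorem3
    {A : Type*} [Ring A] [StarRing A] [Algebra ℂ A] [StarModule ℂ A] [UniformSpace A]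
    {Λ : Type*} [Nonempty Λ] (p : Λ → Seminorm ℂ A) (hA : IsLocallyCStarAlgebra p)
    {B : Type*} [Ring B] [StarRing B] [Algebra ℂ B] [StarModule ℂ B] [UniformSpace B]
    {Δ : Type*} [Nonempty Δ] (q : Δ → Seminorm ℂ B) (hB : IsLocallyCStarAlgebra q)
    {H : Type*} [NormedAddCommGroup H] [InnerProductSpace ℂ H] [CompleteSpace H]
    {ι : Type*} [Nonempty ι] (E : QuantizedDomain ι H)
    {K : Type*} [NormedAddCommGroup K] [InnerProductSpace ℂ K] [CompleteSpace K]
    {κ : Type*} [Nonempty κ] (F : QuantizedDomain κ K)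
    (φ : A →ₗ[ℂ] CStarOps E) (hφ : IsLocalCPCC p φ)
    (ψ : B →ₗ[ℂ] CStarOps F) (hψ : IsLocalCPCC q ψ)
    (χ : MinTensor p q →ₗ[ℂ] CStarOps (E.tensor F))
    (hχ : IsLocalCPCC (MinTensor.seminorm p q) χ)
    (hdom : IsDominated (MinTensor.seminorm p q) χ (tensorMap p q φ ψ))
    (hpure : IsPure p φ) :
    ∃ ψ' : B →ₗ[ℂ] CStarOps F, IsLocalCPCC q ψ' ∧ IsDominated q ψ' ψ ∧
      χ = tensorMap p q φ ψ' ∧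
      ∀ a b, χ (MinTensor.tmul p q a b) = tensorOp (φ a) (ψ' b) := by
  have hp := hA.isCStarSeminorm
  have hq := hB.isCStarSeminorm
  have hφ' := hφ.isFormCPCC hp
  have hψ' := hψ.isFormCPCC hq
  -- Existence rules out the default value `0` of `tensorMap`, so `hdom` is domination by the true
  -- `φ ⊗ ψ`.
  have hΦ := isTensorMap_tensorMap (exists_isTensorMap hp hq hφ' hψ')
  obtain ⟨ψ', h1, h2, h3⟩ := exists_factor hp hpure hφ' hψ' hΦ.2
    (hχ.isFormCPCC MinTensor.isCStarSeminorm)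
    (IsLocalCPCC.isFormCPCC MinTensor.isCStarSeminorm hdom)
  -- As `χ` is itself a tensor product map of `φ` and `ψ'`, uniqueness identifies it with `tensorMap
  -- p q φ ψ'`.
  exact ⟨ψ', h1.isLocalCPCC hq, h2.isLocalCPCC hq, IsTensorMap.eq_tensorMap ⟨hχ, h3⟩, h3⟩
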